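/- **Setting.** Let $p_{i,j}\ge 0$, $(i,j)\in\{-1,0,1\}^2$, be step probabilities ($\sum p_{i,j}=1$) with zero drift, $\sum i\,p_{i,j}=\sum j\,p_{i,j}=0$, and non-degenerate: the list $p_{1,1},p_{1,0},p_{1,-1},p_{0,-1},p_{-1,-1},p_{-1,0},p_{-1,1},p_{0,1}$ has no three consecutive zeros. Put $\sigma_{11}=\sum i^2p_{i,j}$, $\sigma_{12}=\sum ij\,p_{i,j}$, $\sigma_{22}=\sum j^2p_{i,j}$, $\theta=\arccos\bigl(-\sigma_{12}/\sqrt{\sigma_{11}\sigma_{22}}\bigr)$, and assume that $m:=\pi/\theta$ is an integer. *Discrete side.* Let $K(x,y)=xy\bigl(\sum p_{i,j}x^{-i}y^{-j}-1\bigr)=a(x)y^2+b(x)y+c(x)=\tilde a(y)x^2+\tilde b(y)x+\tilde c(y)$, let $X_\pm(y)$ and $Y_\pm(x)$ be the solutions of $K(\cdot,y)=0$ and $K(x,\cdot)=0$, and let $\Phi(x,y)=\bigl(x^{-1}\tilde c(y)/\tilde a(y),y\bigr)$, $\Psi(x,y)=\bigl(x,y^{-1}c(x)/a(x)\bigr)$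 be the generators of the group of the walk. Let $\Theta$ be the substitution operator $(\Theta M)(x,y)=M\bigl(\Psi(\Phi(x,y))\bigr)$. Let $\omega$ be the conformal gluing function of the walk: a rational function whose only pole on the Riemann sphere is at $1$ and has order $m$, with $\omega(0)=0$ and $\omega(X_+)=\omega(X_-)$. For $k\ge 1$ let $d_0=\omega(X_+(0))$, $P_{2j}(z)=z^j(z-d_0)^j$, $P_{2j+1}(z)=z^{j+1}(z-d_0)^j$, and define $$H_1^k(x,y)=\frac{P_k(\omega(x))-P_k(\omega(X_+))}{K(x,y)},\qquad H_{n+1}^k(x,y)=\frac{xyH_n^k(x,y)-F_n^k(x)-\bigl[X_+yH_n^k(X_+,y)-F_n^k(X_+)\bigr]}{K(x,y)},$$ where, when the group is finite of order $2N$, $F_n^k$ is the function $$F_n^k(x)=-\frac1N\sum_{i=1}^{N-1} i\,\Theta^i\bigl[M(x,Y_+)+M(x,Y_-)\bigr],\qquad M=xyH_n^k .$$ *Continuous side.* Let $\gamma(x,y)=\tfrac12(\sigma_{11}x^2+2\sigma_{12}xy+\sigma_{22}y^2)$ and $c_\pm=\sqrt{\sigma_{22}/\sigma_{11}}\,e^{\pm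 i\theta}$, so that $\gamma(c_\pm y,y)=0$. For $k\ge1$ and constants $a_1,a_2,\dots\in\mathbb C$ put $f_n(x)=a_n/x^{km+2n}$ and $$L(h_1^k)(x,y)=\frac{x^{-km}-(c_+y)^{-km}}{\gamma(x,y)},\qquad L(h_{n+1}^k)(x,y)=\frac{L(h_n^k)(x,y)-f_n(x)-\bigl[L(h_n^k)(c_+y,y)-f_n(c_+y)\bigr]}{\gamma(x,y)} .$$ A function $f$ decouples $L(h_n^k)$ if $f(c_+y)-f(c_-y)=L(h_n^k)(c_+y,y)-L(h_n^k)(c_-y,y)$. **Theorem.** 1. *(The continuous ansatz always works.)* Let $k,n\ge1$ and suppose that $f_1,\dots,f_{n-1}$ decouple $L(h_1^k),\dots,L(h_{n-1}^k)$. Then $L(h_n^k)$ is regular at $(c_\pm y,y)$ for generic $y$, and there is a constant $\alpha$ such that $\alpha/x^{km+2n}$ decouples $L(h_n^k)$; if $m\nmid 2n$, then $\alpha$ is unique. 2. The function $\omega$ exists and is unique up to a nonzero constant factor. 3. *(Convergence.)* Suppose that the group of the walk is finite. Then $\omega(X_+)$ is a rational function of $y$, and for every $k\ge1$ the discrete recursion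 is well defined: for every $n\geq 1$, $xyH_n^k$ is regular at the points where it is evaluated, $F_n^k$ and $X_+yH_n^k(X_+,y)-F_n^k(X_+)$ are rational functions of $x$ and of $y$ respectively, and $F_n^k$ is a decoupling function of $xyH_n^k$, that is, $X_+yH_n^k(X_+,y)-F_n^k(X_+)=X_-yH_n^k(X_-,y)-F_n^k(X_-)$. Moreover there are constants $a_n$ and $\alpha_{n,k}\ne0$ $(n\ge1)$ such that, for every $n\ge1$, $f_n(x)=a_n/x^{km+2n}$ decouples $L(h_n^k)$ and, for all nonzero $x,y\in\mathbb C$, as $\mu\to0$ ($\mu\in\mathbb R\setminus\{0\}$), $$\mu^{k\pi/\theta+2n}F_n^k(e^{-\mu x})\to\alpha_{n,k}f_n(x),\qquad \mu^{k\pi/\theta+2n}H_n^k(e^{-\mu x},e^{-\mu y})\to\alpha_{n,k}\,L(h_n^k)(x,y).$$ -/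

import Mathlib

open Filter Topology

noncomputable section

/-! ### Rational functions, algebraic functions and their values -/

/-- The field `ℂ(x, y)` of rational functions in two variables. -/
abbrev Rat2 : Type := FractionRing (MvPolynomial (Fin 2) ℂ)

/-- An algebraic closure of the field of rational functions in one variable `t`. It contains the
algebraic functions `X_±(t)` and `Y_±(t)`. -/
abbrev AlgFun : Type := AlgebraicClosure (RatFunc ℂ)

/-- The variable `x` of `ℂ(x, y)`. -/
def xvar : Rat2 := algebraMap (MvPolynomial (Fin 2) ℂ) Rat2 (MvPolynomial.X 0)

/-- The variable `y` of `ℂ(x, y)`. -/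
def yvar : Rat2 := algebraMap (MvPolynomial (Fin 2) ℂ) Rat2 (MvPolynomial.X 1)

/-- The variable `t`, seen as an algebraic function. -/
def tvar : AlgFun := algebraMap (RatFunc ℂ) AlgFun RatFunc.X

/-- The (reduced) denominator of `M` does not vanish at the point `(u, v)`. -/
def RegularAt {L : Type*} [Field L] [Algebra ℂ L] (M : Rat2) (u v : L) : Prop :=
  MvPolynomial.aeval ![u, v]
    ((IsFractionRing.den (MvPolynomial (Fin 2) ℂ) M : MvPolynomial (Fin 2) ℂ)) ≠ 0

/-- The value `M(u, v)` of a rational function (written in lowest terms) at a point with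
coordinates in a field extension of `ℂ`. -/
def eval2 {L : Type*} [Field L] [Algebra ℂ L] (M : Rat2) (u v : L) : L :=
  MvPolynomial.aeval ![u, v] (IsFractionRing.num (MvPolynomial (Fin 2) ℂ) M) /
    MvPolynomial.aeval ![u, v]
      ((IsFractionRing.den (MvPolynomial (Fin 2) ℂ) M : MvPolynomial (Fin 2) ℂ))

/-- The value `f(u)` of a rational function of one variable (written in lowest terms) at a point
of a field extension of `ℂ`. -/
def eval1 {L : Type*} [Field L] [Algebra ℂ L] (f : RatFunc ℂ) (u : L) : L :=
  Polynomial.aeval u f.num / Polynomial.aeval u f.denom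

/-- The algebraic function `z` is a rational function. -/
def IsRationalFun (z : AlgFun) : Prop := z ∈ Set.range (algebraMap (RatFunc ℂ) AlgFun)

/-- An algebraic function that happens to be rational, as an element of `ℂ(t)`. -/
def toRat (z : AlgFun) : RatFunc ℂ := Function.invFun (algebraMap (RatFunc ℂ) AlgFun) z

/-- A square root of an algebraic function. -/
def algSqrt (z : AlgFun) : AlgFun :=
  (IsAlgClosed.exists_pow_nat_eq z (n := 2) two_pos).choose

/-! ### Weighted small step walks -/

/-- A walk with small steps: the step `(i, j)` has probability `p i j`. -/
structure Walk where
  p : ℤ → ℤ → ℝ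
  nonneg : ∀ i j, 0 ≤ p i j
  small : ∀ i j, p i j ≠ 0 → |i| ≤ 1 ∧ |j| ≤ 1
  sum_one : ∑ i ∈ Finset.Icc (-1 : ℤ) 1, ∑ j ∈ Finset.Icc (-1 : ℤ) 1, p i j = 1

namespace Walk

variable (W : Walk)

/-- The list of the eight weights around the origin has no three consecutive zeros. -/
def NonDegenerate : Prop :=
  ¬ [0, 0, 0] <:+: [W.p 1 1, W.p 1 0, W.p 1 (-1), W.p 0 (-1), W.p (-1) (-1), W.p (-1) 0,
    W.p (-1) 1, W.p 0 1]

/-- The expectation of `f` of one step. -/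
def mean (f : ℤ → ℤ → ℝ) : ℝ :=
  ∑ i ∈ Finset.Icc (-1 : ℤ) 1, ∑ j ∈ Finset.Icc (-1 : ℤ) 1, f i j * W.p i j

def ZeroDrift : Prop := W.mean (fun i _ => i) = 0 ∧ W.mean (fun _ j => j) = 0

def sigma11 : ℝ := W.mean (fun i _ => (i : ℝ) ^ 2)
def sigma12 : ℝ := W.mean (fun i j => (i : ℝ) * j)
def sigma22 : ℝ := W.mean (fun _ j => (j : ℝ) ^ 2)

/-- The angle `θ` of the walk. -/
def theta : ℝ := Real.arccos (-(W.sigma12 / (√W.sigma11 * √W.sigma22)))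

section Kernel

variable {L : Type*} [Field L] [Algebra ℂ L]

/-- The weight `p i j` as an element of a field extension of `ℂ`. -/
def wt (L : Type*) [Field L] [Algebra ℂ L] (i j : ℤ) : L := algebraMap ℂ L (W.p i j : ℂ)

/-- The kernel `K(u, v) = u v (∑ p_{i,j} u^{-i} v^{-j} - 1)`, multiplied out. -/
def kernel (u v : L) : L :=
  (∑ i ∈ Finset.Icc (-1 : ℤ) 1, ∑ j ∈ Finset.Icc (-1 : ℤ) 1,
    W.wt L i j * u ^ (1 - i) * v ^ (1 - j)) - u * v

/-! `K(u, v) = a(u) v² + b(u) v + c(u) = ã(v) u² + b̃(v) u + c̃(v)`. -/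

def ca (u : L) : L := ∑ i ∈ Finset.Icc (-1 : ℤ) 1, W.wt L i (-1) * u ^ (1 - i)
def cb (u : L) : L := (∑ i ∈ Finset.Icc (-1 : ℤ) 1, W.wt L i 0 * u ^ (1 - i)) - u
def cc (u : L) : L := ∑ i ∈ Finset.Icc (-1 : ℤ) 1, W.wt L i 1 * u ^ (1 - i)
def cat (v : L) : L := ∑ j ∈ Finset.Icc (-1 : ℤ) 1, W.wt L (-1) j * v ^ (1 - j)
def cbt (v : L) : L := (∑ j ∈ Finset.Icc (-1 : ℤ) 1, W.wt L 0 j * v ^ (1 - j)) - v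
def cct (v : L) : L := ∑ j ∈ Finset.Icc (-1 : ℤ) 1, W.wt L 1 j * v ^ (1 - j)

/-- The birational involution `Φ : (x, y) ↦ (x⁻¹ c̃(y) / ã(y), y)`. -/
def Phi (q : L × L) : L × L := (q.1⁻¹ * (W.cct q.2 / W.cat q.2), q.2)

/-- The birational involution `Ψ : (x, y) ↦ (x, y⁻¹ c(x) / a(x))`. -/
def Psi (q : L × L) : L × L := (q.1, q.2⁻¹ * (W.cc q.1 / W.ca q.1))

/-- The map on points for which `M ∘ Theta` is the image of the rational function `M` under the
composition `Φ ∘ Ψ` of the substitution operators `M ↦ M ∘ Φ` and `M ↦ M ∘ Ψ`. -/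
def Theta (q : L × L) : L × L := W.Psi (W.Phi q)

end Kernel

/-- The group generated by the birational maps `Φ` and `Ψ` is finite, that is, some positive
iterate of `Theta` fixes the generic point `(x, y)`. -/
def FiniteGroup : Prop := (xvar, yvar) ∈ Function.periodicPts (W.Theta (L := Rat2))

/-- Half the order of the group, that is, the order of `Theta`. -/
def halfOrder : ℕ := Function.minimalPeriod (W.Theta (L := Rat2)) (xvar, yvar)

/-! The two solutions `X_±` of `K(X, t) = 0` and the two solutions `Y_±` of `K(t, Y) = 0`. -/

def Xp : AlgFun :=
  (-W.cbt tvar + algSqrt (W.cbt tvar ^ 2 - 4 * W.cat tvar * W.cct tvar)) / (2 * W.cat tvar)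
def Xm : AlgFun :=
  (-W.cbt tvar - algSqrt (W.cbt tvar ^ 2 - 4 * W.cat tvar * W.cct tvar)) / (2 * W.cat tvar)
def Yp : AlgFun :=
  (-W.cb tvar + algSqrt (W.cb tvar ^ 2 - 4 * W.ca tvar * W.cc tvar)) / (2 * W.ca tvar)
def Ym : AlgFun :=
  (-W.cb tvar - algSqrt (W.cb tvar ^ 2 - 4 * W.ca tvar * W.cc tvar)) / (2 * W.ca tvar)

/-! ### The discrete recursion -/

/-- For `π / θ = m` an integer, the conformal gluing function `ω` of the walk: it is rational, its
only pole on the Riemann sphere is at `1` and has order `m`, and `ω(0) = 0`, `ω(X_+) = ω(X_-)`. -/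
def IsGluing (m : ℕ) (ω : RatFunc ℂ) : Prop :=
  (∃ q : Polynomial ℂ, q.natDegree ≤ m ∧ q.eval 1 ≠ 0 ∧
    ω = algebraMap (Polynomial ℂ) (RatFunc ℂ) q / (RatFunc.X - 1) ^ m) ∧
  eval1 ω (0 : ℂ) = 0 ∧ eval1 ω W.Xp = eval1 ω W.Xm

/-- `d₀ = ω(X_+(0))`. -/
def d0 (ω : RatFunc ℂ) : ℂ := eval1 (toRat (eval1 ω W.Xp)) 0

/-- The polynomials `P_{2j}(z) = z^j (z - d₀)^j` and `P_{2j+1}(z) = z^{j+1} (z - d₀)^j`. -/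
def basisPoly {L : Type*} [Field L] [Algebra ℂ L] (d : ℂ) (k : ℕ) (z : L) : L :=
  z ^ ((k + 1) / 2) * (z - algebraMap ℂ L d) ^ (k / 2)

/-- The discrete harmonic function `H_1^k = (P_k(ω(x)) - P_k(ω(X_+(y)))) / K(x, y)`. -/
def harmonic (ω : RatFunc ℂ) (k : ℕ) : Rat2 :=
  (basisPoly (W.d0 ω) k (eval1 ω xvar)
    - eval1 (toRat (basisPoly (W.d0 ω) k (eval1 ω W.Xp))) yvar) / W.kernel xvar yvar

/-- The decoupling function
`F(t) = -(1/N) ∑_{i=1}^{N-1} i Θ^i [M(t, Y_+) + M(t, Y_-)]`, where the group has order `2N`. -/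
def decouplingFun (M : Rat2) : AlgFun :=
  -(1 / (W.halfOrder : AlgFun)) * ∑ i ∈ Finset.Ico 1 W.halfOrder, (i : AlgFun) *
    (eval2 M (W.Theta^[i] (tvar, W.Yp)).1 (W.Theta^[i] (tvar, W.Yp)).2
      + eval2 M (W.Theta^[i] (tvar, W.Ym)).1 (W.Theta^[i] (tvar, W.Ym)).2)

/-- The function `X_+ y H(X_+, y) - F(X_+)` of `y = t`, for `M = x y H`. -/
def remainder (M : Rat2) (F : RatFunc ℂ) : AlgFun := eval2 M W.Xp tvar - eval1 F W.Xp

/-- The discrete polyharmonic functions `H_n^k`, for `n ≥ 1`: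
`H_{n+1} = (x y H_n - F_n(x) - [X_+ y H_n(X_+, y) - F_n(X_+)]) / K(x, y)`. -/
def discH (ω : RatFunc ℂ) (k : ℕ) : ℕ → Rat2
  | 0 => 0
  | 1 => W.harmonic ω k
  | n + 2 =>
    let M : Rat2 := xvar * yvar * discH ω k (n + 1)
    let F : RatFunc ℂ := toRat (W.decouplingFun M)
    (M - eval1 F xvar - eval1 (toRat (W.remainder M F)) yvar) / W.kernel xvar yvar

/-- `x y H_n^k(x, y)`. -/
def discM (ω : RatFunc ℂ) (k n : ℕ) : Rat2 := xvar * yvar * W.discH ω k n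

/-- The decoupling function `F_n^k` of `x y H_n^k`. -/
def discF (ω : RatFunc ℂ) (k n : ℕ) : RatFunc ℂ := toRat (W.decouplingFun (W.discM ω k n))

/-- Step `n` of the discrete recursion is meaningful: all values that occur in it are taken at
points where `x y H_n` is regular, the formula for `F_n` gives a rational function, which is a
decoupling function of `x y H_n`, and the function of `y` subtracted in the numerator is
rational. -/
def DiscStepOK (ω : RatFunc ℂ) (k n : ℕ) : Prop :=
  (∀ i : ℕ, RegularAt (W.discM ω k n) (W.Theta^[i] (tvar, W.Yp)).1 (W.Theta^[i] (tvar, W.Yp)).2 ∧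
    RegularAt (W.discM ω k n) (W.Theta^[i] (tvar, W.Ym)).1 (W.Theta^[i] (tvar, W.Ym)).2) ∧
  RegularAt (W.discM ω k n) W.Xp tvar ∧ RegularAt (W.discM ω k n) W.Xm tvar ∧
  IsRationalFun (W.decouplingFun (W.discM ω k n)) ∧
  IsRationalFun (W.remainder (W.discM ω k n) (W.discF ω k n)) ∧
  eval2 (W.discM ω k n) W.Xp tvar - eval1 (W.discF ω k n) W.Xp
    = eval2 (W.discM ω k n) W.Xm tvar - eval1 (W.discF ω k n) W.Xm

/-! ### The continuous recursion -/

/-- `γ(x, y) = (σ₁₁ x² + 2 σ₁₂ x y + σ₂₂ y²) / 2` as an element of `ℂ(x, y)`. -/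
def gam : Rat2 :=
  algebraMap ℂ Rat2 (1 / 2) * (algebraMap ℂ Rat2 (W.sigma11 : ℂ) * xvar ^ 2
    + 2 * algebraMap ℂ Rat2 (W.sigma12 : ℂ) * xvar * yvar
    + algebraMap ℂ Rat2 (W.sigma22 : ℂ) * yvar ^ 2)

/-- `c_+ = c e^{iθ}` with `c = √(σ₂₂ / σ₁₁)`; the zeros of `γ(·, y)` are `c_± y`. -/
def cplus : ℂ := (√(W.sigma22 / W.sigma11) : ℝ) * Complex.exp (Complex.I * (W.theta : ℂ))

/-- `c_- = c e^{-iθ}`. -/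
def cminus : ℂ := (√(W.sigma22 / W.sigma11) : ℝ) * Complex.exp (-(Complex.I * (W.theta : ℂ)))

/-- `c_+ y` and `c_- y` as elements of `ℂ(x, y)`. -/
def cpy : Rat2 := algebraMap ℂ Rat2 W.cplus * yvar
def cmy : Rat2 := algebraMap ℂ Rat2 W.cminus * yvar

/-- The ansatz `f_n(u) = a / u^d`, where `d = k m + 2 n` and `-d` is the degree of `L(h_n^k)`. -/
def ansatz {L : Type*} [Field L] [Algebra ℂ L] (m k n : ℕ) (a : ℂ) (u : L) : L :=
  algebraMap ℂ L a / u ^ (k * m + 2 * n)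

/-- The functions `L(h_n^k)`, for `n ≥ 1` and `m = π / θ`, built with `ω̂(x) = 1 / x^m` and the
functions `f_n(x) = a_n / x^{k m + 2 n}`:
`L(h_{n+1}) = (L(h_n) - f_n(x) - [L(h_n)(c_+ y, y) - f_n(c_+ y)]) / γ(x, y)`. -/
def contL (m k : ℕ) (a : ℕ → ℂ) : ℕ → Rat2
  | 0 => 0
  | 1 => ((1 / xvar ^ m) ^ k - (1 / W.cpy ^ m) ^ k) / W.gam
  | n + 2 =>
    (contL m k a (n + 1) - ansatz m k (n + 1) (a (n + 1)) xvar
      - (eval2 (contL m k a (n + 1)) W.cpy yvar - ansatz m k (n + 1) (a (n + 1)) W.cpy)) / W.gam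

/-- `f(x) = α / x^{k m + 2 n}` is a decoupling function of `L(h_n^k)`, that is,
`f(c_+ y) - f(c_- y) = L(h_n^k)(c_+ y, y) - L(h_n^k)(c_- y, y)`. -/
def ContDecouples (m k : ℕ) (a : ℕ → ℂ) (n : ℕ) (α : ℂ) : Prop :=
  ansatz m k n α W.cpy - ansatz m k n α W.cmy
    = eval2 (W.contL m k a n) W.cpy yvar - eval2 (W.contL m k a n) W.cmy yvar

end Walk

end

/-!
The discrete recursion degenerates to the continuous one near the point `(1, 1)` of the curve
`K = 0`, where `K(1 - μ x, 1 - μ y) = μ² γ(x, y) + O(μ³)`. The proof makes this algebraic.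

*Decoupling on the discrete side.* If the group is finite, the alternating sum of `x y H_n` over
the orbit of the generic point of the plane is zero: in one step of the recursion, functions of
`x` alone and functions of `y` alone have vanishing orbit sums, and the factor `x y / K` is
invariant (`Walk.OrbitZero.nextM`). Specialized to the points of the curve, this makes the formula
for `F_n` telescope to the decoupling property (`Walk.decouplingSum_sub`). Galois theory shows that
a function of `X_+` and `t` which does not change when `X_+` is replaced by `X_-` is rational; it
also transports identities at `(X_±, t)` to all points of the curve with non-constant coordinates
in any extension of `ℂ` (`Walk.decouples_of_branches`).

*Lowest order terms.* All functions involved have denominators of the form `A(x) B(y)`. For these,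
`HasLead M d Λ` says that `μ^d M(1 - μ x, 1 - μ y)` tends to `Λ(x, y)`. The numerator in the
recursion vanishes on the curve, so that the kernel cancels, and `Λ` is divided by `γ`
(`Walk.HasLead.div_kernel`). There is a sequence of points of the curve that tends to `(1, 1)` in
the direction `(c_+, 1)` (`Walk.exists_isPath`). Modulo an ultrafilter it is a point of the curve
with coordinates in a field, so that all identities on the curve hold along it; in the limit they
show that `F_n` has a pole of order `k m + 2 n` at `1`, and that the decoupling of `x y H_n` becomes
the decoupling of its lowest order term in the directions `(c_±, 1)`
(`Walk.IsPath.lead_decoupling`). Hence one step of the discrete recursion yields one step of the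
continuous recursion (`Walk.hasLead_nextM`).

*The gluing function.* In the coordinates `1 / (x - 1)` and `1 / (y - 1)` the curve is a conic
`S T = const` with asymptotic directions `1 / c_±`. The exchange of `X_+` and `X_-` swaps the two
asymptotic coordinates up to a factor, and as `c_+ / c_-` is a primitive `m`-th root of unity, a
Dickson polynomial of degree `m` is invariant (`Walk.exists_isGluing`). Uniqueness follows because
an invariant function with a pole of order `j` at `1` satisfies `c_+^j = c_-^j`
(`Walk.pow_eq_of_poleForm`).

*Decoupling on the continuous side.* The function `L(h_n)` is homogeneous of degree `-d`, where
`d = k m + 2 n`. If `m` does not divide `d`, then `c_+^d ≠ c_-^d`, and the decoupling condition is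
a linear equation with one solution. If `m` divides `d`, then `α` drops out, and the values in the
two directions `(c_±, 1)` have to agree. They do, by the same argument with orbit sums, for the
group of order `2 m` generated by the linear parts of `Φ` and `Ψ` (`Walk.RayOrbitZero.eval2_eq`).
-/

noncomputable section

/-! ### Specialization of rational functions -/

/-- The rational function `f` is defined at the point `(u, v)` and takes the value `z` there: it is
a quotient of two polynomials, not necessarily in lowest terms, whose denominator does not vanish
at the point. As a relation between `f` and `z` it respects the field operations. -/
def SpecAt {L : Type*} [Field L] [Algebra ℂ L] (u v : L) (f : Rat2) (z : L) : Prop :=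
  ∃ n d : MvPolynomial (Fin 2) ℂ, MvPolynomial.aeval ![u, v] d ≠ 0 ∧
    f * algebraMap _ Rat2 d = algebraMap _ Rat2 n ∧
    z * MvPolynomial.aeval ![u, v] d = MvPolynomial.aeval ![u, v] n

namespace SpecAt

variable {L : Type*} [Field L] [Algebra ℂ L] {u v : L}

lemma algebraMap_ne_zero {d : MvPolynomial (Fin 2) ℂ} (h : MvPolynomial.aeval ![u, v] d ≠ 0) :
    algebraMap (MvPolynomial (Fin 2) ℂ) Rat2 d ≠ 0 := by
  intro h0
  have : d = 0 := by
    apply IsFractionRing.injective (MvPolynomial (Fin 2) ℂ) Rat2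
    simpa using h0
  simp [this] at h

lemma poly (q : MvPolynomial (Fin 2) ℂ) :
    SpecAt u v (algebraMap _ Rat2 q) (MvPolynomial.aeval ![u, v] q) :=
  ⟨q, 1, by simp, by simp, by simp⟩

lemma const (c : ℂ) : SpecAt u v (algebraMap ℂ Rat2 c) (algebraMap ℂ L c) := by
  have := poly (u := u) (v := v) (MvPolynomial.C c)
  rwa [MvPolynomial.aeval_C, ← MvPolynomial.algebraMap_eq,
    ← IsScalarTower.algebraMap_apply ℂ (MvPolynomial (Fin 2) ℂ) Rat2] at this

lemma x : SpecAt u v xvar u := by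
  have := poly (u := u) (v := v) (MvPolynomial.X 0)
  rwa [MvPolynomial.aeval_X] at this

lemma y : SpecAt u v yvar v := by
  have := poly (u := u) (v := v) (MvPolynomial.X 1)
  rwa [MvPolynomial.aeval_X] at this

lemma zero : SpecAt u v 0 0 := by simpa using poly (u := u) (v := v) 0

lemma one : SpecAt u v 1 1 := by simpa using poly (u := u) (v := v) 1

variable {f g : Rat2} {z w : L}

lemma add (hf : SpecAt u v f z) (hg : SpecAt u v g w) : SpecAt u v (f + g) (z + w) := by
  obtain ⟨n, d, h1, h2, h3⟩ := hf
  obtain ⟨n', d', h1', h2', h3'⟩ := hg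
  refine ⟨n * d' + n' * d, d * d', by simp [h1, h1'], ?_, ?_⟩
  · simp only [map_mul, map_add, ← h2, ← h2']; ring
  · simp only [map_mul, map_add, ← h3, ← h3']; ring

lemma mul (hf : SpecAt u v f z) (hg : SpecAt u v g w) : SpecAt u v (f * g) (z * w) := by
  obtain ⟨n, d, h1, h2, h3⟩ := hf
  obtain ⟨n', d', h1', h2', h3'⟩ := hg
  refine ⟨n * n', d * d', by simp [h1, h1'], ?_, ?_⟩
  · simp only [map_mul, ← h2, ← h2']; ring
  · simp only [map_mul, ← h3, ← h3']; ring

lemma neg (hf : SpecAt u v f z) : SpecAt u v (-f) (-z) := by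
  obtain ⟨n, d, h1, h2, h3⟩ := hf
  exact ⟨-n, d, h1, by simp [← h2], by simp [← h3]⟩

lemma sub (hf : SpecAt u v f z) (hg : SpecAt u v g w) : SpecAt u v (f - g) (z - w) := by
  simpa [sub_eq_add_neg] using hf.add hg.neg

lemma pow (hf : SpecAt u v f z) (k : ℕ) : SpecAt u v (f ^ k) (z ^ k) := by
  induction k with
  | zero => simpa using one
  | succ k ih => simpa [pow_succ] using ih.mul hf

lemma sum {ι : Type*} (s : Finset ι) {F : ι → Rat2} {G : ι → L}
    (h : ∀ i ∈ s, SpecAt u v (F i) (G i)) : SpecAt u v (∑ i ∈ s, F i) (∑ i ∈ s, G i) := by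
  classical
  induction s using Finset.induction_on with
  | empty => simpa using zero
  | insert a s ha ih =>
    rw [Finset.sum_insert ha, Finset.sum_insert ha]
    exact (h a (by simp)).add (ih fun i hi => h i (by simp [hi]))

lemma unique (hf : SpecAt u v f z) (hg : SpecAt u v f w) : z = w := by
  obtain ⟨n, d, h1, h2, h3⟩ := hf
  obtain ⟨n', d', h1', h2', h3'⟩ := hg
  have h : n * d' = n' * d := by
    apply IsFractionRing.injective (MvPolynomial (Fin 2) ℂ) Rat2
    simp only [map_mul, ← h2, ← h2']; ring
  have h' := congrArg (MvPolynomial.aeval ![u, v]) h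
  simp only [map_mul, ← h3, ← h3'] at h'
  have : (z - w) * (MvPolynomial.aeval ![u, v] d * MvPolynomial.aeval ![u, v] d') = 0 := by
    linear_combination h'
  rcases mul_eq_zero.1 this with h | h
  · exact sub_eq_zero.1 h
  · exact absurd h (mul_ne_zero h1 h1')

lemma ne_zero (hf : SpecAt u v f z) (hz : z ≠ 0) : f ≠ 0 := by
  rintro rfl
  exact hz (hf.unique zero)

lemma inv (hf : SpecAt u v f z) (hz : z ≠ 0) : SpecAt u v f⁻¹ z⁻¹ := by
  have hf0 := hf.ne_zero hz
  obtain ⟨n, d, h1, h2, h3⟩ := hf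
  refine ⟨d, n, h3 ▸ mul_ne_zero hz h1, ?_, ?_⟩
  · rw [← h2, inv_mul_cancel_left₀ hf0]
  · rw [← h3, inv_mul_cancel_left₀ hz]

lemma div (hf : SpecAt u v f z) (hg : SpecAt u v g w) (hw : w ≠ 0) :
    SpecAt u v (f / g) (z / w) := by
  simpa [div_eq_mul_inv] using hf.mul (hg.inv hw)

lemma regularAt (hf : SpecAt u v f z) : RegularAt f u v := by
  obtain ⟨n, d, h1, h2, -⟩ := hf
  have hd := algebraMap_ne_zero h1
  have hden : algebraMap (MvPolynomial (Fin 2) ℂ) Rat2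
      (IsFractionRing.den (MvPolynomial (Fin 2) ℂ) f : MvPolynomial (Fin 2) ℂ) ≠ 0 := by
    simp
  have hf' : f = algebraMap (MvPolynomial (Fin 2) ℂ) Rat2 (IsFractionRing.num _ f) /
      algebraMap (MvPolynomial (Fin 2) ℂ) Rat2
        (IsFractionRing.den (MvPolynomial (Fin 2) ℂ) f : MvPolynomial (Fin 2) ℂ) :=
    (IsFractionRing.mk'_num_den' (MvPolynomial (Fin 2) ℂ) f).symm
  have h : IsFractionRing.num (MvPolynomial (Fin 2) ℂ) f * d =
      (IsFractionRing.den (MvPolynomial (Fin 2) ℂ) f : MvPolynomial (Fin 2) ℂ) * n := by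
    apply IsFractionRing.injective (MvPolynomial (Fin 2) ℂ) Rat2
    rw [map_mul, map_mul, ← h2]
    nth_rewrite 3 [hf']
    field_simp
  have hdvd : (IsFractionRing.den (MvPolynomial (Fin 2) ℂ) f : MvPolynomial (Fin 2) ℂ) ∣ d :=
    (IsFractionRing.num_den_reduced (MvPolynomial (Fin 2) ℂ) f).symm.dvd_of_dvd_mul_left
      ⟨n, h⟩
  obtain ⟨e, he⟩ := hdvd
  intro h0
  rw [he, map_mul, h0, zero_mul] at h1
  exact h1 rfl

lemma eval2 (hf : SpecAt u v f z) : eval2 f u v = z := by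
  have hr := hf.regularAt
  refine SpecAt.unique (f := f) ⟨IsFractionRing.num _ f, _, hr, ?_, ?_⟩ hf
  · nth_rewrite 1 [← IsFractionRing.mk'_num_den' (MvPolynomial (Fin 2) ℂ) f]
    exact div_mul_cancel₀ _ (algebraMap_ne_zero hr)
  · rw [_root_.eval2]
    exact div_mul_cancel₀ _ hr

end SpecAt

section OneVariable

variable {L : Type*} [Field L] [Algebra ℂ L]

lemma Transcendental.aeval_ne_zero {u : L} (hu : Transcendental ℂ u) {p : Polynomial ℂ}
    (hp : p ≠ 0) : Polynomial.aeval u p ≠ 0 := fun h => hu ⟨p, hp, h⟩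

lemma Transcendental.ne_algebraMap {u : L} (hu : Transcendental ℂ u) (c : ℂ) :
    u ≠ algebraMap ℂ L c := by
  rintro rfl
  exact hu (isAlgebraic_algebraMap c)

/-- Over `ℂ` an algebraic element is a constant. -/
lemma transcendental_of_forall_ne {u : L} (h : ∀ c : ℂ, u ≠ algebraMap ℂ L c) :
    Transcendental ℂ u := by
  intro ha
  obtain ⟨p, hp0, hp⟩ := ha
  have hs := IsAlgClosed.splits p
  have := hs.eq_prod_roots
  rw [this] at hp
  simp only [map_mul, Polynomial.aeval_C, map_multiset_prod, Multiset.map_map, mul_eq_zero,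
    Multiset.prod_eq_zero_iff, Multiset.mem_map] at hp
  rcases hp with hp | ⟨a, -, ha⟩
  · simp [hp0] at hp
  · simp only [Function.comp_apply, map_sub, Polynomial.aeval_X, Polynomial.aeval_C] at ha
    exact h a (sub_eq_zero.1 ha)

lemma Transcendental.map {K : Type*} [Field K] [Algebra ℂ K] {u : L} (hu : Transcendental ℂ u)
    (φ : L →ₐ[ℂ] K) : Transcendental ℂ (φ u) := fun h =>
  hu ((isAlgebraic_algHom_iff φ φ.toRingHom.injective).1 h)

/-- The value of a quotient of polynomials, not necessarily in lowest terms. -/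
lemma eval1_eq_div {f : RatFunc ℂ} {p q : Polynomial ℂ} {u : L}
    (hf : f = algebraMap _ (RatFunc ℂ) p / algebraMap _ (RatFunc ℂ) q)
    (hq : Polynomial.aeval u q ≠ 0) :
    eval1 f u = Polynomial.aeval u p / Polynomial.aeval u q := by
  have hq0 : q ≠ 0 := by rintro rfl; simp at hq
  subst hf
  have h := (RatFunc.num_mul_eq_mul_denom_iff (p := p) hq0).2 rfl
  have hd : Polynomial.aeval u (RatFunc.denom (algebraMap _ (RatFunc ℂ) p /
      algebraMap _ (RatFunc ℂ) q)) ≠ 0 := by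
    obtain ⟨e, he⟩ := RatFunc.denom_div_dvd p q
    intro h0
    rw [he, map_mul, h0, zero_mul] at hq
    exact hq rfl
  have h' := congrArg (Polynomial.aeval u) h
  simp only [map_mul] at h'
  rw [eval1, div_eq_div_iff hd hq]
  exact h'

lemma aeval_denom_ne_zero {u : L} (hu : Transcendental ℂ u) (f : RatFunc ℂ) :
    Polynomial.aeval u f.denom ≠ 0 := hu.aeval_ne_zero f.denom_ne_zero

/-- Substitution of a transcendental element into rational functions. -/
def substHom {u : L} (hu : Transcendental ℂ u) : RatFunc ℂ →ₐ[ℂ] L :=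
  RatFunc.liftAlgHom (Polynomial.aeval u) (by
    intro p hp
    simpa using hu.aeval_ne_zero (nonZeroDivisors.ne_zero hp))

lemma substHom_apply {u : L} (hu : Transcendental ℂ u) (f : RatFunc ℂ) :
    substHom hu f = eval1 f u := by
  rw [substHom, RatFunc.liftAlgHom_apply]; rfl

lemma map_eval1 {K : Type*} [Field K] [Algebra ℂ K] (φ : L →ₐ[ℂ] K) (f : RatFunc ℂ) (u : L) :
    φ (eval1 f u) = eval1 f (φ u) := by
  simp [eval1, Polynomial.aeval_algHom_apply]

lemma map_aeval2 {K : Type*} [Field K] [Algebra ℂ K] (φ : L →ₐ[ℂ] K)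
    (p : MvPolynomial (Fin 2) ℂ) (u v : L) :
    φ (MvPolynomial.aeval ![u, v] p) = MvPolynomial.aeval ![φ u, φ v] p := by
  have : (φ.comp (MvPolynomial.aeval ![u, v])) = MvPolynomial.aeval ![φ u, φ v] := by
    ext i; fin_cases i <;> simp
  exact congrArg (fun h => h p) this

lemma map_eval2 {K : Type*} [Field K] [Algebra ℂ K] (φ : L →ₐ[ℂ] K) (f : Rat2) (u v : L) :
    φ (eval2 f u v) = eval2 f (φ u) (φ v) := by
  simp [eval2, map_aeval2]

/-- A polynomial in one variable, seen as a polynomial in the `i`-th of two variables. -/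
def poly2 (i : Fin 2) (p : Polynomial ℂ) : MvPolynomial (Fin 2) ℂ :=
  Polynomial.aeval (MvPolynomial.X i) p

lemma aeval_poly2_zero (p : Polynomial ℂ) (u v : L) :
    MvPolynomial.aeval ![u, v] (poly2 0 p) = Polynomial.aeval u p := by
  simp [poly2, ← Polynomial.aeval_algHom_apply]

lemma aeval_poly2_one (p : Polynomial ℂ) (u v : L) :
    MvPolynomial.aeval ![u, v] (poly2 1 p) = Polynomial.aeval v p := by
  simp [poly2, ← Polynomial.aeval_algHom_apply]

lemma algebraMap_poly2 (i : Fin 2) (p : Polynomial ℂ) :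
    algebraMap _ Rat2 (poly2 i p) =
      Polynomial.aeval (algebraMap (MvPolynomial (Fin 2) ℂ) Rat2 (MvPolynomial.X i)) p := by
  rw [poly2, Polynomial.aeval_algebraMap_apply]

lemma algebraMap_eq_aeval (Q : MvPolynomial (Fin 2) ℂ) :
    algebraMap _ Rat2 Q = MvPolynomial.aeval ![xvar, yvar] Q := by
  have : IsScalarTower.toAlgHom ℂ (MvPolynomial (Fin 2) ℂ) Rat2
      = MvPolynomial.aeval ![xvar, yvar] := by
    ext i; fin_cases i <;> simp [xvar, yvar]
  exact congrArg (fun h => h Q) this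

lemma SpecAt.aeval {u v : L} {f : Rat2} {z : L} (h : SpecAt u v f z) (p : Polynomial ℂ) :
    SpecAt u v (Polynomial.aeval f p) (Polynomial.aeval z p) := by
  induction p using Polynomial.induction_on' with
  | add p q hp hq => simpa using hp.add hq
  | monomial n a =>
    simp only [Polynomial.aeval_monomial]
    exact (SpecAt.const a).mul (h.pow n)

lemma SpecAt.mvaeval {u v : L} {f g : Rat2} {z w : L} (h : SpecAt u v f z) (h' : SpecAt u v g w)
    (p : MvPolynomial (Fin 2) ℂ) :
    SpecAt u v (MvPolynomial.aeval ![f, g] p) (MvPolynomial.aeval ![z, w] p) := by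
  induction p using MvPolynomial.induction_on with
  | C a => simpa using SpecAt.const a
  | add p q hp hq => simpa using hp.add hq
  | mul_X p i hp =>
    rw [map_mul, map_mul]
    refine hp.mul ?_
    fin_cases i
    · simpa using h
    · simpa using h'

lemma SpecAt.eval1 {u v : L} {f : Rat2} {z : L} (h : SpecAt u v f z) (F : RatFunc ℂ)
    (hz : Transcendental ℂ z) : SpecAt u v (eval1 F f) (eval1 F z) :=
  (h.aeval _).div (h.aeval _) (aeval_denom_ne_zero hz F)

/-- A rational function whose value is not constant is not constant. -/
lemma SpecAt.transcendental {u v : L} {f : Rat2} {z : L} (h : SpecAt u v f z)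
    (hz : Transcendental ℂ z) : Transcendental ℂ f := by
  apply transcendental_of_forall_ne
  rintro c rfl
  exact hz.ne_algebraMap c (h.unique (SpecAt.const c))

lemma transcendental_xvar : Transcendental ℂ xvar := by
  rw [xvar, transcendental_algebraMap_iff
    (IsFractionRing.injective (MvPolynomial (Fin 2) ℂ) Rat2)]
  exact MvPolynomial.transcendental_X ℂ 0

lemma transcendental_yvar : Transcendental ℂ yvar := by
  rw [yvar, transcendental_algebraMap_iff
    (IsFractionRing.injective (MvPolynomial (Fin 2) ℂ) Rat2)]
  exact MvPolynomial.transcendental_X ℂ 1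

lemma xvar_ne_zero : xvar ≠ 0 := by
  simpa using transcendental_xvar.ne_algebraMap 0

lemma yvar_ne_zero : yvar ≠ 0 := by
  simpa using transcendental_yvar.ne_algebraMap 0

lemma transcendental_tvar : Transcendental ℂ tvar := by
  rw [tvar, transcendental_algebraMap_iff (algebraMap (RatFunc ℂ) AlgFun).injective]
  exact RatFunc.transcendental_X

lemma algebraMap_eq_eval1 (f : RatFunc ℂ) : algebraMap (RatFunc ℂ) AlgFun f = eval1 f tvar := by
  rw [← substHom_apply transcendental_tvar, substHom, RatFunc.liftAlgHom_apply]
  rw [tvar, Polynomial.aeval_algebraMap_apply, Polynomial.aeval_algebraMap_apply, ← map_div₀]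
  congr 1
  rw [← RatFunc.algebraMap_X]
  rw [Polynomial.aeval_algebraMap_apply, Polynomial.aeval_algebraMap_apply]
  simp

lemma eval1_toRat {z : AlgFun} (hz : IsRationalFun z) : eval1 (toRat z) tvar = z := by
  rw [← algebraMap_eq_eval1]
  exact Function.invFun_eq hz

/-- An algebraic function fixed by all automorphisms over `ℂ(t)` is rational. -/
lemma isRationalFun_of_fixed {z : AlgFun} (h : ∀ σ : AlgFun ≃ₐ[RatFunc ℂ] AlgFun, σ z = z) :
    IsRationalFun z :=
  (InfiniteGalois.mem_range_algebraMap_iff_fixed z).2 h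

/-- For every transcendental element `v` of an extension `L` of `ℂ` there is a substitution `t ↦ v`
of algebraic functions, with values in an algebraic closure of `L`. -/
lemma exists_algHom_of_transcendental {L : Type} [Field L] [Algebra ℂ L] {v : L}
    (hv : Transcendental ℂ v) :
    ∃ τ : AlgFun →ₐ[ℂ] AlgebraicClosure L, τ tvar = algebraMap L _ v := by
  have hv' : Transcendental ℂ (algebraMap L (AlgebraicClosure L) v) :=
    (transcendental_algebraMap_iff (algebraMap L (AlgebraicClosure L)).injective).2 hv
  let s := substHom hv'
  let _ : Algebra (RatFunc ℂ) (AlgebraicClosure L) := s.toRingHom.toAlgebra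
  have hs : ∀ f : RatFunc ℂ, algebraMap (RatFunc ℂ) (AlgebraicClosure L) f = s f := fun f => rfl
  have : IsScalarTower ℂ (RatFunc ℂ) (AlgebraicClosure L) :=
    IsScalarTower.of_algebraMap_eq fun c => by rw [hs, s.commutes]
  let τ : AlgFun →ₐ[RatFunc ℂ] AlgebraicClosure L := IsAlgClosed.lift
  refine ⟨τ.restrictScalars ℂ, ?_⟩
  rw [tvar, AlgHom.restrictScalars_apply, τ.commutes, hs, substHom_apply,
    eval1_eq_div (p := Polynomial.X) (q := 1)]
  · simp
  · simp
  · simp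

end OneVariable

/-- The rational function `M` has a denominator of the form `A(x) B(y)`. -/
def Split (M : Rat2) : Prop :=
  ∃ (Q : MvPolynomial (Fin 2) ℂ) (A B : Polynomial ℂ), A ≠ 0 ∧ B ≠ 0 ∧
    M * (Polynomial.aeval xvar A * Polynomial.aeval yvar B) = algebraMap _ Rat2 Q

lemma specAt_of_mul_eq {L : Type*} [Field L] [Algebra ℂ L] {u v : L} {M : Rat2}
    {Q : MvPolynomial (Fin 2) ℂ} {A B : Polynomial ℂ}
    (h : M * (Polynomial.aeval xvar A * Polynomial.aeval yvar B) = algebraMap _ Rat2 Q)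
    (hA : Polynomial.aeval u A ≠ 0) (hB : Polynomial.aeval v B ≠ 0) :
    SpecAt u v M (MvPolynomial.aeval ![u, v] Q /
      (Polynomial.aeval u A * Polynomial.aeval v B)) := by
  refine ⟨Q, poly2 0 A * poly2 1 B, ?_, ?_, ?_⟩
  · rw [map_mul, aeval_poly2_zero, aeval_poly2_one]
    exact mul_ne_zero hA hB
  · rw [map_mul, algebraMap_poly2, algebraMap_poly2]; exact h
  · rw [map_mul, aeval_poly2_zero, aeval_poly2_one]
    exact div_mul_cancel₀ _ (mul_ne_zero hA hB)

/-- A denominator `A(x) B(y)` does not vanish at points with two transcendental coordinates, even if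
they are algebraically dependent. -/
lemma Split.specAt {M : Rat2} (h : Split M) {L : Type*} [Field L] [Algebra ℂ L] {u v : L}
    (hu : Transcendental ℂ u) (hv : Transcendental ℂ v) : SpecAt u v M (eval2 M u v) := by
  obtain ⟨Q, A, B, hA, hB, hM⟩ := h
  have := specAt_of_mul_eq hM (hu.aeval_ne_zero hA) (hv.aeval_ne_zero hB)
  rwa [this.eval2]

lemma eval2_zero {L : Type*} [Field L] [Algebra ℂ L] (u v : L) : eval2 0 u v = 0 :=
  SpecAt.zero.eval2

lemma split_zero : Split 0 := ⟨0, 1, 1, one_ne_zero, one_ne_zero, by simp⟩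

lemma algebraMap_X_zero : algebraMap (MvPolynomial (Fin 2) ℂ) Rat2 (MvPolynomial.X 0) = xvar := rfl

lemma algebraMap_X_one : algebraMap (MvPolynomial (Fin 2) ℂ) Rat2 (MvPolynomial.X 1) = yvar := rfl

namespace Walk

variable (W : Walk)

/-! ### The kernel and the covariance matrix -/

lemma sum_Icc_int {M : Type*} [AddCommMonoid M] (f : ℤ → M) :
    ∑ i ∈ Finset.Icc (-1 : ℤ) 1, f i = f (-1) + (f 0 + f 1) := by
  have : Finset.Icc (-1 : ℤ) 1 = {-1, 0, 1} := by decide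
  rw [this]; simp

section

variable {L : Type*} [Field L] [Algebra ℂ L]

lemma ca_eq (u : L) : W.ca u = W.wt L 1 (-1) + W.wt L 0 (-1) * u + W.wt L (-1) (-1) * u ^ 2 := by
  rw [ca, sum_Icc_int, show (1 - (-1) : ℤ) = (2 : ℕ) by norm_num, zpow_natCast]; simp; ring

lemma cb_eq (u : L) :
    W.cb u = W.wt L 1 0 + W.wt L 0 0 * u + W.wt L (-1) 0 * u ^ 2 - u := by
  rw [cb, sum_Icc_int, show (1 - (-1) : ℤ) = (2 : ℕ) by norm_num, zpow_natCast]; simp; ring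

lemma cc_eq (u : L) : W.cc u = W.wt L 1 1 + W.wt L 0 1 * u + W.wt L (-1) 1 * u ^ 2 := by
  rw [cc, sum_Icc_int, show (1 - (-1) : ℤ) = (2 : ℕ) by norm_num, zpow_natCast]; simp; ring

lemma cat_eq (u : L) : W.cat u = W.wt L (-1) 1 + W.wt L (-1) 0 * u + W.wt L (-1) (-1) * u ^ 2 := by
  rw [cat, sum_Icc_int, show (1 - (-1) : ℤ) = (2 : ℕ) by norm_num, zpow_natCast]; simp; ring

lemma cbt_eq (u : L) :
    W.cbt u = W.wt L 0 1 + W.wt L 0 0 * u + W.wt L 0 (-1) * u ^ 2 - u := by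
  rw [cbt, sum_Icc_int, show (1 - (-1) : ℤ) = (2 : ℕ) by norm_num, zpow_natCast]; simp; ring

lemma cct_eq (u : L) : W.cct u = W.wt L 1 1 + W.wt L 1 0 * u + W.wt L 1 (-1) * u ^ 2 := by
  rw [cct, sum_Icc_int, show (1 - (-1) : ℤ) = (2 : ℕ) by norm_num, zpow_natCast]; simp; ring

lemma kernel_eq_y (u v : L) : W.kernel u v = W.ca u * v ^ 2 + W.cb u * v + W.cc u := by
  rw [ca_eq, cb_eq, cc_eq, kernel]
  simp only [sum_Icc_int, show (1 - (-1) : ℤ) = (2 : ℕ) by norm_num, zpow_natCast]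
  simp; ring

lemma kernel_eq_x (u v : L) : W.kernel u v = W.cat v * u ^ 2 + W.cbt v * u + W.cct v := by
  rw [kernel_eq_y, ca_eq, cb_eq, cc_eq, cat_eq, cbt_eq, cct_eq]; ring

variable {K : Type*} [Field K] [Algebra ℂ K] (φ : L →ₐ[ℂ] K)

@[simp] lemma map_wt (i j : ℤ) : φ (W.wt L i j) = W.wt K i j := by simp [wt]
@[simp] lemma map_ca (u : L) : φ (W.ca u) = W.ca (φ u) := by simp [ca_eq]
@[simp] lemma map_cb (u : L) : φ (W.cb u) = W.cb (φ u) := by simp [cb_eq]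
@[simp] lemma map_cc (u : L) : φ (W.cc u) = W.cc (φ u) := by simp [cc_eq]
@[simp] lemma map_cat (u : L) : φ (W.cat u) = W.cat (φ u) := by simp [cat_eq]
@[simp] lemma map_cbt (u : L) : φ (W.cbt u) = W.cbt (φ u) := by simp [cbt_eq]
@[simp] lemma map_cct (u : L) : φ (W.cct u) = W.cct (φ u) := by simp [cct_eq]
@[simp] lemma map_kernel (u v : L) : φ (W.kernel u v) = W.kernel (φ u) (φ v) := by
  simp [kernel_eq_y]

lemma map_Phi (q : L × L) : Prod.map φ φ (W.Phi q) = W.Phi (Prod.map φ φ q) := by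
  simp [Phi, Prod.map]
lemma map_Psi (q : L × L) : Prod.map φ φ (W.Psi q) = W.Psi (Prod.map φ φ q) := by
  simp [Psi, Prod.map]
lemma map_Theta (q : L × L) : Prod.map φ φ (W.Theta q) = W.Theta (Prod.map φ φ q) := by
  rw [Theta, map_Psi, map_Phi, Theta]
lemma map_Theta_iterate (i : ℕ) (q : L × L) :
    Prod.map φ φ (W.Theta^[i] q) = W.Theta^[i] (Prod.map φ φ q) :=
  Function.Semiconj.iterate_right (fun q => W.map_Theta φ q) i q

end

lemma mean_eq (f : ℤ → ℤ → ℝ) : W.mean f =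
    f (-1) (-1) * W.p (-1) (-1) + f (-1) 0 * W.p (-1) 0 + f (-1) 1 * W.p (-1) 1 +
    f 0 (-1) * W.p 0 (-1) + f 0 0 * W.p 0 0 + f 0 1 * W.p 0 1 +
    f 1 (-1) * W.p 1 (-1) + f 1 0 * W.p 1 0 + f 1 1 * W.p 1 1 := by
  simp only [mean, sum_Icc_int]; ring

lemma sigma11_eq : W.sigma11 = W.p (-1) (-1) + W.p (-1) 0 + W.p (-1) 1 +
    W.p 1 (-1) + W.p 1 0 + W.p 1 1 := by
  rw [sigma11, mean_eq]; push_cast; ring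

lemma sigma22_eq : W.sigma22 = W.p (-1) (-1) + W.p (-1) 1 + W.p 0 (-1) + W.p 0 1 +
    W.p 1 (-1) + W.p 1 1 := by
  rw [sigma22, mean_eq]; push_cast; ring

lemma sigma12_eq : W.sigma12 = W.p (-1) (-1) - W.p (-1) 1 - W.p 1 (-1) + W.p 1 1 := by
  rw [sigma12, mean_eq]; push_cast; ring

lemma ZeroDrift.eq_x {W : Walk} (h : W.ZeroDrift) :
    W.p 1 1 + W.p 1 0 + W.p 1 (-1) = W.p (-1) 1 + W.p (-1) 0 + W.p (-1) (-1) := by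
  have := h.1
  rw [mean_eq] at this; push_cast at this; linarith

lemma ZeroDrift.eq_y {W : Walk} (h : W.ZeroDrift) :
    W.p 1 1 + W.p 0 1 + W.p (-1) 1 = W.p 1 (-1) + W.p 0 (-1) + W.p (-1) (-1) := by
  have := h.2
  rw [mean_eq] at this; push_cast at this; linarith

lemma sum_eq_one : W.p (-1) (-1) + W.p (-1) 0 + W.p (-1) 1 + W.p 0 (-1) + W.p 0 0 + W.p 0 1 +
    W.p 1 (-1) + W.p 1 0 + W.p 1 1 = 1 := by
  have := W.sum_one
  simp only [sum_Icc_int] at this; linarith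

lemma NonDegenerate.triples {W : Walk} (h : W.NonDegenerate) :
    (W.p 1 1 = 0 → W.p 1 0 = 0 → W.p 1 (-1) ≠ 0) ∧
    (W.p 1 0 = 0 → W.p 1 (-1) = 0 → W.p 0 (-1) ≠ 0) ∧
    (W.p 1 (-1) = 0 → W.p 0 (-1) = 0 → W.p (-1) (-1) ≠ 0) ∧
    (W.p 0 (-1) = 0 → W.p (-1) (-1) = 0 → W.p (-1) 0 ≠ 0) ∧
    (W.p (-1) (-1) = 0 → W.p (-1) 0 = 0 → W.p (-1) 1 ≠ 0) ∧
    (W.p (-1) 0 = 0 → W.p (-1) 1 = 0 → W.p 0 1 ≠ 0) := by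
  refine ⟨fun h1 h2 h3 => h ?_, fun h1 h2 h3 => h ?_, fun h1 h2 h3 => h ?_, fun h1 h2 h3 => h ?_,
    fun h1 h2 h3 => h ?_, fun h1 h2 h3 => h ?_⟩ <;> rw [h1, h2, h3]
  · exact ⟨[], _, rfl⟩
  · exact ⟨[_], _, rfl⟩
  · exact ⟨[_, _], _, rfl⟩
  · exact ⟨[_, _, _], _, rfl⟩
  · exact ⟨[_, _, _, _], _, rfl⟩
  · exact ⟨[_, _, _, _, _], _, rfl⟩

/-- The covariance matrix of a non-degenerate walk is positive definite. Its determinant is the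
sum of `p_s p_t (s × t)²` over pairs of steps; if it vanishes, then all steps are on one line
through the origin. -/
lemma det_pos {W : Walk} (hnd : W.NonDegenerate) :
    0 < W.sigma11 * W.sigma22 - W.sigma12 ^ 2 := by
  obtain ⟨h1, h2, h3, h4, h5, h6⟩ := hnd.triples
  rw [sigma11_eq, sigma12_eq, sigma22_eq]
  have n1 := W.nonneg 1 1
  have n2 := W.nonneg 1 0
  have n3 := W.nonneg 1 (-1)
  have n4 := W.nonneg 0 (-1)
  have n5 := W.nonneg (-1) (-1)
  have n6 := W.nonneg (-1) 0
  have n7 := W.nonneg (-1) 1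
  have n8 := W.nonneg 0 1
  generalize W.p 1 1 = a1 at *
  generalize W.p 1 0 = a2 at *
  generalize W.p 1 (-1) = a3 at *
  generalize W.p 0 (-1) = a4 at *
  generalize W.p (-1) (-1) = a5 at *
  generalize W.p (-1) 0 = a6 at *
  generalize W.p (-1) 1 = a7 at *
  generalize W.p 0 1 = a8 at *
  -- The lines through the origin are those of `(a1, a5)`, `(a2, a6)`, `(a3, a7)`, `(a4, a8)`.
  have key : (a5 + a6 + a7 + a3 + a2 + a1) * (a5 + a7 + a4 + a8 + a3 + a1)
      - (a5 - a7 - a3 + a1) ^ 2 =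
      (a1 + a5) * (a2 + a6) + 4 * ((a1 + a5) * (a3 + a7)) + (a1 + a5) * (a4 + a8) +
        (a2 + a6) * (a3 + a7) + (a2 + a6) * (a4 + a8) + (a3 + a7) * (a4 + a8) := by ring
  rw [key]
  have m1 := mul_nonneg (add_nonneg n1 n5) (add_nonneg n2 n6)
  have m2 := mul_nonneg (add_nonneg n1 n5) (add_nonneg n3 n7)
  have m3 := mul_nonneg (add_nonneg n1 n5) (add_nonneg n4 n8)
  have m4 := mul_nonneg (add_nonneg n2 n6) (add_nonneg n3 n7)
  have m5 := mul_nonneg (add_nonneg n2 n6) (add_nonneg n4 n8)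
  have m6 := mul_nonneg (add_nonneg n3 n7) (add_nonneg n4 n8)
  by_contra hc
  have z1 : (a1 + a5) * (a2 + a6) = 0 := by linarith
  have z2 : (a1 + a5) * (a3 + a7) = 0 := by linarith
  have z3 : (a1 + a5) * (a4 + a8) = 0 := by linarith
  have z4 : (a2 + a6) * (a3 + a7) = 0 := by linarith
  have z5 : (a2 + a6) * (a4 + a8) = 0 := by linarith
  have z6 : (a3 + a7) * (a4 + a8) = 0 := by linarith
  have s0 : ∀ {x y : ℝ}, 0 ≤ x → 0 ≤ y → x + y = 0 → x = 0 ∧ y = 0 := fun hx hy h =>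
    ⟨by linarith, by linarith⟩
  have s1 := s0 n1 n5
  have s2 := s0 n2 n6
  have s3 := s0 n3 n7
  have s4 := s0 n4 n8
  -- At most one of the four sums is not zero, and then three consecutive weights are zero.
  by_cases c1 : a1 + a5 = 0
  · by_cases c2 : a2 + a6 = 0
    · by_cases c3 : a3 + a7 = 0
      · exact h5 (s1 c1).2 (s2 c2).2 (s3 c3).2
      · exact h4 (s4 ((mul_eq_zero.1 z6).resolve_left c3)).1 (s1 c1).2 (s2 c2).2
    · exact h3 (s3 ((mul_eq_zero.1 z4).resolve_left c2)).1
        (s4 ((mul_eq_zero.1 z5).resolve_left c2)).1 (s1 c1).2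
  · exact h2 (s2 ((mul_eq_zero.1 z1).resolve_left c1)).1
      (s3 ((mul_eq_zero.1 z2).resolve_left c1)).1 (s4 ((mul_eq_zero.1 z3).resolve_left c1)).1

lemma sigma11_pos {W : Walk} (hnd : W.NonDegenerate) : 0 < W.sigma11 := by
  have h := det_pos hnd
  have h1 : 0 ≤ W.sigma11 := by
    rw [sigma11_eq]
    have := W.nonneg 1 1; have := W.nonneg 1 0; have := W.nonneg 1 (-1); have := W.nonneg (-1) 1
    have := W.nonneg (-1) 0; have := W.nonneg (-1) (-1)
    positivity
  rcases h1.lt_or_eq with h2 | h2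
  · exact h2
  · rw [← h2] at h; nlinarith [sq_nonneg W.sigma12]

lemma sigma22_pos {W : Walk} (hnd : W.NonDegenerate) : 0 < W.sigma22 := by
  have h := det_pos hnd
  have h1 := sigma11_pos hnd
  by_contra h2
  nlinarith [sq_nonneg W.sigma12, mul_nonneg h1.le (neg_nonneg.2 (not_lt.1 h2))]

end Walk

namespace Walk

variable {W : Walk}

/-! ### The zeros `c_± y` of `γ(·, y)` -/

/-- The real part of `c_±`. As the covariance matrix is positive definite, the argument of the
arccosine lies between `-1` and `1`. -/
lemma sqrt_mul_cos_theta (hnd : W.NonDegenerate) :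
    √(W.sigma22 / W.sigma11) * Real.cos W.theta = -W.sigma12 / W.sigma11 := by
  have h1 := sigma11_pos hnd
  have h2 := sigma22_pos hnd
  have hd := det_pos hnd
  have hs1 := Real.sq_sqrt h1.le
  have hs2 := Real.sq_sqrt h2.le
  have p1 := Real.sqrt_pos.2 h1
  have p2 := Real.sqrt_pos.2 h2
  have hle : |W.sigma12| ≤ √W.sigma11 * √W.sigma22 := by
    apply abs_le_of_sq_le_sq _ (by positivity)
    rw [mul_pow, hs1, hs2]; linarith
  have hle' := abs_le.1 hle
  rw [theta, Real.cos_arccos, Real.sqrt_div h2.le]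
  · field_simp
    rw [hs1]; ring
  · rw [le_neg, neg_neg, div_le_one (by positivity)]; exact hle'.2
  · rw [neg_le, le_div_iff₀ (by positivity)]; linarith [hle'.1]

lemma cplus_add_cminus (hnd : W.NonDegenerate) :
    W.cplus + W.cminus = -2 * (W.sigma12 : ℂ) / W.sigma11 := by
  have h := congrArg (fun r : ℝ => (r : ℂ)) (sqrt_mul_cos_theta hnd)
  push_cast at h
  have h2 : Complex.exp (Complex.I * W.theta) + Complex.exp (-(Complex.I * W.theta)) =
      2 * Complex.cos W.theta := by
    rw [Complex.cos, mul_div_cancel₀ _ two_ne_zero]; congr 2 <;> ring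
  rw [cplus, cminus, ← mul_add, h2, show (-2 * (W.sigma12 : ℂ) / W.sigma11) =
    2 * (-(W.sigma12 : ℂ) / W.sigma11) by ring, ← h]
  ring

lemma cplus_mul_cminus (hnd : W.NonDegenerate) :
    W.cplus * W.cminus = (W.sigma22 : ℂ) / W.sigma11 := by
  have h1 := sigma11_pos hnd
  have h2 := sigma22_pos hnd
  have h := congrArg (fun r : ℝ => (r : ℂ)) (Real.sq_sqrt (div_pos h2 h1).le)
  push_cast at h
  rw [cplus, cminus, mul_mul_mul_comm, ← Complex.exp_add, add_neg_cancel, Complex.exp_zero,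
    ← sq, h, mul_one]

lemma sigma11_ne (hnd : W.NonDegenerate) : (W.sigma11 : ℂ) ≠ 0 := by
  exact_mod_cast (sigma11_pos hnd).ne'

lemma sigma22_ne (hnd : W.NonDegenerate) : (W.sigma22 : ℂ) ≠ 0 := by
  exact_mod_cast (sigma22_pos hnd).ne'

lemma cplus_ne_zero (hnd : W.NonDegenerate) : W.cplus ≠ 0 := by
  intro h
  have := cplus_mul_cminus hnd
  rw [h, zero_mul, eq_comm, div_eq_zero_iff] at this
  exact this.elim (sigma22_ne hnd) (sigma11_ne hnd)

lemma cminus_ne_zero (hnd : W.NonDegenerate) : W.cminus ≠ 0 := by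
  intro h
  have := cplus_mul_cminus hnd
  rw [h, mul_zero, eq_comm, div_eq_zero_iff] at this
  exact this.elim (sigma22_ne hnd) (sigma11_ne hnd)

section

variable {m : ℕ}

/-- The angle `θ` is positive, so that `π / θ` is a true quotient. -/
lemma m_ne_zero (hnd : W.NonDegenerate) (hm : Real.pi / W.theta = m) : m ≠ 0 := by
  rintro rfl
  have h : W.theta = 0 := by
    rw [Nat.cast_zero, div_eq_zero_iff] at hm
    rcases hm with h | h
    · exact absurd h Real.pi_ne_zero
    · exact h
  have h1 := sqrt_mul_cos_theta hnd
  rw [h, Real.cos_zero, mul_one] at h1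
  have h2 := Real.sq_sqrt (div_pos (sigma22_pos hnd) (sigma11_pos hnd)).le
  rw [h1] at h2
  have := sigma11_pos hnd
  have := det_pos hnd
  field_simp at h2
  linarith

/-- The ratio `c_+ / c_- = e^{2iθ}` is a primitive `m`-th root of unity. -/
lemma isPrimitiveRoot (hnd : W.NonDegenerate) (hm : Real.pi / W.theta = m) :
    IsPrimitiveRoot (W.cplus / W.cminus) m := by
  have hm0 := m_ne_zero hnd hm
  have hm' : (m : ℂ) ≠ 0 := by exact_mod_cast hm0
  have hth : W.theta = Real.pi / m := by
    have : W.theta ≠ 0 := by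
      rintro h; rw [h, div_zero] at hm; exact hm0 (by exact_mod_cast hm.symm)
    rw [← hm]; field_simp
  convert Complex.isPrimitiveRoot_exp m hm0 using 1
  rw [div_eq_iff (cminus_ne_zero hnd), cplus, cminus, mul_left_comm, ← Complex.exp_add, hth]
  congr 2
  push_cast
  field_simp
  ring

lemma cplus_pow_eq_iff (hnd : W.NonDegenerate) (hm : Real.pi / W.theta = m) (d : ℕ) :
    W.cplus ^ d = W.cminus ^ d ↔ m ∣ d := by
  rw [← (isPrimitiveRoot hnd hm).pow_eq_one_iff_dvd, div_pow,
    div_eq_one_iff_eq (pow_ne_zero _ (cminus_ne_zero hnd))]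

lemma cplus_ne_cminus (hnd : W.NonDegenerate) : W.cplus ≠ W.cminus := by
  intro h
  have h1 := cplus_add_cminus hnd
  have h2 := cplus_mul_cminus hnd
  rw [h] at h1 h2
  have h11 := sigma11_ne hnd
  have hd : ((W.sigma11 * W.sigma22 - W.sigma12 ^ 2 : ℝ) : ℂ) ≠ 0 := by
    exact_mod_cast (det_pos hnd).ne'
  apply hd
  push_cast
  rw [eq_div_iff h11] at h1 h2
  linear_combination (-(W.sigma11 : ℂ)) * h2 + (W.cminus * W.sigma11 / 2 - W.sigma12 / 2) * h1

end

/-! ### Expansion of the kernel at `(1, 1)` -/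

section

variable {L : Type*} [Field L] [Algebra ℂ L]

local notation "κ" => algebraMap ℂ L

lemma wt_sum : W.wt L (-1) (-1) + W.wt L (-1) 0 + W.wt L (-1) 1 + W.wt L 0 (-1) + W.wt L 0 0 +
    W.wt L 0 1 + W.wt L 1 (-1) + W.wt L 1 0 + W.wt L 1 1 = 1 := by
  have := congrArg (fun r : ℝ => κ (r : ℂ)) W.sum_eq_one
  simpa [wt] using this

lemma ZeroDrift.wt_x (h : W.ZeroDrift) :
    W.wt L 1 1 + W.wt L 1 0 + W.wt L 1 (-1) = W.wt L (-1) 1 + W.wt L (-1) 0 + W.wt L (-1) (-1) := by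
  have := congrArg (fun r : ℝ => κ (r : ℂ)) h.eq_x
  simpa [wt] using this

lemma ZeroDrift.wt_y (h : W.ZeroDrift) :
    W.wt L 1 1 + W.wt L 0 1 + W.wt L (-1) 1 = W.wt L 1 (-1) + W.wt L 0 (-1) + W.wt L (-1) (-1) := by
  have := congrArg (fun r : ℝ => κ (r : ℂ)) h.eq_y
  simpa [wt] using this

lemma wt_sigma11 : κ (W.sigma11 : ℂ) = W.wt L (-1) (-1) + W.wt L (-1) 0 + W.wt L (-1) 1 +
    W.wt L 1 (-1) + W.wt L 1 0 + W.wt L 1 1 := by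
  have := congrArg (fun r : ℝ => κ (r : ℂ)) W.sigma11_eq
  simpa [wt] using this

lemma wt_sigma12 : κ (W.sigma12 : ℂ) =
    W.wt L (-1) (-1) - W.wt L (-1) 1 - W.wt L 1 (-1) + W.wt L 1 1 := by
  have := congrArg (fun r : ℝ => κ (r : ℂ)) W.sigma12_eq
  simpa [wt] using this

lemma wt_sigma22 : κ (W.sigma22 : ℂ) = W.wt L (-1) (-1) + W.wt L (-1) 1 + W.wt L 0 (-1) +
    W.wt L 0 1 + W.wt L 1 (-1) + W.wt L 1 1 := by
  have := congrArg (fun r : ℝ => κ (r : ℂ)) W.sigma22_eq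
  simpa [wt] using this

lemma two_ne_zero_of_algebra : (2 : L) ≠ 0 := by
  have h : κ 2 ≠ 0 := (map_ne_zero κ).2 two_ne_zero
  rwa [map_ofNat] at h

/-- The coefficient `ã` at `1 + v`. -/
lemma cat_one_add (hzd : W.ZeroDrift) (v : L) : W.cat (1 + v) = κ (W.sigma11 : ℂ) / 2 +
    (W.wt L (-1) 0 + 2 * W.wt L (-1) (-1)) * v + W.wt L (-1) (-1) * v ^ 2 := by
  have h2 := two_ne_zero_of_algebra (L := L)
  rw [cat_eq, wt_sigma11]
  field_simp
  linear_combination - hzd.wt_x (L := L)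

lemma cbt_one_add (hzd : W.ZeroDrift) (v : L) :
    2 * W.cat (1 + v) + W.cbt (1 + v) = κ (W.sigma12 : ℂ) * v +
      (W.wt L 0 (-1) + 2 * W.wt L (-1) (-1)) * v ^ 2 := by
  rw [cat_eq, cbt_eq, wt_sigma12]
  linear_combination (1 + v) * wt_sum (W := W) (L := L) - (1 + v) * hzd.wt_x (L := L)
    - v * hzd.wt_y (L := L)

lemma cct_one_add (hzd : W.ZeroDrift) (v : L) :
    W.cat (1 + v) + W.cbt (1 + v) + W.cct (1 + v) = κ (W.sigma22 : ℂ) / 2 * v ^ 2 := by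
  have h2 := two_ne_zero_of_algebra (L := L)
  rw [cat_eq, cbt_eq, cct_eq, wt_sigma22]
  field_simp
  linear_combination 2 * (1 + v) * wt_sum (W := W) (L := L) - (2 * v + v ^ 2) * hzd.wt_y (L := L)

lemma kernel_one_add (hzd : W.ZeroDrift) (u v : L) : W.kernel (1 + u) (1 + v) =
    (κ (W.sigma11 : ℂ) / 2 + (W.wt L (-1) 0 + 2 * W.wt L (-1) (-1)) * v +
      W.wt L (-1) (-1) * v ^ 2) * u ^ 2 + (κ (W.sigma12 : ℂ) * v +
      (W.wt L 0 (-1) + 2 * W.wt L (-1) (-1)) * v ^ 2) * u + κ (W.sigma22 : ℂ) / 2 * v ^ 2 := by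
  rw [← cat_one_add hzd, ← cbt_one_add hzd, ← cct_one_add hzd, kernel_eq_x]
  ring

/-- The expansion of `c̃` in the form of that of `ã`. -/
lemma cct_one_add' (hzd : W.ZeroDrift) (v : L) : W.cct (1 + v) = κ (W.sigma11 : ℂ) / 2 +
    (W.wt L 1 0 + 2 * W.wt L 1 (-1)) * v + W.wt L 1 (-1) * v ^ 2 := by
  have h2 := two_ne_zero_of_algebra (L := L)
  rw [cct_eq, wt_sigma11]
  field_simp
  linear_combination hzd.wt_x (L := L)

lemma ca_one_add (hzd : W.ZeroDrift) (v : L) : W.ca (1 + v) = κ (W.sigma22 : ℂ) / 2 +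
    (W.wt L 0 (-1) + 2 * W.wt L (-1) (-1)) * v + W.wt L (-1) (-1) * v ^ 2 := by
  have h2 := two_ne_zero_of_algebra (L := L)
  rw [ca_eq, wt_sigma22]
  field_simp
  linear_combination - hzd.wt_y (L := L)

lemma cc_one_add (hzd : W.ZeroDrift) (v : L) : W.cc (1 + v) = κ (W.sigma22 : ℂ) / 2 +
    (W.wt L 0 1 + 2 * W.wt L (-1) 1) * v + W.wt L (-1) 1 * v ^ 2 := by
  have h2 := two_ne_zero_of_algebra (L := L)
  rw [cc_eq, wt_sigma22]
  field_simp
  linear_combination hzd.wt_y (L := L)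

/-! ### Generic points of the curve `K = 0` -/

/-- A quadratic polynomial in `v - 1` with constant coefficients, not all zero, does not vanish at
a transcendental element. -/
lemma quadratic_ne_zero {v : L} (hv : Transcendental ℂ v) {a b c : ℂ}
    (h : a ≠ 0 ∨ c ≠ 0) : κ a + κ b * (v - 1) + κ c * (v - 1) ^ 2 ≠ 0 := by
  have hP : (Polynomial.C a + Polynomial.C b * Polynomial.X +
      Polynomial.C c * Polynomial.X ^ 2) ≠ 0 := by
    intro h0
    rcases h with h | h
    · exact h (by simpa using congrArg (fun p => Polynomial.coeff p 0) h0)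
    · exact h (by simpa [Polynomial.coeff_X] using congrArg (fun p => Polynomial.coeff p 2) h0)
  have hv' : Transcendental ℂ (v - 1) := transcendental_of_forall_ne fun d hd =>
    hv.ne_algebraMap (d + 1) (by rw [map_add, map_one, ← hd]; ring)
  simpa using hv'.aeval_ne_zero hP

lemma cat_ne_zero (hnd : W.NonDegenerate) (hzd : W.ZeroDrift) {v : L}
    (hv : Transcendental ℂ v) : W.cat v ≠ 0 := by
  have := quadratic_ne_zero hv (a := (W.sigma11 : ℂ) / 2)
    (b := W.p (-1) 0 + 2 * W.p (-1) (-1)) (c := W.p (-1) (-1))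
    (Or.inl (div_ne_zero (sigma11_ne hnd) two_ne_zero))
  rw [show v = 1 + (v - 1) by ring, cat_one_add hzd]
  simpa only [wt, map_add, map_mul, map_div₀, map_ofNat, add_sub_cancel_left] using this

lemma cct_ne_zero (hnd : W.NonDegenerate) (hzd : W.ZeroDrift) {v : L}
    (hv : Transcendental ℂ v) : W.cct v ≠ 0 := by
  have := quadratic_ne_zero hv (a := (W.sigma11 : ℂ) / 2)
    (b := W.p 1 0 + 2 * W.p 1 (-1)) (c := W.p 1 (-1))
    (Or.inl (div_ne_zero (sigma11_ne hnd) two_ne_zero))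
  rw [show v = 1 + (v - 1) by ring, cct_one_add' hzd]
  simpa only [wt, map_add, map_mul, map_div₀, map_ofNat, add_sub_cancel_left] using this

lemma ca_ne_zero (hnd : W.NonDegenerate) (hzd : W.ZeroDrift) {v : L}
    (hv : Transcendental ℂ v) : W.ca v ≠ 0 := by
  have := quadratic_ne_zero hv (a := (W.sigma22 : ℂ) / 2)
    (b := W.p 0 (-1) + 2 * W.p (-1) (-1)) (c := W.p (-1) (-1))
    (Or.inl (div_ne_zero (sigma22_ne hnd) two_ne_zero))
  rw [show v = 1 + (v - 1) by ring, ca_one_add hzd]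
  simpa only [wt, map_add, map_mul, map_div₀, map_ofNat, add_sub_cancel_left] using this

lemma cc_ne_zero (hnd : W.NonDegenerate) (hzd : W.ZeroDrift) {v : L}
    (hv : Transcendental ℂ v) : W.cc v ≠ 0 := by
  have := quadratic_ne_zero hv (a := (W.sigma22 : ℂ) / 2)
    (b := W.p 0 1 + 2 * W.p (-1) 1) (c := W.p (-1) 1)
    (Or.inl (div_ne_zero (sigma22_ne hnd) two_ne_zero))
  rw [show v = 1 + (v - 1) by ring, cc_one_add hzd]
  simpa only [wt, map_add, map_mul, map_div₀, map_ofNat, add_sub_cancel_left] using this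

/-- The discriminant of the kernel in `x` is not zero, because that of `γ` is not. -/
lemma disc_ne_zero (hnd : W.NonDegenerate) (hzd : W.ZeroDrift) {v : L}
    (hv : Transcendental ℂ v) : W.cbt v ^ 2 - 4 * W.cat v * W.cct v ≠ 0 := by
  have hd : ((W.sigma12 : ℂ) ^ 2 - W.sigma11 * W.sigma22) ≠ 0 := by
    have := (det_pos hnd).ne'
    intro h
    apply this
    have h' : ((W.sigma11 * W.sigma22 - W.sigma12 ^ 2 : ℝ) : ℂ) = 0 := by
      push_cast; linear_combination -h
    exact_mod_cast h'
  have h := quadratic_ne_zero hv (a := (W.sigma12 : ℂ) ^ 2 - W.sigma11 * W.sigma22)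
    (b := 2 * W.sigma12 * (W.p 0 (-1) + 2 * W.p (-1) (-1))
      - 2 * W.sigma22 * (W.p (-1) 0 + 2 * W.p (-1) (-1)))
    (c := (W.p 0 (-1) + 2 * W.p (-1) (-1)) ^ 2 - 2 * W.sigma22 * W.p (-1) (-1)) (Or.inl hd)
  have h1 : v - 1 ≠ 0 := sub_ne_zero.2 (by simpa using hv.ne_algebraMap 1)
  have h2 := two_ne_zero_of_algebra (L := L)
  have e1 := cat_one_add hzd (v - 1)
  have e2 := cbt_one_add hzd (v - 1)
  have e3 := cct_one_add hzd (v - 1)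
  rw [add_sub_cancel] at e1 e2 e3
  have key : W.cbt v ^ 2 - 4 * W.cat v * W.cct v =
      (2 * W.cat v + W.cbt v) ^ 2 - 4 * W.cat v * (W.cat v + W.cbt v + W.cct v) := by ring
  rw [key, e2, e3, e1]
  intro h0
  apply mul_ne_zero (pow_ne_zero 2 h1) h
  rw [← h0]
  simp only [wt, map_sub, map_add, map_mul, map_pow, map_ofNat]
  field_simp
  ring

/-- A generic point of the curve `K = 0`: neither coordinate is constant. -/
structure OnCurve (W : Walk) (q : L × L) : Prop where
  fst : Transcendental ℂ q.1
  snd : Transcendental ℂ q.2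
  kernel : W.kernel q.1 q.2 = 0

/-- A point of the curve whose ordinate is not constant is generic, because `K(c, y)` is not zero for
any constant `c`. -/
lemma OnCurve.of_snd (hnd : W.NonDegenerate) (hzd : W.ZeroDrift) {u v : L}
    (hv : Transcendental ℂ v) (h : W.kernel u v = 0) : W.OnCurve (u, v) := by
  refine ⟨transcendental_of_forall_ne ?_, hv, h⟩
  rintro c (rfl : u = κ c)
  have h11 := sigma11_ne hnd
  have h22 := sigma22_ne hnd
  have hq := quadratic_ne_zero hv (a := (W.sigma11 : ℂ) / 2 * (c - 1) ^ 2)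
    (b := (W.p (-1) 0 + 2 * W.p (-1) (-1)) * (c - 1) ^ 2 + W.sigma12 * (c - 1))
    (c := W.p (-1) (-1) * (c - 1) ^ 2 + (W.p 0 (-1) + 2 * W.p (-1) (-1)) * (c - 1)
      + (W.sigma22 : ℂ) / 2) (by
    by_cases hc : c - 1 = 0
    · right; simp [hc, h22]
    · left; simp [hc, h11])
  apply hq
  have hk := kernel_one_add hzd (κ c - 1) (v - 1)
  rw [add_sub_cancel, add_sub_cancel] at hk
  rw [← h, hk]
  simp only [wt, map_sub, map_add, map_mul, map_pow, map_ofNat, map_div₀, map_one]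
  ring

lemma OnCurve.of_fst (hnd : W.NonDegenerate) (hzd : W.ZeroDrift) {u v : L}
    (hu : Transcendental ℂ u) (h : W.kernel u v = 0) : W.OnCurve (u, v) := by
  refine ⟨hu, transcendental_of_forall_ne ?_, h⟩
  rintro c (rfl : v = κ c)
  have h11 := sigma11_ne hnd
  have h22 := sigma22_ne hnd
  have hq := quadratic_ne_zero hu (a := (W.sigma22 : ℂ) / 2 * (c - 1) ^ 2)
    (b := W.sigma12 * (c - 1) + (W.p 0 (-1) + 2 * W.p (-1) (-1)) * (c - 1) ^ 2)
    (c := (W.sigma11 : ℂ) / 2 + (W.p (-1) 0 + 2 * W.p (-1) (-1)) * (c - 1)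
      + W.p (-1) (-1) * (c - 1) ^ 2) (by
    by_cases hc : c - 1 = 0
    · right; simp [hc, h11]
    · left; simp [hc, h22])
  apply hq
  have hk := kernel_one_add hzd (u - 1) (κ c - 1)
  rw [add_sub_cancel, add_sub_cancel] at hk
  rw [← h, hk]
  simp only [wt, map_sub, map_add, map_mul, map_pow, map_ofNat, map_div₀, map_one]
  ring

lemma OnCurve.fst_ne_zero {q : L × L} (h : W.OnCurve q) : q.1 ≠ 0 := by
  simpa using h.fst.ne_algebraMap 0

lemma OnCurve.snd_ne_zero {q : L × L} (h : W.OnCurve q) : q.2 ≠ 0 := by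
  simpa using h.snd.ne_algebraMap 0

lemma OnCurve.map {K : Type*} [Field K] [Algebra ℂ K] (φ : L →ₐ[ℂ] K) {q : L × L}
    (h : W.OnCurve q) : W.OnCurve (Prod.map φ φ q) :=
  ⟨h.fst.map φ, h.snd.map φ, by simp [← map_kernel, h.kernel]⟩

lemma OnCurve.phi (hnd : W.NonDegenerate) (hzd : W.ZeroDrift) {q : L × L} (h : W.OnCurve q) :
    W.OnCurve (W.Phi q) := by
  refine OnCurve.of_snd hnd hzd h.snd ?_
  have h1 := h.fst_ne_zero
  have h2 := cat_ne_zero hnd hzd h.snd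
  have h3 := h.kernel
  rw [kernel_eq_x] at h3 ⊢
  field_simp
  linear_combination (W.cct q.2) * h3

lemma OnCurve.psi (hnd : W.NonDegenerate) (hzd : W.ZeroDrift) {q : L × L} (h : W.OnCurve q) :
    W.OnCurve (W.Psi q) := by
  refine OnCurve.of_fst hnd hzd h.fst ?_
  have h1 := h.snd_ne_zero
  have h2 := ca_ne_zero hnd hzd h.fst
  have h3 := h.kernel
  rw [kernel_eq_y] at h3 ⊢
  field_simp
  linear_combination (W.cc q.1) * h3

lemma OnCurve.theta (hnd : W.NonDegenerate) (hzd : W.ZeroDrift) {q : L × L} (h : W.OnCurve q) :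
    W.OnCurve (W.Theta q) := (h.phi hnd hzd).psi hnd hzd

lemma OnCurve.theta_iterate (hnd : W.NonDegenerate) (hzd : W.ZeroDrift) {q : L × L}
    (h : W.OnCurve q) (i : ℕ) : W.OnCurve (W.Theta^[i] q) := by
  induction i with
  | zero => exact h
  | succ i ih => rw [Function.iterate_succ_apply']; exact ih.theta hnd hzd

lemma phi_phi (hnd : W.NonDegenerate) (hzd : W.ZeroDrift) {q : L × L}
    (h1 : Transcendental ℂ q.1) (h2 : Transcendental ℂ q.2) : W.Phi (W.Phi q) = q := by
  have h1' : q.1 ≠ 0 := by simpa using h1.ne_algebraMap 0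
  have h3 := cat_ne_zero hnd hzd h2
  have h4 := cct_ne_zero hnd hzd h2
  ext
  · simp only [Phi]; field_simp
  · rfl

lemma psi_psi (hnd : W.NonDegenerate) (hzd : W.ZeroDrift) {q : L × L}
    (h1 : Transcendental ℂ q.1) (h2 : Transcendental ℂ q.2) : W.Psi (W.Psi q) = q := by
  have h1' : q.2 ≠ 0 := by simpa using h2.ne_algebraMap 0
  have h3 := ca_ne_zero hnd hzd h1
  have h4 := cc_ne_zero hnd hzd h1
  ext
  · rfl
  · simp only [Psi]; field_simp

end
end Walk

/-! ### Orbits of a group generated by two involutions -/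

section Orbit

variable {X : Type*} (Φ Ψ : X → X) {q : X} {N : ℕ}

/-- Here and below `Φ` and `Ψ` are assumed to be involutive only at the points of one orbit, as is the
case for birational maps. -/
lemma iterate_reflect_add
    (h1 : ∀ i, Φ (Φ ((Ψ ∘ Φ)^[i] q)) = (Ψ ∘ Φ)^[i] q)
    (h2 : ∀ i, Ψ (Ψ (Φ ((Ψ ∘ Φ)^[i] q))) = Φ ((Ψ ∘ Φ)^[i] q)) (i k : ℕ) :
    (Ψ ∘ Φ)^[i] (Ψ ((Ψ ∘ Φ)^[i + k] q)) = Ψ ((Ψ ∘ Φ)^[k] q) := by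
  induction i with
  | zero => simp
  | succ i ih =>
    rw [Function.iterate_succ_apply, show i + 1 + k = (i + k) + 1 by ring,
      Function.iterate_succ_apply', Function.comp_apply, Function.comp_apply (f := Ψ), h2, h1, ih]

/-- If the product `Θ = Ψ ∘ Φ` of two involutions satisfies `Θ^N q = q`, then the orbit of `Ψ q`
is the image under `Ψ` of the orbit of `q`, traversed backwards. -/
lemma iterate_reflect (hN : (Ψ ∘ Φ)^[N] q = q)
    (h1 : ∀ i, Φ (Φ ((Ψ ∘ Φ)^[i] q)) = (Ψ ∘ Φ)^[i] q)
    (h2 : ∀ i, Ψ (Ψ (Φ ((Ψ ∘ Φ)^[i] q))) = Φ ((Ψ ∘ Φ)^[i] q)) {i : ℕ} (hi : i ≤ N) :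
    (Ψ ∘ Φ)^[i] (Ψ q) = Ψ ((Ψ ∘ Φ)^[N - i] q) := by
  have := iterate_reflect_add Φ Ψ h1 h2 i (N - i)
  rwa [Nat.add_sub_cancel' hi, hN] at this

variable {V : Type*} [AddCommGroup V]

/-- The alternating orbit sum of a `Ψ`-invariant function is zero. -/
lemma orbit_sum_of_psi_invariant (hN : (Ψ ∘ Φ)^[N] q = q)
    (h1 : ∀ i, Φ (Φ ((Ψ ∘ Φ)^[i] q)) = (Ψ ∘ Φ)^[i] q)
    (h2 : ∀ i, Ψ (Ψ (Φ ((Ψ ∘ Φ)^[i] q))) = Φ ((Ψ ∘ Φ)^[i] q)) (f : X → V)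
    (hf : ∀ p, f (Ψ p) = f p) :
    ∑ i ∈ Finset.range N, (f ((Ψ ∘ Φ)^[i] q) - f ((Ψ ∘ Φ)^[i] (Ψ q))) = 0 := by
  have hB : ∑ i ∈ Finset.range N, f ((Ψ ∘ Φ)^[i] (Ψ q)) =
      ∑ i ∈ Finset.range N, f ((Ψ ∘ Φ)^[i + 1] q) := by
    rw [← Finset.sum_range_reflect]
    refine Finset.sum_congr rfl fun i hi => ?_
    have hi' := Finset.mem_range.1 hi
    rw [iterate_reflect Φ Ψ hN h1 h2 (by omega), hf, show N - (N - 1 - i) = i + 1 by omega]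
  have hs := Finset.sum_range_succ (fun i => f ((Ψ ∘ Φ)^[i] q)) N
  rw [Finset.sum_range_succ', hN] at hs
  rw [Finset.sum_sub_distrib, hB, sub_eq_zero]
  simpa using hs.symm

/-- The alternating orbit sum of a `Φ`-invariant function is zero. -/
lemma orbit_sum_of_phi_invariant (hN : (Ψ ∘ Φ)^[N] q = q)
    (h1 : ∀ i, Φ (Φ ((Ψ ∘ Φ)^[i] q)) = (Ψ ∘ Φ)^[i] q)
    (h2 : ∀ i, Ψ (Ψ (Φ ((Ψ ∘ Φ)^[i] q))) = Φ ((Ψ ∘ Φ)^[i] q)) (f : X → V)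
    (hf : ∀ p, f (Φ p) = f p) :
    ∑ i ∈ Finset.range N, (f ((Ψ ∘ Φ)^[i] q) - f ((Ψ ∘ Φ)^[i] (Ψ q))) = 0 := by
  rw [Finset.sum_sub_distrib, sub_eq_zero]
  rw [← Finset.sum_range_reflect]
  refine Finset.sum_congr rfl fun i hi => ?_
  have hi' := Finset.mem_range.1 hi
  rw [iterate_reflect Φ Ψ hN h1 h2 hi'.le, show N - i = (N - 1 - i) + 1 by omega,
    Function.iterate_succ_apply', Function.comp_apply, h2, hf]

end Orbit

/-- Summation by parts for the weights `i` of the decoupling function. -/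
lemma sum_telescope {L : Type*} [CommRing L] (A B : ℕ → L) (n : ℕ) :
    ∑ i ∈ Finset.Ico 1 (n + 1), (i : L) * ((A i + B i) - (B (i - 1) + A (i + 1))) =
      ∑ i ∈ Finset.range (n + 1), (A i - B i) - A 0 - n * A (n + 1) + (n + 1) * B n := by
  induction n with
  | zero => simp
  | succ n ih =>
    rw [Finset.sum_Ico_succ_top (by omega), ih, Finset.sum_range_succ _ (n + 1)]
    simp only [Nat.add_sub_cancel]
    push_cast
    ring

namespace Walk

variable {W : Walk}

/-! ### Algebraic functions and generic points of the curve -/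

/-- The value of `M` at a point given as a pair. -/
abbrev ev {L : Type*} [Field L] [Algebra ℂ L] (M : Rat2) (q : L × L) : L := eval2 M q.1 q.2

lemma eq_and_eq_or_of_add_mul {L : Type*} [Field L] {a b c d : L} (h1 : a + b = c + d)
    (h2 : a * b = c * d) : (a = c ∧ b = d) ∨ (a = d ∧ b = c) := by
  have : (a - c) * (a - d) = 0 := by linear_combination a * h1 - h2
  rcases mul_eq_zero.1 this with h | h
  · left; exact ⟨sub_eq_zero.1 h, by linear_combination h1 - h⟩
  · right; exact ⟨sub_eq_zero.1 h, by linear_combination h1 - h⟩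

lemma algSqrt_sq (z : AlgFun) : algSqrt z ^ 2 = z :=
  (IsAlgClosed.exists_pow_nat_eq z (n := 2) two_pos).choose_spec

lemma Xp_add_Xm (hnd : W.NonDegenerate) (hzd : W.ZeroDrift) :
    W.Xp + W.Xm = -W.cbt tvar / W.cat tvar := by
  have h := cat_ne_zero hnd hzd transcendental_tvar
  have h2 := two_ne_zero_of_algebra (L := AlgFun)
  rw [Xp, Xm]; field_simp; ring

lemma Xp_mul_Xm (hnd : W.NonDegenerate) (hzd : W.ZeroDrift) :
    W.Xp * W.Xm = W.cct tvar / W.cat tvar := by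
  have h := cat_ne_zero hnd hzd transcendental_tvar
  have h2 := two_ne_zero_of_algebra (L := AlgFun)
  have h3 := algSqrt_sq (W.cbt tvar ^ 2 - 4 * W.cat tvar * W.cct tvar)
  rw [Xp, Xm]; field_simp; linear_combination -h3

lemma Yp_add_Ym (hnd : W.NonDegenerate) (hzd : W.ZeroDrift) :
    W.Yp + W.Ym = -W.cb tvar / W.ca tvar := by
  have h := ca_ne_zero hnd hzd transcendental_tvar
  have h2 := two_ne_zero_of_algebra (L := AlgFun)
  rw [Yp, Ym]; field_simp; ring

lemma Yp_mul_Ym (hnd : W.NonDegenerate) (hzd : W.ZeroDrift) :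
    W.Yp * W.Ym = W.cc tvar / W.ca tvar := by
  have h := ca_ne_zero hnd hzd transcendental_tvar
  have h2 := two_ne_zero_of_algebra (L := AlgFun)
  have h3 := algSqrt_sq (W.cb tvar ^ 2 - 4 * W.ca tvar * W.cc tvar)
  rw [Yp, Ym]; field_simp; linear_combination -h3

lemma Xp_ne_Xm (hnd : W.NonDegenerate) (hzd : W.ZeroDrift) : W.Xp ≠ W.Xm := by
  have h := cat_ne_zero hnd hzd transcendental_tvar
  have h2 := two_ne_zero_of_algebra (L := AlgFun)
  have h3 := algSqrt_sq (W.cbt tvar ^ 2 - 4 * W.cat tvar * W.cct tvar)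
  have h4 := disc_ne_zero hnd hzd transcendental_tvar
  intro he
  rw [Xp, Xm, div_left_inj' (mul_ne_zero h2 h)] at he
  have h0 : algSqrt (W.cbt tvar ^ 2 - 4 * W.cat tvar * W.cct tvar) = 0 := by
    have : 2 * algSqrt (W.cbt tvar ^ 2 - 4 * W.cat tvar * W.cct tvar) = 0 := by
      linear_combination he
    exact (mul_eq_zero.1 this).resolve_left h2
  rw [h0] at h3
  exact h4 (by rw [← h3]; ring)

lemma onCurve_Xp (hnd : W.NonDegenerate) (hzd : W.ZeroDrift) : W.OnCurve (W.Xp, tvar) := by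
  refine OnCurve.of_snd hnd hzd transcendental_tvar ?_
  have h := cat_ne_zero hnd hzd transcendental_tvar
  have h1 := Xp_add_Xm hnd hzd
  have h2 := Xp_mul_Xm hnd hzd
  rw [eq_div_iff h] at h1 h2
  rw [kernel_eq_x]; linear_combination W.Xp * h1 - h2

lemma onCurve_Xm (hnd : W.NonDegenerate) (hzd : W.ZeroDrift) : W.OnCurve (W.Xm, tvar) := by
  refine OnCurve.of_snd hnd hzd transcendental_tvar ?_
  have h := cat_ne_zero hnd hzd transcendental_tvar
  have h1 := Xp_add_Xm hnd hzd
  have h2 := Xp_mul_Xm hnd hzd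
  rw [eq_div_iff h] at h1 h2
  rw [kernel_eq_x]; linear_combination W.Xm * h1 - h2

lemma onCurve_Yp (hnd : W.NonDegenerate) (hzd : W.ZeroDrift) : W.OnCurve (tvar, W.Yp) := by
  refine OnCurve.of_fst hnd hzd transcendental_tvar ?_
  have h := ca_ne_zero hnd hzd transcendental_tvar
  have h1 := Yp_add_Ym hnd hzd
  have h2 := Yp_mul_Ym hnd hzd
  rw [eq_div_iff h] at h1 h2
  rw [kernel_eq_y]; linear_combination W.Yp * h1 - h2

lemma onCurve_Ym (hnd : W.NonDegenerate) (hzd : W.ZeroDrift) : W.OnCurve (tvar, W.Ym) := by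
  refine OnCurve.of_fst hnd hzd transcendental_tvar ?_
  have h := ca_ne_zero hnd hzd transcendental_tvar
  have h1 := Yp_add_Ym hnd hzd
  have h2 := Yp_mul_Ym hnd hzd
  rw [eq_div_iff h] at h1 h2
  rw [kernel_eq_y]; linear_combination W.Ym * h1 - h2

lemma phi_Xp (hnd : W.NonDegenerate) (hzd : W.ZeroDrift) :
    W.Phi (W.Xp, tvar) = (W.Xm, tvar) := by
  ext
  · simp only [Phi]
    rw [← Xp_mul_Xm hnd hzd, inv_mul_cancel_left₀ (onCurve_Xp hnd hzd).fst_ne_zero]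
  · rfl

lemma psi_Yp (hnd : W.NonDegenerate) (hzd : W.ZeroDrift) :
    W.Psi (tvar, W.Yp) = (tvar, W.Ym) := by
  ext
  · rfl
  · simp only [Psi]
    rw [← Yp_mul_Ym hnd hzd, inv_mul_cancel_left₀ (onCurve_Yp hnd hzd).snd_ne_zero]

section

variable {L : Type*} [Field L] [Algebra ℂ L] {q : L × L}

lemma OnCurve.fst_add_phi (hnd : W.NonDegenerate) (hzd : W.ZeroDrift) (h : W.OnCurve q) :
    q.1 + (W.Phi q).1 = -W.cbt q.2 / W.cat q.2 := by
  have h1 := cat_ne_zero hnd hzd h.snd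
  have h2 := h.fst_ne_zero
  have h3 := h.kernel
  rw [kernel_eq_x] at h3
  simp only [Phi]; field_simp; linear_combination h3

lemma OnCurve.fst_mul_phi (h : W.OnCurve q) :
    q.1 * (W.Phi q).1 = W.cct q.2 / W.cat q.2 := by
  simp only [Phi]; rw [mul_inv_cancel_left₀ h.fst_ne_zero]

lemma OnCurve.snd_add_psi (hnd : W.NonDegenerate) (hzd : W.ZeroDrift) (h : W.OnCurve q) :
    q.2 + (W.Psi q).2 = -W.cb q.1 / W.ca q.1 := by
  have h1 := ca_ne_zero hnd hzd h.fst
  have h2 := h.snd_ne_zero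
  have h3 := h.kernel
  rw [kernel_eq_y] at h3
  simp only [Psi]; field_simp; linear_combination h3

lemma OnCurve.snd_mul_psi (h : W.OnCurve q) :
    q.2 * (W.Psi q).2 = W.cc q.1 / W.ca q.1 := by
  simp only [Psi]; rw [mul_inv_cancel_left₀ h.snd_ne_zero]

/-- A homomorphism sending `t` to the ordinate of a point of the curve sends `X_±` to the two
abscissae. -/
lemma OnCurve.map_Xp (hnd : W.NonDegenerate) (hzd : W.ZeroDrift) (h : W.OnCurve q)
    (τ : AlgFun →ₐ[ℂ] L) (hτ : τ tvar = q.2) :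
    (τ W.Xp = q.1 ∧ τ W.Xm = (W.Phi q).1) ∨ (τ W.Xp = (W.Phi q).1 ∧ τ W.Xm = q.1) := by
  apply eq_and_eq_or_of_add_mul
  · rw [← map_add, Xp_add_Xm hnd hzd, h.fst_add_phi hnd hzd]; simp [hτ]
  · rw [← map_mul, Xp_mul_Xm hnd hzd, h.fst_mul_phi]; simp [hτ]

lemma OnCurve.map_Yp (hnd : W.NonDegenerate) (hzd : W.ZeroDrift) (h : W.OnCurve q)
    (τ : AlgFun →ₐ[ℂ] L) (hτ : τ tvar = q.1) :
    (τ W.Yp = q.2 ∧ τ W.Ym = (W.Psi q).2) ∨ (τ W.Yp = (W.Psi q).2 ∧ τ W.Ym = q.2) := by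
  apply eq_and_eq_or_of_add_mul
  · rw [← map_add, Yp_add_Ym hnd hzd, h.snd_add_psi hnd hzd]; simp [hτ]
  · rw [← map_mul, Yp_mul_Ym hnd hzd, h.snd_mul_psi]; simp [hτ]

end

/-- The inclusion of a field into its algebraic closure, over `ℂ`. -/
abbrev inclClosure (L : Type) [Field L] [Algebra ℂ L] : L →ₐ[ℂ] AlgebraicClosure L :=
  IsScalarTower.toAlgHom ℂ L (AlgebraicClosure L)

/-- `M(x, y) = F(x) + G(y)` at the generic points of the curve. -/
def Decouples (W : Walk) (M : Rat2) (F G : RatFunc ℂ) : Prop :=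
  ∀ {L : Type} [Field L] [Algebra ℂ L] (q : L × L), W.OnCurve q →
    eval1 G q.2 = ev M q - eval1 F q.1

/-- If `M(X, t) - F(X)` takes the same value for `X = X_+` and `X = X_-`, then this value is a
rational function, because it is fixed by the Galois group; substituting for `t`, one gets an
identity at all generic points of the curve. -/
lemma decouples_of_branches (hnd : W.NonDegenerate) (hzd : W.ZeroDrift) {M : Rat2}
    {F : RatFunc ℂ} {z : AlgFun} (h1 : z = eval2 M W.Xp tvar - eval1 F W.Xp)
    (h2 : z = eval2 M W.Xm tvar - eval1 F W.Xm) :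
    IsRationalFun z ∧ W.Decouples M F (toRat z) := by
  have hz : IsRationalFun z := by
    refine isRationalFun_of_fixed fun σ => ?_
    let s : AlgFun →ₐ[ℂ] AlgFun := (σ.restrictScalars ℂ).toAlgHom
    have hs : ∀ w, s w = σ w := fun w => rfl
    have hst : s tvar = tvar := by rw [hs, tvar, σ.commutes]
    have := (onCurve_Xp hnd hzd).map_Xp hnd hzd s hst
    rw [phi_Xp hnd hzd] at this
    rw [← hs]
    nth_rewrite 1 [h1]
    rw [map_sub, map_eval2, map_eval1, hst]
    rcases this with ⟨h, -⟩ | ⟨h, -⟩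
    · rw [h, ← h1]
    · rw [h, ← h2]
  refine ⟨hz, ?_⟩
  intro L _ _ q hq
  obtain ⟨τ, hτ⟩ := exists_algHom_of_transcendental hq.snd
  have hq' := hq.map (inclClosure L)
  have hm := hq'.map_Xp hnd hzd τ hτ
  apply (inclClosure L).toRingHom.injective
  change inclClosure L _ = inclClosure L _
  rw [map_sub, map_eval1, map_eval1, map_eval2]
  have e : τ z = eval1 (toRat z) (inclClosure L q.2) := by
    rw [← eval1_toRat hz, map_eval1, hτ, eval1_toRat hz]; rfl
  rw [← e]
  rcases hm with ⟨h, -⟩ | ⟨-, h⟩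
  · rw [h1, map_sub, map_eval2, map_eval1, hτ, h]; rfl
  · rw [h2, map_sub, map_eval2, map_eval1, hτ, h]; rfl

/-- The right-hand side of the formula for the decoupling function, with the points `(t, Y_±)`
replaced by `q` and `Ψ q`. -/
def decouplingSum (W : Walk) {L : Type*} [Field L] [Algebra ℂ L] (M : Rat2) (q : L × L) : L :=
  -(1 / (W.halfOrder : L)) * ∑ i ∈ Finset.Ico 1 W.halfOrder, (i : L) *
    (ev M (W.Theta^[i] q) + ev M (W.Theta^[i] (W.Psi q)))

lemma decouplingFun_eq (hnd : W.NonDegenerate) (hzd : W.ZeroDrift) (M : Rat2) :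
    W.decouplingFun M = W.decouplingSum M (tvar, W.Yp) := by
  rw [decouplingFun, decouplingSum, psi_Yp hnd hzd]

lemma map_ev {L K : Type*} [Field L] [Algebra ℂ L] [Field K] [Algebra ℂ K] (φ : L →ₐ[ℂ] K)
    (M : Rat2) (q : L × L) : φ (ev M q) = ev M (Prod.map φ φ q) := by
  rw [map_eval2]; rfl

lemma map_decouplingSum {L K : Type*} [Field L] [Algebra ℂ L] [Field K] [Algebra ℂ K]
    (φ : L →ₐ[ℂ] K) (M : Rat2) (q : L × L) :
    φ (W.decouplingSum M q) = W.decouplingSum M (Prod.map φ φ q) := by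
  simp only [decouplingSum, map_mul, map_neg, map_div₀, map_one, map_natCast, map_sum, map_add,
    map_ev, map_Theta_iterate, map_Psi]

lemma decouplingSum_psi (hnd : W.NonDegenerate) (hzd : W.ZeroDrift) {L : Type*} [Field L]
    [Algebra ℂ L] (M : Rat2) {q : L × L} (h : W.OnCurve q) :
    W.decouplingSum M (W.Psi q) = W.decouplingSum M q := by
  simp only [decouplingSum, psi_psi hnd hzd h.fst h.snd, add_comm]

/-- The value of `decouplingSum` under a homomorphism that sends `t` to the abscissa. -/
lemma map_decouplingFun (hnd : W.NonDegenerate) (hzd : W.ZeroDrift) {L : Type*} [Field L]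
    [Algebra ℂ L] (M : Rat2) {q : L × L} (h : W.OnCurve q) (τ : AlgFun →ₐ[ℂ] L)
    (hτ : τ tvar = q.1) : τ (W.decouplingFun M) = W.decouplingSum M q := by
  rw [decouplingFun_eq hnd hzd, map_decouplingSum]
  rcases h.map_Yp hnd hzd τ hτ with ⟨h1, -⟩ | ⟨h1, -⟩
  · rw [Prod.map, h1, hτ]
  · rw [← decouplingSum_psi hnd hzd M h, Prod.map, h1, hτ]; rfl

/-- The Galois group at most exchanges `Y_+` and `Y_-`, and the decoupling function is symmetric in
them. -/
lemma isRationalFun_decouplingFun (hnd : W.NonDegenerate) (hzd : W.ZeroDrift) (M : Rat2) :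
    IsRationalFun (W.decouplingFun M) := by
  refine isRationalFun_of_fixed fun σ => ?_
  let s : AlgFun →ₐ[ℂ] AlgFun := (σ.restrictScalars ℂ).toAlgHom
  have hs : ∀ w, s w = σ w := fun w => rfl
  have hst : s tvar = tvar := by rw [hs, tvar, σ.commutes]
  rw [← hs, map_decouplingFun hnd hzd M (onCurve_Yp hnd hzd) s hst, decouplingFun_eq hnd hzd]

/-- The formula for the decoupling function holds at every generic point of the curve. -/
lemma eval1_decouplingFun (hnd : W.NonDegenerate) (hzd : W.ZeroDrift) (M : Rat2) {L : Type}
    [Field L] [Algebra ℂ L] {q : L × L} (h : W.OnCurve q) :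
    eval1 (toRat (W.decouplingFun M)) q.1 = W.decouplingSum M q := by
  obtain ⟨τ, hτ⟩ := exists_algHom_of_transcendental h.fst
  apply (inclClosure L).toRingHom.injective
  change inclClosure L _ = inclClosure L _
  rw [map_decouplingSum, ← map_decouplingFun hnd hzd M (h.map (inclClosure L)) τ hτ,
    ← eval1_toRat (isRationalFun_decouplingFun hnd hzd M), map_eval1, map_eval1, hτ,
    eval1_toRat (isRationalFun_decouplingFun hnd hzd M)]
  rfl

end Walk

namespace Walk

variable {W : Walk}

/-! ### The alternating orbit sum and the decoupling function -/

section Generic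

variable {L : Type*} [Field L] [Algebra ℂ L] {P : L × L}

/-- The generic point of the plane. -/
abbrev genericPt : Rat2 × Rat2 := (xvar, yvar)

/-- The coordinates of `q` are defined at the point `P`, and their values there are those of
`q'`. -/
def SpecPt (P : L × L) (q : Rat2 × Rat2) (q' : L × L) : Prop :=
  SpecAt P.1 P.2 q.1 q'.1 ∧ SpecAt P.1 P.2 q.2 q'.2

variable {q : Rat2 × Rat2} {q' : L × L}

lemma specPt_genericPt : SpecPt P genericPt P := ⟨SpecAt.x, SpecAt.y⟩

lemma SpecPt.unique {q'' : L × L} (h : SpecPt P q q') (h' : SpecPt P q q'') : q' = q'' :=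
  Prod.ext (h.1.unique h'.1) (h.2.unique h'.2)

lemma SpecPt.phi (hnd : W.NonDegenerate) (hzd : W.ZeroDrift) (h : SpecPt P q q')
    (h' : W.OnCurve q') : SpecPt P (W.Phi q) (W.Phi q') := by
  refine ⟨(h.1.inv h'.fst_ne_zero).mul (SpecAt.div ?_ ?_ (cat_ne_zero hnd hzd h'.snd)), h.2⟩
  · simp only [cct_eq]
    exact ((SpecAt.const _).add ((SpecAt.const _).mul h.2)).add ((SpecAt.const _).mul (h.2.pow 2))
  · simp only [cat_eq]
    exact ((SpecAt.const _).add ((SpecAt.const _).mul h.2)).add ((SpecAt.const _).mul (h.2.pow 2))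

lemma SpecPt.psi (hnd : W.NonDegenerate) (hzd : W.ZeroDrift) (h : SpecPt P q q')
    (h' : W.OnCurve q') : SpecPt P (W.Psi q) (W.Psi q') := by
  refine ⟨h.1, (h.2.inv h'.snd_ne_zero).mul (SpecAt.div ?_ ?_ (ca_ne_zero hnd hzd h'.fst))⟩
  · simp only [cc_eq]
    exact ((SpecAt.const _).add ((SpecAt.const _).mul h.1)).add ((SpecAt.const _).mul (h.1.pow 2))
  · simp only [ca_eq]
    exact ((SpecAt.const _).add ((SpecAt.const _).mul h.1)).add ((SpecAt.const _).mul (h.1.pow 2))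

lemma SpecPt.theta (hnd : W.NonDegenerate) (hzd : W.ZeroDrift) (h : SpecPt P q q')
    (h' : W.OnCurve q') : SpecPt P (W.Theta q) (W.Theta q') :=
  (h.phi hnd hzd h').psi hnd hzd (h'.phi hnd hzd)

lemma SpecPt.theta_iterate (hnd : W.NonDegenerate) (hzd : W.ZeroDrift) (h : SpecPt P q q')
    (h' : W.OnCurve q') (i : ℕ) : SpecPt P (W.Theta^[i] q) (W.Theta^[i] q') := by
  induction i with
  | zero => exact h
  | succ i ih =>
    rw [Function.iterate_succ_apply', Function.iterate_succ_apply']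
    exact ih.theta hnd hzd (h'.theta_iterate hnd hzd i)

lemma theta_period_genericPt (hfin : W.FiniteGroup) :
    0 < W.halfOrder ∧ W.Theta^[W.halfOrder] genericPt = genericPt :=
  ⟨Function.minimalPeriod_pos_of_mem_periodicPts hfin, Function.iterate_minimalPeriod⟩

/-- An iterate of `Θ` that fixes the generic point of the plane fixes the generic points of the
curve. -/
lemma OnCurve.theta_period (hnd : W.NonDegenerate) (hzd : W.ZeroDrift) (hfin : W.FiniteGroup)
    (h : W.OnCurve P) : W.Theta^[W.halfOrder] P = P := by
  have h1 := (specPt_genericPt (P := P)).theta_iterate hnd hzd h W.halfOrder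
  rw [(theta_period_genericPt hfin).2] at h1
  exact h1.unique specPt_genericPt

/-- The pair `q` of rational functions specializes to a generic point of the curve `K = 0` at some
generic point of that curve. This is so for the whole orbit of the generic point of the plane. -/
def Nice (W : Walk) (q : Rat2 × Rat2) : Prop :=
  ∃ q' : AlgFun × AlgFun, SpecPt (W.Xp, tvar) q q' ∧ W.OnCurve q'

lemma Nice.fst (h : W.Nice q) : Transcendental ℂ q.1 := by
  obtain ⟨q', h1, h2⟩ := h
  exact h1.1.transcendental h2.fst

lemma Nice.snd (h : W.Nice q) : Transcendental ℂ q.2 := by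
  obtain ⟨q', h1, h2⟩ := h
  exact h1.2.transcendental h2.snd

lemma Nice.phi (hnd : W.NonDegenerate) (hzd : W.ZeroDrift) (h : W.Nice q) : W.Nice (W.Phi q) := by
  obtain ⟨q', h1, h2⟩ := h
  exact ⟨_, h1.phi hnd hzd h2, h2.phi hnd hzd⟩

lemma Nice.psi (hnd : W.NonDegenerate) (hzd : W.ZeroDrift) (h : W.Nice q) : W.Nice (W.Psi q) := by
  obtain ⟨q', h1, h2⟩ := h
  exact ⟨_, h1.psi hnd hzd h2, h2.psi hnd hzd⟩

lemma Nice.theta_iterate (hnd : W.NonDegenerate) (hzd : W.ZeroDrift) (h : W.Nice q) (i : ℕ) :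
    W.Nice (W.Theta^[i] q) := by
  induction i with
  | zero => exact h
  | succ i ih => rw [Function.iterate_succ_apply']; exact (ih.phi hnd hzd).psi hnd hzd

lemma nice_genericPt (hnd : W.NonDegenerate) (hzd : W.ZeroDrift) : W.Nice genericPt :=
  ⟨_, specPt_genericPt, onCurve_Xp hnd hzd⟩

lemma orbit_sum_generic_fst (hnd : W.NonDegenerate) (hzd : W.ZeroDrift) (hfin : W.FiniteGroup)
    (f : Rat2 → Rat2) : ∑ i ∈ Finset.range W.halfOrder, (f (W.Theta^[i] genericPt).1 -
      f (W.Theta^[i] (W.Psi genericPt)).1) = 0 := by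
  have hn := (nice_genericPt hnd hzd).theta_iterate hnd hzd
  exact orbit_sum_of_psi_invariant W.Phi W.Psi (theta_period_genericPt hfin).2
    (fun i => phi_phi hnd hzd (hn i).fst (hn i).snd)
    (fun i => psi_psi hnd hzd ((hn i).phi hnd hzd).fst ((hn i).phi hnd hzd).snd)
    (fun p => f p.1) (fun p => rfl)

lemma orbit_sum_generic_snd (hnd : W.NonDegenerate) (hzd : W.ZeroDrift) (hfin : W.FiniteGroup)
    (f : Rat2 → Rat2) : ∑ i ∈ Finset.range W.halfOrder, (f (W.Theta^[i] genericPt).2 -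
      f (W.Theta^[i] (W.Psi genericPt)).2) = 0 := by
  have hn := (nice_genericPt hnd hzd).theta_iterate hnd hzd
  exact orbit_sum_of_phi_invariant W.Phi W.Psi (theta_period_genericPt hfin).2
    (fun i => phi_phi hnd hzd (hn i).fst (hn i).snd)
    (fun i => psi_psi hnd hzd ((hn i).phi hnd hzd).fst ((hn i).phi hnd hzd).snd)
    (fun p => f p.2) (fun p => rfl)

/-! The function `x y / K(x, y)` is invariant under the group. -/

lemma ratio_phi (hnd : W.NonDegenerate) (hzd : W.ZeroDrift) {q : L × L}
    (h1 : Transcendental ℂ q.1) (h2 : Transcendental ℂ q.2) :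
    (W.Phi q).1 * (W.Phi q).2 / W.kernel (W.Phi q).1 (W.Phi q).2 =
      q.1 * q.2 / W.kernel q.1 q.2 := by
  have h1' : q.1 ≠ 0 := by simpa using h1.ne_algebraMap 0
  have h3 := cat_ne_zero hnd hzd h2
  have h4 := cct_ne_zero hnd hzd h2
  have hk : W.kernel (W.Phi q).1 (W.Phi q).2 =
      W.cct q.2 / (W.cat q.2 * q.1 ^ 2) * W.kernel q.1 q.2 := by
    simp only [kernel_eq_x, Phi]; field_simp; ring
  rw [hk]
  simp only [Phi]
  by_cases h0 : W.kernel q.1 q.2 = 0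
  · simp [h0]
  · field_simp

lemma ratio_psi (hnd : W.NonDegenerate) (hzd : W.ZeroDrift) {q : L × L}
    (h1 : Transcendental ℂ q.1) (h2 : Transcendental ℂ q.2) :
    (W.Psi q).1 * (W.Psi q).2 / W.kernel (W.Psi q).1 (W.Psi q).2 =
      q.1 * q.2 / W.kernel q.1 q.2 := by
  have h1' : q.2 ≠ 0 := by simpa using h2.ne_algebraMap 0
  have h3 := ca_ne_zero hnd hzd h1
  have h4 := cc_ne_zero hnd hzd h1
  have hk : W.kernel (W.Psi q).1 (W.Psi q).2 =
      W.cc q.1 / (W.ca q.1 * q.2 ^ 2) * W.kernel q.1 q.2 := by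
    simp only [kernel_eq_y, Psi]; field_simp; ring
  rw [hk]
  simp only [Psi]
  by_cases h0 : W.kernel q.1 q.2 = 0
  · simp [h0]
  · field_simp

lemma Nice.ratio_theta_iterate (hnd : W.NonDegenerate) (hzd : W.ZeroDrift) (h : W.Nice q)
    (i : ℕ) : (W.Theta^[i] q).1 * (W.Theta^[i] q).2 /
      W.kernel (W.Theta^[i] q).1 (W.Theta^[i] q).2 = q.1 * q.2 / W.kernel q.1 q.2 := by
  induction i with
  | zero => rfl
  | succ i ih =>
    have hi := h.theta_iterate hnd hzd i
    rw [Function.iterate_succ_apply', Theta,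
      ratio_psi hnd hzd (hi.phi hnd hzd).fst (hi.phi hnd hzd).snd, ratio_phi hnd hzd hi.fst hi.snd,
      ih]

end Generic

/-- Substitution of `q` into `M` commutes with specialization. -/
lemma _root_.Split.specAt_comp {M : Rat2} (h : Split M) {L : Type*} [Field L] [Algebra ℂ L]
    {P : L × L} {q : Rat2 × Rat2} {q' : L × L} (hq : SpecPt P q q') (h' : W.OnCurve q') :
    SpecAt P.1 P.2 (ev M q) (ev M q') := by
  obtain ⟨Q, A, B, hA, hB, hM⟩ := h
  have h1 := hq.1.transcendental h'.fst
  have h2 := hq.2.transcendental h'.snd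
  rw [ev, ev, (specAt_of_mul_eq hM (h1.aeval_ne_zero hA) (h2.aeval_ne_zero hB)).eval2,
    (specAt_of_mul_eq hM (h'.fst.aeval_ne_zero hA) (h'.snd.aeval_ne_zero hB)).eval2]
  exact (hq.1.mvaeval hq.2 Q).div ((hq.1.aeval A).mul (hq.2.aeval B))
    (mul_ne_zero (h'.fst.aeval_ne_zero hA) (h'.snd.aeval_ne_zero hB))

/-- The alternating sum of `M` over the orbit of the generic point vanishes. -/
def OrbitZero (W : Walk) (M : Rat2) : Prop :=
  ∑ i ∈ Finset.range W.halfOrder,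
    (ev M (W.Theta^[i] genericPt) - ev M (W.Theta^[i] (W.Psi genericPt))) = 0

lemma orbitZero_zero : W.OrbitZero 0 := by simp [OrbitZero, ev, eval2_zero]

/-- By specialization the alternating orbit sum vanishes at all generic points of the curve. -/
lemma OrbitZero.at_onCurve (hnd : W.NonDegenerate) (hzd : W.ZeroDrift) {M : Rat2}
    (h : W.OrbitZero M) (hM : Split M) {L : Type*} [Field L] [Algebra ℂ L] {P : L × L}
    (hP : W.OnCurve P) : ∑ i ∈ Finset.range W.halfOrder,
      (ev M (W.Theta^[i] P) - ev M (W.Theta^[i] (W.Psi P))) = 0 := by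
  have hs := SpecAt.sum (u := P.1) (v := P.2) (Finset.range W.halfOrder) fun i _ =>
    (hM.specAt_comp (specPt_genericPt.theta_iterate hnd hzd hP i) (hP.theta_iterate hnd hzd i)).sub
    (hM.specAt_comp ((specPt_genericPt.psi hnd hzd hP).theta_iterate hnd hzd (hP.psi hnd hzd) i)
      ((hP.psi hnd hzd).theta_iterate hnd hzd i))
  rw [h] at hs
  exact hs.unique SpecAt.zero

/-- One step of the discrete recursion, for `M = x y H`: from `x y H_n` to `x y H_{n+1}`. -/
def nextM (W : Walk) (M : Rat2) (F G : RatFunc ℂ) : Rat2 :=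
  xvar * yvar * ((M - eval1 F xvar - eval1 G yvar) / W.kernel xvar yvar)

lemma Nice.ev_nextM {q : Rat2 × Rat2} (h : W.Nice q) {M : Rat2} (hM : Split M)
    (F G : RatFunc ℂ) (hk : W.kernel q.1 q.2 ≠ 0) :
    ev (W.nextM M F G) q = (ev M q - eval1 F q.1 - eval1 G q.2) *
      (q.1 * q.2 / W.kernel q.1 q.2) := by
  have hK : SpecAt q.1 q.2 (W.kernel xvar yvar) (W.kernel q.1 q.2) := by
    rw [kernel_eq_y, kernel_eq_y, ca_eq, cb_eq, cc_eq, ca_eq, cb_eq, cc_eq]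
    have hc : ∀ i j, SpecAt q.1 q.2 (W.wt Rat2 i j) (W.wt Rat2 i j) := fun i j => SpecAt.const _
    have hx := SpecAt.x (u := q.1) (v := q.2)
    have hy := SpecAt.y (u := q.1) (v := q.2)
    exact (((((hc _ _).add ((hc _ _).mul hx)).add ((hc _ _).mul (hx.pow 2))).mul (hy.pow 2)).add
      (((((hc _ _).add ((hc _ _).mul hx)).add ((hc _ _).mul (hx.pow 2))).sub hx).mul hy)).add
      (((hc _ _).add ((hc _ _).mul hx)).add ((hc _ _).mul (hx.pow 2)))
  have := (SpecAt.x.mul SpecAt.y).mul ((((hM.specAt h.fst h.snd).sub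
    (SpecAt.x.eval1 F h.fst)).sub (SpecAt.y.eval1 G h.snd)).div hK hk)
  rw [ev, nextM, this.eval2]
  ring

lemma kernel_generic_ne_zero (hnd : W.NonDegenerate) (hzd : W.ZeroDrift) :
    W.kernel xvar yvar ≠ 0 := by
  -- At a point with constant ordinate other than `1`, the kernel does not vanish.
  intro h
  have hv : W.kernel (xvar) (algebraMap ℂ Rat2 2) = 0 := by
    have hK : SpecAt xvar (algebraMap ℂ Rat2 2) (W.kernel xvar yvar)
        (W.kernel xvar (algebraMap ℂ Rat2 2)) := by
      rw [kernel_eq_y, kernel_eq_y, ca_eq, cb_eq, cc_eq]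
      have hc : ∀ i j, SpecAt xvar (algebraMap ℂ Rat2 2) (W.wt Rat2 i j) (W.wt Rat2 i j) :=
        fun i j => SpecAt.const _
      have hx := SpecAt.x (u := xvar) (v := algebraMap ℂ Rat2 2)
      have hy := SpecAt.y (u := xvar) (v := algebraMap ℂ Rat2 2)
      exact (((((hc _ _).add ((hc _ _).mul hx)).add ((hc _ _).mul (hx.pow 2))).mul
        (hy.pow 2)).add
        (((((hc _ _).add ((hc _ _).mul hx)).add ((hc _ _).mul (hx.pow 2))).sub hx).mul hy)).add
        (((hc _ _).add ((hc _ _).mul hx)).add ((hc _ _).mul (hx.pow 2)))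
    rw [h] at hK
    exact hK.unique SpecAt.zero
  exact (OnCurve.of_fst hnd hzd transcendental_xvar hv).snd.ne_algebraMap 2 rfl

/-- The recursion preserves the vanishing of the alternating orbit sum: the sums of `F(x)` and of
`G(y)` vanish, and the factor `x y / K` is invariant. -/
lemma OrbitZero.nextM (hnd : W.NonDegenerate) (hzd : W.ZeroDrift) (hfin : W.FiniteGroup)
    {M : Rat2} (h : W.OrbitZero M) (hM : Split M) (F G : RatFunc ℂ) :
    W.OrbitZero (W.nextM M F G) := by
  have hq := nice_genericPt hnd hzd
  have h0 : xvar * yvar / W.kernel xvar yvar ≠ 0 :=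
    div_ne_zero (mul_ne_zero xvar_ne_zero yvar_ne_zero) (kernel_generic_ne_zero hnd hzd)
  have hr1 : ∀ i, _ := fun i => hq.ratio_theta_iterate hnd hzd i
  have hr2 : ∀ i, _ := fun i => (hq.psi hnd hzd).ratio_theta_iterate hnd hzd i
  simp only [ratio_psi hnd hzd hq.fst hq.snd] at hr2
  have hk : ∀ {q : Rat2 × Rat2}, q.1 * q.2 / W.kernel q.1 q.2 = xvar * yvar / W.kernel xvar yvar →
      W.kernel q.1 q.2 ≠ 0 := by
    intro q hq hk
    rw [hk, div_zero] at hq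
    exact h0 hq.symm
  have hs1 := orbit_sum_generic_fst hnd hzd hfin (eval1 F)
  have hs2 := orbit_sum_generic_snd hnd hzd hfin (eval1 G)
  rw [OrbitZero] at h ⊢
  calc _ = (∑ i ∈ Finset.range W.halfOrder,
        ((ev M (W.Theta^[i] genericPt) - ev M (W.Theta^[i] (W.Psi genericPt))) -
        (eval1 F (W.Theta^[i] genericPt).1 - eval1 F (W.Theta^[i] (W.Psi genericPt)).1) -
        (eval1 G (W.Theta^[i] genericPt).2 - eval1 G (W.Theta^[i] (W.Psi genericPt)).2))) *
          (xvar * yvar / W.kernel xvar yvar) := by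
        rw [Finset.sum_mul]
        refine Finset.sum_congr rfl fun i _ => ?_
        rw [(hq.theta_iterate hnd hzd i).ev_nextM hM F G (hk (hr1 i)),
          ((hq.psi hnd hzd).theta_iterate hnd hzd i).ev_nextM hM F G (hk (hr2 i)), hr1, hr2]
        ring
    _ = 0 := by
        rw [Finset.sum_sub_distrib, Finset.sum_sub_distrib, h, hs1, hs2]; ring

/-- If the alternating orbit sum of `M` vanishes, then `decouplingSum M` decouples `M`. -/
lemma decouplingSum_sub (hnd : W.NonDegenerate) (hzd : W.ZeroDrift) (hfin : W.FiniteGroup)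
    {M : Rat2} (h : W.OrbitZero M) (hM : Split M) {L : Type*} [Field L] [Algebra ℂ L] {P : L × L}
    (hP : W.OnCurve P) : W.decouplingSum M P - W.decouplingSum M (W.Phi P) =
      ev M P - ev M (W.Phi P) := by
  have hpos := (theta_period_genericPt hfin).1
  have hphi := phi_phi hnd hzd hP.fst hP.snd
  have hper := hP.theta_period hnd hzd hfin
  have hper' := (hP.phi hnd hzd).theta_period hnd hzd hfin
  have h0 := h.at_onCurve hnd hzd hM hP
  have hN : (W.halfOrder : L) ≠ 0 := by
    have : algebraMap ℂ L (W.halfOrder : ℂ) ≠ 0 := by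
      rw [map_ne_zero]; exact_mod_cast hpos.ne'
    simpa using this
  -- The orbit of `Φ P` is that of `Ψ P`, shifted by one, so that the difference telescopes.
  obtain ⟨n, hn⟩ : ∃ n, W.halfOrder = n + 1 := ⟨W.halfOrder - 1, by omega⟩
  simp only [decouplingSum]
  rw [hn] at hper hper' h0 hN ⊢
  have hphi1 : W.Theta (W.Phi P) = W.Psi P := by rw [Theta, hphi]
  have ht := sum_telescope (fun i => ev M (W.Theta^[i] P)) (fun i => ev M (W.Theta^[i] (W.Psi P))) n
  rw [h0] at ht
  simp only [hper, Function.iterate_zero, id] at ht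
  rw [← hphi1, ← Function.iterate_succ_apply, hper'] at ht
  have e : ∑ i ∈ Finset.Ico 1 (n + 1), (i : L) * (ev M (W.Theta^[i] (W.Phi P)) +
      ev M (W.Theta^[i] (W.Psi (W.Phi P)))) = ∑ i ∈ Finset.Ico 1 (n + 1), (i : L) *
      (ev M (W.Theta^[i - 1] (W.Theta (W.Phi P))) + ev M (W.Theta^[i + 1] P)) := by
    refine Finset.sum_congr rfl fun i hi => ?_
    have hi' := (Finset.mem_Ico.1 hi).1
    rw [← Function.iterate_succ_apply, Nat.succ_eq_add_one, Nat.sub_add_cancel hi',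
      Function.iterate_succ_apply]
    rfl
  rw [e, ← mul_sub, ← Finset.sum_sub_distrib]
  simp only [← mul_sub]
  rw [← hphi1, ht]
  push_cast at hN ⊢
  field_simp
  ring

/-- The decoupling function of the discrete recursion decouples, and the remaining function of `y`
is rational. -/
lemma decouples_decouplingFun (hnd : W.NonDegenerate) (hzd : W.ZeroDrift) (hfin : W.FiniteGroup)
    {M : Rat2} (h : W.OrbitZero M) (hM : Split M) :
    let F := toRat (W.decouplingFun M)
    eval2 M W.Xp tvar - eval1 F W.Xp = eval2 M W.Xm tvar - eval1 F W.Xm ∧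
    IsRationalFun (W.remainder M F) ∧ W.Decouples M F (toRat (W.remainder M F)) := by
  intro F
  have hP := onCurve_Xp hnd hzd
  have h1 := decouplingSum_sub hnd hzd hfin h hM hP
  rw [← eval1_decouplingFun hnd hzd M hP, ← eval1_decouplingFun hnd hzd M (hP.phi hnd hzd),
    phi_Xp hnd hzd] at h1
  have h2 : eval2 M W.Xp tvar - eval1 F W.Xp = eval2 M W.Xm tvar - eval1 F W.Xm := by
    linear_combination -h1
  exact ⟨h2, decouples_of_branches hnd hzd rfl h2⟩

end Walk

/-! ### Division by a quadratic polynomial in `x` -/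

/-- The polynomial `a₂(y) x² + a₁(y) x + a₀(y)`. -/
def quadPoly (a₂ a₁ a₀ : Polynomial ℂ) : MvPolynomial (Fin 2) ℂ :=
  poly2 1 a₂ * MvPolynomial.X 0 ^ 2 + poly2 1 a₁ * MvPolynomial.X 0 + poly2 1 a₀

lemma aeval_quadPoly {L : Type*} [Field L] [Algebra ℂ L] (a₂ a₁ a₀ : Polynomial ℂ) (u v : L) :
    MvPolynomial.aeval ![u, v] (quadPoly a₂ a₁ a₀) = Polynomial.aeval v a₂ * u ^ 2 +
      Polynomial.aeval v a₁ * u + Polynomial.aeval v a₀ := by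
  simp [quadPoly, aeval_poly2_one]

@[simp] lemma poly2_mul (i : Fin 2) (p q : Polynomial ℂ) :
    poly2 i (p * q) = poly2 i p * poly2 i q := map_mul _ _ _
@[simp] lemma poly2_add (i : Fin 2) (p q : Polynomial ℂ) :
    poly2 i (p + q) = poly2 i p + poly2 i q := map_add _ _ _
@[simp] lemma poly2_sub (i : Fin 2) (p q : Polynomial ℂ) :
    poly2 i (p - q) = poly2 i p - poly2 i q := map_sub _ _ _
@[simp] lemma poly2_pow (i : Fin 2) (p : Polynomial ℂ) (k : ℕ) :
    poly2 i (p ^ k) = poly2 i p ^ k := map_pow _ _ _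
@[simp] lemma poly2_zero (i : Fin 2) : poly2 i 0 = 0 := map_zero _
@[simp] lemma poly2_one (i : Fin 2) : poly2 i 1 = 1 := map_one _
@[simp] lemma poly2_X (i : Fin 2) : poly2 i Polynomial.X = MvPolynomial.X i := by simp [poly2]
@[simp] lemma poly2_C (i : Fin 2) (c : ℂ) : poly2 i (Polynomial.C c) = MvPolynomial.C c := by
  simp [poly2, MvPolynomial.algebraMap_eq]

/-- Pseudo-division in `ℂ[y][x]` by a quadratic polynomial. -/
lemma exists_pseudo_division (a₂ a₁ a₀ : Polynomial ℂ) (Q : MvPolynomial (Fin 2) ℂ) :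
    ∃ (e : ℕ) (R : MvPolynomial (Fin 2) ℂ) (α β : Polynomial ℂ), poly2 1 (a₂ ^ e) * Q =
      quadPoly a₂ a₁ a₀ * R + poly2 1 α * MvPolynomial.X 0 + poly2 1 β := by
  induction Q using MvPolynomial.induction_on with
  | C c => exact ⟨0, 0, 0, Polynomial.C c, by simp⟩
  | add p q hp hq =>
    obtain ⟨e, R, α, β, h⟩ := hp
    obtain ⟨e', R', α', β', h'⟩ := hq
    refine ⟨e + e', poly2 1 (a₂ ^ e') * R + poly2 1 (a₂ ^ e) * R', a₂ ^ e' * α + a₂ ^ e * α',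
      a₂ ^ e' * β + a₂ ^ e * β', ?_⟩
    simp only [poly2_add, poly2_mul, poly2_pow, pow_add] at h h' ⊢
    linear_combination (poly2 1 a₂ ^ e') * h + (poly2 1 a₂ ^ e) * h'
  | mul_X p i hp =>
    obtain ⟨e, R, α, β, h⟩ := hp
    fin_cases i
    · refine ⟨e + 1, poly2 1 a₂ * R * MvPolynomial.X 0 + poly2 1 α, a₂ * β - α * a₁, - (α * a₀), ?_⟩
      simp only [quadPoly, poly2_sub, poly2_mul, poly2_pow, pow_succ, ← zero_sub (α * a₀),
        poly2_zero, Fin.zero_eta, Fin.isValue] at h ⊢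
      linear_combination (poly2 1 a₂ * MvPolynomial.X 0) * h
    · refine ⟨e, R * MvPolynomial.X 1, α * Polynomial.X, β * Polynomial.X, ?_⟩
      simp only [poly2_mul, poly2_X, Fin.mk_one, Fin.isValue]
      linear_combination (MvPolynomial.X 1) * h

/-- A polynomial that vanishes at both points of the curve `a₂(y) x² + a₁(y) x + a₀(y) = 0` with
a generic ordinate is divisible by the equation of the curve, up to a factor that depends only
on `y`. -/
lemma exists_mul_eq_quadPoly_mul {L : Type*} [Field L] [Algebra ℂ L] {a₂ a₁ a₀ : Polynomial ℂ}
    {Q : MvPolynomial (Fin 2) ℂ} {v r s : L} (hv : Transcendental ℂ v) (hrs : r ≠ s)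
    (h1 : MvPolynomial.aeval ![r, v] (quadPoly a₂ a₁ a₀) = 0)
    (h2 : MvPolynomial.aeval ![s, v] (quadPoly a₂ a₁ a₀) = 0)
    (hQ1 : MvPolynomial.aeval ![r, v] Q = 0) (hQ2 : MvPolynomial.aeval ![s, v] Q = 0) :
    ∃ (e : ℕ) (R : MvPolynomial (Fin 2) ℂ), poly2 1 (a₂ ^ e) * Q = quadPoly a₂ a₁ a₀ * R := by
  obtain ⟨e, R, α, β, h⟩ := exists_pseudo_division a₂ a₁ a₀ Q
  have e1 := congrArg (MvPolynomial.aeval ![r, v]) h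
  have e2 := congrArg (MvPolynomial.aeval ![s, v]) h
  simp only [map_mul, map_add, hQ1, hQ2, h1, h2, aeval_poly2_one, MvPolynomial.aeval_X,
    Matrix.cons_val_zero, mul_zero, zero_mul, zero_add] at e1 e2
  -- The remainder is linear in `x` and has the two zeros `r` and `s`.
  have hα : Polynomial.aeval v α = 0 := by
    have : Polynomial.aeval v α * (r - s) = 0 := by linear_combination e2 - e1
    exact (mul_eq_zero.1 this).resolve_right (sub_ne_zero.2 hrs)
  have hβ : Polynomial.aeval v β = 0 := by rw [hα] at e1; simpa using e1.symm
  have hα0 : α = 0 := by_contra fun h0 => hv.aeval_ne_zero h0 hα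
  have hβ0 : β = 0 := by_contra fun h0 => hv.aeval_ne_zero h0 hβ
  exact ⟨e, R, by rw [h, hα0, hβ0]; simp⟩

/-! ### Leading terms at `(1, 1)` -/

/-- The expansion of `Q(1 - μ x, 1 - μ y)` in powers of `μ`, with coefficients in `ℂ[x, y]`. -/
def expand : MvPolynomial (Fin 2) ℂ →ₐ[ℂ] Polynomial (MvPolynomial (Fin 2) ℂ) :=
  MvPolynomial.aeval ![1 - Polynomial.X * Polynomial.C (MvPolynomial.X 0),
    1 - Polynomial.X * Polynomial.C (MvPolynomial.X 1)]

@[simp] lemma expand_C (c : ℂ) : expand (MvPolynomial.C c) = Polynomial.C (MvPolynomial.C c) := by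
  rw [expand, MvPolynomial.aeval_C]; rfl

@[simp] lemma expand_X_zero : expand (MvPolynomial.X 0) =
    1 - Polynomial.X * Polynomial.C (MvPolynomial.X 0) := by simp [expand]

@[simp] lemma expand_X_one : expand (MvPolynomial.X 1) =
    1 - Polynomial.X * Polynomial.C (MvPolynomial.X 1) := by simp [expand]

lemma coeff_zero_expand (Q : MvPolynomial (Fin 2) ℂ) :
    (expand Q).coeff 0 = MvPolynomial.C (MvPolynomial.aeval ![(1 : ℂ), 1] Q) := by
  induction Q using MvPolynomial.induction_on with
  | C c => simp
  | add p q hp hq => simp [hp, hq]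
  | mul_X p i hp => fin_cases i <;> simp [Polynomial.mul_coeff_zero, hp]

/-- The value of a polynomial in `μ`, `x`, `y`. -/
def eval3 (μ x y : ℂ) : Polynomial (MvPolynomial (Fin 2) ℂ) →+* ℂ :=
  Polynomial.eval₂RingHom (MvPolynomial.aeval ![x, y] : MvPolynomial (Fin 2) ℂ →ₐ[ℂ] ℂ) μ

lemma eval3_expand (μ x y : ℂ) (Q : MvPolynomial (Fin 2) ℂ) :
    eval3 μ x y (expand Q) = MvPolynomial.aeval ![1 - μ * x, 1 - μ * y] Q := by
  induction Q using MvPolynomial.induction_on with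
  | C c => simp [eval3]
  | add p q hp hq => simp [hp, hq]
  | mul_X p i hp =>
    rw [map_mul, map_mul, hp, map_mul]
    congr 1
    fin_cases i
    · simp [eval3, mul_comm x]
    · simp [eval3, mul_comm y]

lemma eval3_zero (x y : ℂ) (R : Polynomial (MvPolynomial (Fin 2) ℂ)) :
    eval3 0 x y R = MvPolynomial.aeval ![x, y] (R.coeff 0) := by
  simp [eval3, Polynomial.eval₂_at_zero]

lemma tendsto_eval3 (R : Polynomial (MvPolynomial (Fin 2) ℂ)) {ι : Type*} {l : Filter ι}
    {μ ξ η : ι → ℂ} {x y : ℂ} (hμ : Tendsto μ l (𝓝 0)) (hξ : Tendsto ξ l (𝓝 x))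
    (hη : Tendsto η l (𝓝 y)) :
    Tendsto (fun i => eval3 (μ i) (ξ i) (η i) R) l
      (𝓝 (MvPolynomial.aeval ![x, y] (R.coeff 0))) := by
  rw [← eval3_zero]
  induction R using Polynomial.induction_on' with
  | add p q hp hq => simp only [map_add]; exact hp.add hq
  | monomial n a =>
    have h : ∀ μ ξ η : ℂ, eval3 μ ξ η (Polynomial.monomial n a) =
        MvPolynomial.eval ![ξ, η] a * μ ^ n := by
      intro μ ξ η
      simp [eval3, Polynomial.eval₂_monomial]
    simp only [h]
    have hv : Tendsto (fun i => ![ξ i, η i]) l (𝓝 ![x, y]) := by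
      rw [tendsto_pi_nhds]
      intro j
      fin_cases j
      · exact hξ
      · exact hη
    exact (((MvPolynomial.continuous_eval a).tendsto _).comp hv).mul (hμ.pow n)

/-- `M` has a denominator of the form `A(x) B(y)`, and `μ^d M(1 - μ x, 1 - μ y)` tends to `Λ(x, y)`
as `μ → 0`. The limit is expressed algebraically: the zeros of `A` and `B` at `1` are split off,
and the numerator is expanded in powers of `μ`. -/
def HasLead (M : Rat2) (d : ℕ) (Λ : Rat2) : Prop :=
  ∃ (Q : MvPolynomial (Fin 2) ℂ) (A B : Polynomial ℂ) (a b e : ℕ)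
    (R : Polynomial (MvPolynomial (Fin 2) ℂ)),
    A.eval 1 ≠ 0 ∧ B.eval 1 ≠ 0 ∧
    M * (((1 - xvar) ^ a * Polynomial.aeval xvar A) * ((1 - yvar) ^ b * Polynomial.aeval yvar B)) =
      algebraMap _ Rat2 Q ∧
    expand Q = Polynomial.X ^ e * R ∧ e + d = a + b ∧
    Λ * ((xvar ^ a * algebraMap ℂ Rat2 (A.eval 1)) * (yvar ^ b * algebraMap ℂ Rat2 (B.eval 1))) =
      algebraMap _ Rat2 (R.coeff 0)

namespace HasLead

variable {M M' Λ Λ' : Rat2} {d : ℕ}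

lemma split (h : HasLead M d Λ) : Split M := by
  obtain ⟨Q, A, B, a, b, e, R, hA, hB, hM, -⟩ := h
  have h1 : (1 - Polynomial.X : Polynomial ℂ) ≠ 0 := by
    intro h0; simpa using congrArg (Polynomial.eval 0) h0
  refine ⟨Q, (1 - Polynomial.X) ^ a * A, (1 - Polynomial.X) ^ b * B,
    mul_ne_zero (pow_ne_zero _ h1) ?_, mul_ne_zero (pow_ne_zero _ h1) ?_, ?_⟩
  · rintro rfl; simp at hA
  · rintro rfl; simp at hB
  · simpa using hM

lemma algebraMap_C' (c : ℂ) : algebraMap (MvPolynomial (Fin 2) ℂ) Rat2 (MvPolynomial.C c) =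
    algebraMap ℂ Rat2 c := by
  rw [← MvPolynomial.algebraMap_eq, ← IsScalarTower.algebraMap_apply]

lemma zero (d : ℕ) : HasLead 0 d 0 :=
  ⟨0, 1, 1, d, 0, 0, 0, by simp, by simp, by simp, by simp, by simp, by simp⟩

lemma neg (h : HasLead M d Λ) : HasLead (-M) d (-Λ) := by
  obtain ⟨Q, A, B, a, b, e, R, hA, hB, hM, hQ, hd, hΛ⟩ := h
  exact ⟨-Q, A, B, a, b, e, -R, hA, hB, by rw [neg_mul, hM, map_neg],
    by rw [map_neg, hQ]; exact (mul_neg (Polynomial.X ^ e) R).symm, hd,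
    by rw [neg_mul, hΛ, Polynomial.coeff_neg, map_neg]⟩

lemma expand_one_sub_x (a : ℕ) : expand ((1 - MvPolynomial.X 0) ^ a) =
    Polynomial.X ^ a * Polynomial.C (MvPolynomial.X 0 ^ a) := by
  rw [map_pow, map_sub, map_one, expand_X_zero, sub_sub_cancel, mul_pow, Polynomial.C_pow]

lemma expand_one_sub_y (a : ℕ) : expand ((1 - MvPolynomial.X 1) ^ a) =
    Polynomial.X ^ a * Polynomial.C (MvPolynomial.X 1 ^ a) := by
  rw [map_pow, map_sub, map_one, expand_X_one, sub_sub_cancel, mul_pow, Polynomial.C_pow]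

lemma coeff_expand_poly2 (i : Fin 2) (p : Polynomial ℂ) :
    (expand (poly2 i p)).coeff 0 = MvPolynomial.C (p.eval 1) := by
  rw [coeff_zero_expand]
  fin_cases i
  · simp [aeval_poly2_zero]
  · simp [aeval_poly2_one]

lemma add (h : HasLead M d Λ) (h' : HasLead M' d Λ') : HasLead (M + M') d (Λ + Λ') := by
  obtain ⟨Q, A, B, a, b, e, R, hA, hB, hM, hQ, hd, hΛ⟩ := h
  obtain ⟨Q', A', B', a', b', e', R', hA', hB', hM', hQ', hd', hΛ'⟩ := h'
  -- The factor by which the first fraction is expanded, and the expansion of that factor.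
  let T := (1 - MvPolynomial.X 0) ^ a' * poly2 0 A' * ((1 - MvPolynomial.X 1) ^ b' * poly2 1 B')
  let T' := (1 - MvPolynomial.X 0) ^ a * poly2 0 A * ((1 - MvPolynomial.X 1) ^ b * poly2 1 B)
  let S := Polynomial.C (MvPolynomial.X 0 ^ a') * expand (poly2 0 A') *
    (Polynomial.C (MvPolynomial.X 1 ^ b') * expand (poly2 1 B'))
  let S' := Polynomial.C (MvPolynomial.X 0 ^ a) * expand (poly2 0 A) *
    (Polynomial.C (MvPolynomial.X 1 ^ b) * expand (poly2 1 B))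
  have hT : expand T = Polynomial.X ^ (a' + b') * S := by
    simp only [T, S, map_mul, expand_one_sub_x, expand_one_sub_y, pow_add]; ring
  have hT' : expand T' = Polynomial.X ^ (a + b) * S' := by
    simp only [T', S', map_mul, expand_one_sub_x, expand_one_sub_y, pow_add]; ring
  refine ⟨T * Q + T' * Q', A * A', B * B', a + a', b + b', e + (a' + b'), S * R + S' * R',
    by simp [hA, hA'], by simp [hB, hB'], ?_, ?_, by omega, ?_⟩
  · simp only [T, T', map_add, map_mul, map_pow, map_sub, map_one, algebraMap_poly2, ← hM, ← hM',
      pow_add, algebraMap_X_zero, algebraMap_X_one]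
    ring
  · rw [map_add, map_mul _ T, map_mul _ T', hT, hT', hQ, hQ']
    have e2 : (Polynomial.X : Polynomial (MvPolynomial (Fin 2) ℂ)) ^ (a + b) * Polynomial.X ^ e' =
        Polynomial.X ^ e * Polynomial.X ^ (a' + b') := by
      rw [← pow_add, ← pow_add]; congr 1; omega
    rw [pow_add Polynomial.X e]
    linear_combination (S' * R') * e2
  · simp only [S, S', Polynomial.coeff_add, Polynomial.mul_coeff_zero, Polynomial.coeff_C_zero,
      coeff_expand_poly2]
    simp only [map_add, map_mul, map_pow, algebraMap_C', ← hΛ, ← hΛ', pow_add,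
      Polynomial.eval_mul, algebraMap_X_zero, algebraMap_X_one]
    ring

lemma sub (h : HasLead M d Λ) (h' : HasLead M' d Λ') : HasLead (M - M') d (Λ - Λ') := by
  simpa [sub_eq_add_neg] using h.add h'.neg

lemma mul_xy (h : HasLead M d Λ) : HasLead (xvar * yvar * M) d Λ := by
  obtain ⟨Q, A, B, a, b, e, R, hA, hB, hM, hQ, hd, hΛ⟩ := h
  refine ⟨MvPolynomial.X 0 * MvPolynomial.X 1 * Q, A, B, a, b, e,
    expand (MvPolynomial.X 0 * MvPolynomial.X 1) * R, hA, hB, ?_, ?_, hd, ?_⟩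
  · rw [mul_assoc, hM]; simp [xvar, yvar]
  · rw [map_mul, hQ]; ring
  · rw [Polynomial.mul_coeff_zero, coeff_zero_expand, hΛ]; simp

/-- The factor `x y` does not change the lowest order term, as it takes the value `1` at `(1, 1)`. -/
lemma div_xy (h : HasLead (xvar * yvar * M) d Λ) : HasLead M d Λ := by
  obtain ⟨Q, A, B, a, b, e, R, hA, hB, hM, hQ, hd, hΛ⟩ := h
  refine ⟨Q, A * Polynomial.X, B * Polynomial.X, a, b, e, R, by simpa using hA, by simpa using hB,
    ?_, hQ, hd, ?_⟩
  · rw [← hM]; simp; ring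
  · rw [← hΛ]; simp

/-- A function of `x` alone that behaves like a constant multiple of `(1 - x)^{-d}`. -/
lemma of_fst {F : RatFunc ℂ} {p A : Polynomial ℂ} (hA : A.eval 1 ≠ 0)
    (hF : F = algebraMap _ (RatFunc ℂ) p / algebraMap _ (RatFunc ℂ) ((1 - Polynomial.X) ^ d * A)) :
    HasLead (eval1 F xvar) d (algebraMap ℂ Rat2 (p.eval 1 / A.eval 1) / xvar ^ d) := by
  have h1 : (1 - Polynomial.X : Polynomial ℂ) ≠ 0 := by
    intro h0; simpa using congrArg (Polynomial.eval 0) h0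
  have hA0 : A ≠ 0 := by rintro rfl; simp at hA
  have h0 := transcendental_xvar.aeval_ne_zero (mul_ne_zero (pow_ne_zero d h1) hA0)
  have h2 : algebraMap ℂ Rat2 (A.eval 1) ≠ 0 := by simpa using hA
  refine ⟨poly2 0 p, A, 1, d, 0, 0, expand (poly2 0 p), hA, by simp, ?_, by simp, by simp, ?_⟩
  · rw [eval1_eq_div hF h0, algebraMap_poly2, algebraMap_X_zero]
    have : (1 - xvar) ^ d * Polynomial.aeval xvar A =
      Polynomial.aeval xvar ((1 - Polynomial.X) ^ d * A) := by simp
    rw [this]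
    simp only [pow_zero, map_one, mul_one]
    rw [div_mul_cancel₀ _ h0]
  · have := pow_ne_zero d xvar_ne_zero
    rw [coeff_expand_poly2, algebraMap_C', map_div₀]
    simp
    field_simp

/-- A function of `y` alone that behaves like a constant multiple of `(1 - y)^{-d}`. -/
lemma of_snd {F : RatFunc ℂ} {p A : Polynomial ℂ} (hA : A.eval 1 ≠ 0)
    (hF : F = algebraMap _ (RatFunc ℂ) p / algebraMap _ (RatFunc ℂ) ((1 - Polynomial.X) ^ d * A)) :
    HasLead (eval1 F yvar) d (algebraMap ℂ Rat2 (p.eval 1 / A.eval 1) / yvar ^ d) := by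
  have h1 : (1 - Polynomial.X : Polynomial ℂ) ≠ 0 := by
    intro h0; simpa using congrArg (Polynomial.eval 0) h0
  have hA0 : A ≠ 0 := by rintro rfl; simp at hA
  have h0 := transcendental_yvar.aeval_ne_zero (mul_ne_zero (pow_ne_zero d h1) hA0)
  have h2 : algebraMap ℂ Rat2 (A.eval 1) ≠ 0 := by simpa using hA
  refine ⟨poly2 1 p, 1, A, 0, d, 0, expand (poly2 1 p), by simp, hA, ?_, by simp, by simp, ?_⟩
  · rw [eval1_eq_div hF h0, algebraMap_poly2, algebraMap_X_one]
    have : (1 - yvar) ^ d * Polynomial.aeval yvar A =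
      Polynomial.aeval yvar ((1 - Polynomial.X) ^ d * A) := by simp
    rw [this]
    simp only [pow_zero, map_one, one_mul]
    rw [div_mul_cancel₀ _ h0]
  · have := pow_ne_zero d yvar_ne_zero
    rw [coeff_expand_poly2, algebraMap_C', map_div₀]
    simp
    field_simp

/-- The value of the lowest order term, whose denominator is a monomial. -/
lemma value_of_mul_eq {Λ : Rat2} {A B : Polynomial ℂ} {a b : ℕ} {q : MvPolynomial (Fin 2) ℂ}
    (hA : A.eval 1 ≠ 0) (hB : B.eval 1 ≠ 0)
    (hΛ : Λ * ((xvar ^ a * algebraMap ℂ Rat2 (A.eval 1)) *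
      (yvar ^ b * algebraMap ℂ Rat2 (B.eval 1))) = algebraMap _ Rat2 q) {x y : ℂ}
    (hx : x ≠ 0) (hy : y ≠ 0) : eval2 Λ x y = MvPolynomial.aeval ![x, y] q /
      ((x ^ a * A.eval 1) * (y ^ b * B.eval 1)) := by
  have h1 := specAt_of_mul_eq (u := x) (v := y) (M := Λ) (Q := q)
    (A := Polynomial.C (A.eval 1) * Polynomial.X ^ a)
    (B := Polynomial.C (B.eval 1) * Polynomial.X ^ b)
    (by rw [← hΛ]; simp only [map_mul, map_pow, Polynomial.aeval_X, Polynomial.aeval_C]; ring)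
    (by simp [hx, hA]) (by simp [hy, hB])
  rw [h1.eval2]
  simp only [map_mul, map_pow, Polynomial.aeval_X, Polynomial.aeval_C, Algebra.algebraMap_self,
    RingHom.id_apply, mul_comm]

/-- The limit holds along every path with a limiting direction `(x, y)` off the axes. -/
lemma tendsto (h : HasLead M d Λ) {ι : Type*} {l : Filter ι} {μ ξ η : ι → ℂ} {x y : ℂ}
    (hx : x ≠ 0) (hy : y ≠ 0) (hμ : Tendsto μ l (𝓝[≠] 0)) (hξ : Tendsto ξ l (𝓝 x))
    (hη : Tendsto η l (𝓝 y)) :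
    Tendsto (fun i => μ i ^ d * eval2 M (1 - μ i * ξ i) (1 - μ i * η i)) l
      (𝓝 (eval2 Λ x y)) := by
  obtain ⟨Q, A, B, a, b, e, R, hA, hB, hM, hQ, hd, hΛ⟩ := h
  have hμ0 : Tendsto μ l (𝓝 0) := hμ.mono_right nhdsWithin_le_nhds
  have hμne : ∀ᶠ i in l, μ i ≠ 0 := hμ self_mem_nhdsWithin
  have hA' : Tendsto (fun i => A.eval (1 - μ i * ξ i)) l (𝓝 (A.eval 1)) := by
    have : Tendsto (fun i => 1 - μ i * ξ i) l (𝓝 (1 - 0 * x)) := (hμ0.mul hξ).const_sub 1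
    rw [zero_mul, sub_zero] at this
    exact (A.continuous.tendsto 1).comp this
  have hB' : Tendsto (fun i => B.eval (1 - μ i * η i)) l (𝓝 (B.eval 1)) := by
    have : Tendsto (fun i => 1 - μ i * η i) l (𝓝 (1 - 0 * y)) := (hμ0.mul hη).const_sub 1
    rw [zero_mul, sub_zero] at this
    exact (B.continuous.tendsto 1).comp this
  have hR := tendsto_eval3 R hμ0 hξ hη
  rw [value_of_mul_eq hA hB hΛ hx hy]
  have hden := ((hξ.pow a).mul hA').mul ((hη.pow b).mul hB')
  have hden0 : (x ^ a * A.eval 1) * (y ^ b * B.eval 1) ≠ 0 := by simp [hx, hy, hA, hB]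
  refine (hR.div hden hden0).congr' ?_
  filter_upwards [hμne, hA'.eventually_ne hA, hB'.eventually_ne hB, hξ.eventually_ne hx,
    hη.eventually_ne hy] with i h1 h2 h3 h4 h5
  have hs := specAt_of_mul_eq (u := 1 - μ i * ξ i) (v := 1 - μ i * η i) (M := M) (Q := Q)
    (A := (1 - Polynomial.X) ^ a * A) (B := (1 - Polynomial.X) ^ b * B) (by simpa using hM)
    (by simp [h1, h2, h4]) (by simp [h1, h3, h5])
  have hpow : μ i ^ d * μ i ^ e = μ i ^ a * μ i ^ b := by
    rw [← pow_add, ← pow_add, add_comm d e, hd]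
  rw [hs.eval2, ← eval3_expand, hQ]
  simp only [map_mul, map_pow, map_sub, map_one, Polynomial.aeval_X, sub_sub_cancel,
    Polynomial.coe_aeval_eq_eval, mul_pow]
  have hX : eval3 (μ i) (ξ i) (η i) Polynomial.X = μ i := by simp [eval3]
  rw [hX, Pi.div_apply]
  field_simp
  linear_combination (-eval3 (μ i) (ξ i) (η i) R) * hpow

end HasLead

namespace Walk

variable {W : Walk}

/-! ### Division by the kernel -/

/-- The polynomial `ã`. -/
def catPoly (W : Walk) : Polynomial ℂ := Polynomial.C (W.p (-1) 1 : ℂ) +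
  Polynomial.C (W.p (-1) 0 : ℂ) * Polynomial.X + Polynomial.C (W.p (-1) (-1) : ℂ) * Polynomial.X ^ 2

/-- The polynomial `b̃`. -/
def cbtPoly (W : Walk) : Polynomial ℂ := Polynomial.C (W.p 0 1 : ℂ) +
  Polynomial.C (W.p 0 0 : ℂ) * Polynomial.X + Polynomial.C (W.p 0 (-1) : ℂ) * Polynomial.X ^ 2
    - Polynomial.X

/-- The polynomial `c̃`. -/
def cctPoly (W : Walk) : Polynomial ℂ := Polynomial.C (W.p 1 1 : ℂ) +
  Polynomial.C (W.p 1 0 : ℂ) * Polynomial.X + Polynomial.C (W.p 1 (-1) : ℂ) * Polynomial.X ^ 2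

/-- The kernel as a polynomial. -/
def kernelPoly (W : Walk) : MvPolynomial (Fin 2) ℂ :=
  quadPoly W.catPoly W.cbtPoly W.cctPoly

lemma aeval_kernelPoly {L : Type*} [Field L] [Algebra ℂ L] (u v : L) :
    MvPolynomial.aeval ![u, v] W.kernelPoly = W.kernel u v := by
  rw [kernelPoly, aeval_quadPoly, kernel_eq_x, cat_eq, cbt_eq, cct_eq]
  simp [catPoly, cbtPoly, cctPoly, wt]

lemma algebraMap_kernelPoly : algebraMap _ Rat2 W.kernelPoly = W.kernel xvar yvar := by
  rw [algebraMap_eq_aeval, aeval_kernelPoly]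

lemma catPoly_eval_one (hzd : W.ZeroDrift) : W.catPoly.eval 1 = (W.sigma11 : ℂ) / 2 := by
  have h1 := cat_one_add (W := W) (L := ℂ) hzd 0
  have h2 : W.catPoly.eval 1 = W.cat (1 : ℂ) := by simp [catPoly, cat_eq, wt]
  rw [h2]
  simpa using h1

/-- The polynomial `γ`. -/
def gamPoly (W : Walk) : MvPolynomial (Fin 2) ℂ :=
  MvPolynomial.C ((W.sigma11 : ℂ) / 2) * MvPolynomial.X 0 ^ 2 +
    MvPolynomial.C (W.sigma12 : ℂ) * MvPolynomial.X 0 * MvPolynomial.X 1 +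
    MvPolynomial.C ((W.sigma22 : ℂ) / 2) * MvPolynomial.X 1 ^ 2

lemma algebraMap_gamPoly : algebraMap _ Rat2 W.gamPoly = W.gam := by
  have h2 := two_ne_zero_of_algebra (L := Rat2)
  simp only [gamPoly, gam, map_add, map_mul, map_pow, HasLead.algebraMap_C', algebraMap_X_zero,
    algebraMap_X_one, map_div₀, map_ofNat, map_one]
  field_simp

lemma gam_ne_zero (hnd : W.NonDegenerate) : W.gam ≠ 0 := by
  rw [← algebraMap_gamPoly, Ne, map_eq_zero_iff _
    (IsFractionRing.injective (MvPolynomial (Fin 2) ℂ) Rat2)]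
  intro h0
  have := congrArg (MvPolynomial.aeval ![(1 : ℂ), 0]) h0
  simp [gamPoly, sigma11_ne hnd] at this

/-- The lowest order term of the kernel at `(1, 1)` is `γ`. -/
lemma expand_kernelPoly (hzd : W.ZeroDrift) :
    ∃ K₂ : Polynomial (MvPolynomial (Fin 2) ℂ), expand W.kernelPoly = Polynomial.X ^ 2 * K₂ ∧
      K₂.coeff 0 = W.gamPoly := by
  let x : Polynomial (MvPolynomial (Fin 2) ℂ) := Polynomial.C (MvPolynomial.X 0)
  let y : Polynomial (MvPolynomial (Fin 2) ℂ) := Polynomial.C (MvPolynomial.X 1)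
  let c : ℂ → Polynomial (MvPolynomial (Fin 2) ℂ) := fun z => Polynomial.C (MvPolynomial.C z)
  refine ⟨c (W.sigma11 / 2) * x ^ 2 + c W.sigma12 * x * y + c (W.sigma22 / 2) * y ^ 2 -
    Polynomial.X * (c (W.p (-1) 0 + 2 * W.p (-1) (-1)) * x ^ 2 * y +
      c (W.p 0 (-1) + 2 * W.p (-1) (-1)) * x * y ^ 2) +
    Polynomial.X ^ 2 * (c (W.p (-1) (-1)) * x ^ 2 * y ^ 2), ?_, ?_⟩
  · have e1 : W.catPoly = Polynomial.C ((W.sigma11 : ℂ) / 2) +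
        Polynomial.C ((W.p (-1) 0 : ℂ) + 2 * W.p (-1) (-1)) * (Polynomial.X - 1) +
        Polynomial.C (W.p (-1) (-1) : ℂ) * (Polynomial.X - 1) ^ 2 := by
      refine Polynomial.funext fun r => ?_
      have := cat_one_add (W := W) (L := ℂ) hzd (r - 1)
      rw [add_sub_cancel] at this
      rw [show W.catPoly.eval r = W.cat r by simp [catPoly, cat_eq, wt], this]
      simp [wt]
    have e2 : 2 * W.catPoly + W.cbtPoly = Polynomial.C (W.sigma12 : ℂ) * (Polynomial.X - 1) +
        Polynomial.C ((W.p 0 (-1) : ℂ) + 2 * W.p (-1) (-1)) * (Polynomial.X - 1) ^ 2 := by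
      refine Polynomial.funext fun r => ?_
      have := cbt_one_add (W := W) (L := ℂ) hzd (r - 1)
      rw [add_sub_cancel] at this
      rw [show (2 * W.catPoly + W.cbtPoly).eval r = 2 * W.cat r + W.cbt r by
        simp [catPoly, cat_eq, cbtPoly, cbt_eq, wt], this]
      simp [wt]
    have e3 : W.catPoly + W.cbtPoly + W.cctPoly =
        Polynomial.C ((W.sigma22 : ℂ) / 2) * (Polynomial.X - 1) ^ 2 := by
      refine Polynomial.funext fun r => ?_
      have := cct_one_add (W := W) (L := ℂ) hzd (r - 1)
      rw [add_sub_cancel] at this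
      rw [show (W.catPoly + W.cbtPoly + W.cctPoly).eval r = W.cat r + W.cbt r + W.cct r by
        simp [catPoly, cat_eq, cbtPoly, cbt_eq, cctPoly, cct_eq, wt], this]
      simp
    have hk : W.kernelPoly = poly2 1 W.catPoly * (MvPolynomial.X 0 - 1) ^ 2 +
        poly2 1 (2 * W.catPoly + W.cbtPoly) * (MvPolynomial.X 0 - 1) +
        poly2 1 (W.catPoly + W.cbtPoly + W.cctPoly) := by
      have h2 : poly2 1 2 = 2 := by rw [poly2]; exact map_ofNat _ 2
      rw [kernelPoly, quadPoly]
      simp only [poly2_add, poly2_mul, h2]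
      ring
    rw [hk, e3, e2, e1]
    simp only [poly2_add, poly2_mul, poly2_sub, poly2_pow, poly2_X, poly2_C, poly2_one, map_add,
      map_mul, map_sub, map_pow, map_one, expand_C, expand_X_zero, expand_X_one]
    simp only [c, x, y, map_add, map_mul]
    ring
  · simp only [gamPoly, Polynomial.coeff_add, Polynomial.coeff_sub, Polynomial.mul_coeff_zero, c,
      x, y, Polynomial.coeff_C_zero, Polynomial.coeff_X_zero, pow_succ,
      pow_zero, one_mul, zero_mul, sub_zero, add_zero]

/-- Division of a rational function by the kernel. If the numerator vanishes at the generic points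
of the curve, then the kernel cancels, up to a factor that depends only on `y`, so that the
denominator is still of the form `A(x) B(y)`; the lowest order terms are divided by `γ`. -/
lemma HasLead.div_kernel (hnd : W.NonDegenerate) (hzd : W.ZeroDrift) {U Λ : Rat2} {d : ℕ}
    (h : HasLead U d Λ) (h1 : eval2 U W.Xp tvar = 0) (h2 : eval2 U W.Xm tvar = 0) :
    HasLead (U / W.kernel xvar yvar) (d + 2) (Λ / W.gam) := by
  obtain ⟨Q, A, B, a, b, e, R, hA, hB, hM, hQ, hd, hΛ⟩ := h
  have hp := onCurve_Xp hnd hzd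
  have hm := onCurve_Xm hnd hzd
  have hone : (1 - Polynomial.X : Polynomial ℂ) ≠ 0 := by
    intro h0; simpa using congrArg (Polynomial.eval 0) h0
  have hA0 : (1 - Polynomial.X : Polynomial ℂ) ^ a * A ≠ 0 :=
    mul_ne_zero (pow_ne_zero _ hone) (by rintro rfl; simp at hA)
  have hB0 : (1 - Polynomial.X : Polynomial ℂ) ^ b * B ≠ 0 :=
    mul_ne_zero (pow_ne_zero _ hone) (by rintro rfl; simp at hB)
  have hM' : U * (Polynomial.aeval xvar ((1 - Polynomial.X) ^ a * A) *
      Polynomial.aeval yvar ((1 - Polynomial.X) ^ b * B)) = algebraMap _ Rat2 Q := by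
    simpa using hM
  have hQ0 : ∀ {X : AlgFun}, W.OnCurve (X, tvar) → eval2 U X tvar = 0 →
      MvPolynomial.aeval ![X, tvar] Q = 0 := by
    intro X hX hU
    have h1 := hX.fst.aeval_ne_zero hA0
    have h2 := hX.snd.aeval_ne_zero hB0
    rw [(specAt_of_mul_eq hM' h1 h2).eval2, div_eq_zero_iff] at hU
    exact hU.resolve_right (mul_ne_zero h1 h2)
  have hK : ∀ {X : AlgFun}, W.OnCurve (X, tvar) →
      MvPolynomial.aeval ![X, tvar] W.kernelPoly = 0 := fun hX => by
    rw [aeval_kernelPoly]; exact hX.kernel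
  obtain ⟨n, S, hS⟩ := exists_mul_eq_quadPoly_mul transcendental_tvar (Xp_ne_Xm hnd hzd) (hK hp)
    (hK hm) (hQ0 hp h1) (hQ0 hm h2)
  change _ = W.kernelPoly * S at hS
  obtain ⟨K₂, hK₂, hK₂0⟩ := expand_kernelPoly hzd
  have hgam := gam_ne_zero hnd
  have hker := kernel_generic_ne_zero hnd hzd
  have hK₂ne : ¬ (Polynomial.X ∣ K₂) := by
    rw [Polynomial.X_dvd_iff, hK₂0]
    intro h0
    exact hgam (by rw [← algebraMap_gamPoly, h0, map_zero])
  -- The numerator is multiplied by `(1 - x)²` to make room for the two orders that are lost.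
  have hX : expand ((1 - MvPolynomial.X 0) ^ 2) =
      Polynomial.X ^ 2 * Polynomial.C (MvPolynomial.X 0 ^ 2) := HasLead.expand_one_sub_x 2
  have hE : K₂ * expand ((1 - MvPolynomial.X 0) ^ 2 * S) = Polynomial.X ^ e *
      (expand (poly2 1 (W.catPoly ^ n)) * Polynomial.C (MvPolynomial.X 0 ^ 2) * R) := by
    have := congrArg expand hS
    rw [map_mul, map_mul, hQ, hK₂] at this
    rw [map_mul, hX]
    linear_combination (-Polynomial.C (MvPolynomial.X 0 ^ 2)) * this
  -- The lowest order term `γ` of the kernel is not divisible by `μ`, so `μ^e` divides the quotient.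
  obtain ⟨T, hT⟩ : Polynomial.X ^ e ∣ expand ((1 - MvPolynomial.X 0) ^ 2 * S) :=
    Polynomial.prime_X.pow_dvd_of_dvd_mul_left _ hK₂ne ⟨_, hE⟩
  have hT' : K₂ * T =
      expand (poly2 1 (W.catPoly ^ n)) * Polynomial.C (MvPolynomial.X 0 ^ 2) * R := by
    rw [hT] at hE
    have hXne : (Polynomial.X : Polynomial (MvPolynomial (Fin 2) ℂ))^ e ≠ 0 :=
      pow_ne_zero _ Polynomial.X_ne_zero
    apply mul_left_cancel₀ hXne
    linear_combination hE
  have hcat : (W.catPoly ^ n).eval 1 ≠ 0 := by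
    rw [Polynomial.eval_pow, catPoly_eval_one hzd]
    exact pow_ne_zero _ (div_ne_zero (sigma11_ne hnd) two_ne_zero)
  refine ⟨(1 - MvPolynomial.X 0) ^ 2 * S, A, W.catPoly ^ n * B, a + 2, b, e, T, hA, ?_, ?_, hT,
    by omega, ?_⟩
  · rw [Polynomial.eval_mul]; exact mul_ne_zero hcat hB
  · have hS' := congrArg (algebraMap (MvPolynomial (Fin 2) ℂ) Rat2) hS
    rw [map_mul, map_mul, algebraMap_kernelPoly, algebraMap_poly2, algebraMap_X_one, ← hM] at hS'
    rw [map_mul _ _ S, map_pow, map_sub, map_one, algebraMap_X_zero,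
      map_mul (Polynomial.aeval yvar), div_mul_eq_mul_div,
      div_eq_iff hker]
    linear_combination (1 - xvar) ^ 2 * hS'
  · have hc := congrArg (fun p => algebraMap (MvPolynomial (Fin 2) ℂ) Rat2 (Polynomial.coeff p 0))
      hT'
    simp only [Polynomial.mul_coeff_zero, hK₂0, HasLead.coeff_expand_poly2,
      Polynomial.coeff_C_zero] at hc
    simp only [map_mul, map_pow, algebraMap_gamPoly, HasLead.algebraMap_C', algebraMap_X_zero,
      ← hΛ] at hc
    apply mul_left_cancel₀ hgam
    rw [hc, Polynomial.eval_mul, map_mul]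
    field_simp
    ring

/-- The lowest order term after one step of the discrete recursion. -/
lemma HasLead.nextM (hnd : W.NonDegenerate) (hzd : W.ZeroDrift) {M Λ f g : Rat2} {d : ℕ}
    {F G : RatFunc ℂ} (hM : HasLead M d Λ) (hF : HasLead (eval1 F xvar) d f)
    (hG : HasLead (eval1 G yvar) d g) (hdec : W.Decouples M F G) :
    HasLead (W.nextM M F G) (d + 2) ((Λ - f - g) / W.gam) := by
  have hU := (hM.sub hF).sub hG
  have h0 : ∀ {X : AlgFun}, W.OnCurve (X, tvar) →
      eval2 (M - eval1 F xvar - eval1 G yvar) X tvar = 0 := by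
    intro X hX
    have := ((hM.split.specAt hX.fst hX.snd).sub (SpecAt.x.eval1 F hX.fst)).sub
      (SpecAt.y.eval1 G hX.snd)
    rw [this.eval2, hdec _ hX]
    simp [ev]
  exact (HasLead.div_kernel hnd hzd hU (h0 (onCurve_Xp hnd hzd)) (h0 (onCurve_Xm hnd hzd))).mul_xy

end Walk

/-! ### Sequences modulo an ultrafilter -/

/-- The ultrafilter along which limits are taken. -/
abbrev ultra : Filter ℕ := (hyperfilter ℕ : Filter ℕ)

/-- The field of sequences of complex numbers modulo an ultrafilter. A sequence of points of the
curve is a point with coordinates in this field, and it is generic if the sequence has no constant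
coordinate. Identities at generic points thus become identities along sequences, without any need
to exclude the poles of the functions involved. -/
abbrev Ultra : Type := Germ ultra ℂ

/-- The class of a sequence. -/
def ofSeq : (ℕ → ℂ) →+* Ultra := Germ.coeRingHom ultra

instance : Algebra ℂ Ultra := (ofSeq.comp (Pi.constRingHom ℕ ℂ)).toAlgebra

lemma algebraMap_ultra (c : ℂ) : algebraMap ℂ Ultra c = ofSeq fun _ => c := rfl

lemma ofSeq_inv (f : ℕ → ℂ) : ofSeq (fun n => (f n)⁻¹) = (ofSeq f)⁻¹ := rfl

lemma ofSeq_div (f g : ℕ → ℂ) : ofSeq (fun n => f n / g n) = ofSeq f / ofSeq g := by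
  simp only [div_eq_mul_inv]; rw [← ofSeq_inv, ← map_mul]; rfl

lemma ofSeq_eq_iff {f g : ℕ → ℂ} : ofSeq f = ofSeq g ↔ ∀ᶠ n in ultra, f n = g n := Germ.coe_eq

lemma aeval_ofSeq (p : Polynomial ℂ) (x : ℕ → ℂ) :
    Polynomial.aeval (ofSeq x) p = ofSeq fun n => Polynomial.aeval (x n) p := by
  induction p using Polynomial.induction_on' with
  | add p q hp hq => rw [map_add, hp, hq, ← map_add]; congr 1; ext n; simp
  | monomial n a =>
    rw [Polynomial.aeval_monomial, algebraMap_ultra, ← map_pow, ← map_mul]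
    congr 1; ext k; simp [Polynomial.aeval_monomial]

lemma mvaeval_ofSeq (p : MvPolynomial (Fin 2) ℂ) (x y : ℕ → ℂ) :
    MvPolynomial.aeval ![ofSeq x, ofSeq y] p =
      ofSeq fun n => MvPolynomial.aeval ![x n, y n] p := by
  induction p using MvPolynomial.induction_on with
  | C a => rw [MvPolynomial.aeval_C, algebraMap_ultra]; congr 1; ext n; simp
  | add p q hp hq => rw [map_add, hp, hq, ← map_add]; congr 1; ext n; simp
  | mul_X p i hp =>
    rw [map_mul, hp, MvPolynomial.aeval_X]
    fin_cases i
    · change _ * ofSeq x = _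
      rw [← map_mul]; congr 1; ext n; simp
    · change _ * ofSeq y = _
      rw [← map_mul]; congr 1; ext n; simp

lemma eval1_ofSeq (f : RatFunc ℂ) (x : ℕ → ℂ) :
    eval1 f (ofSeq x) = ofSeq fun n => eval1 f (x n) := by
  simp only [eval1, aeval_ofSeq, ofSeq_div]

lemma eval2_ofSeq (f : Rat2) (x y : ℕ → ℂ) :
    eval2 f (ofSeq x) (ofSeq y) = ofSeq fun n => eval2 f (x n) (y n) := by
  simp only [eval2, mvaeval_ofSeq, ofSeq_div]

/-- The class of a sequence of points. -/
def ofPts (P : ℕ → ℂ × ℂ) : Ultra × Ultra := (ofSeq fun n => (P n).1, ofSeq fun n => (P n).2)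

namespace Walk

variable {W : Walk}

lemma ev_ofPts (M : Rat2) (P : ℕ → ℂ × ℂ) : ev M (ofPts P) = ofSeq fun n => ev M (P n) :=
  eval2_ofSeq _ _ _

lemma phi_ofPts (P : ℕ → ℂ × ℂ) : W.Phi (ofPts P) = ofPts fun n => W.Phi (P n) := by
  simp only [Phi, cat_eq, cct_eq, ofPts]; rfl

lemma psi_ofPts (P : ℕ → ℂ × ℂ) : W.Psi (ofPts P) = ofPts fun n => W.Psi (P n) := by
  simp only [Psi, ca_eq, cc_eq, ofPts]; rfl

lemma theta_ofPts (P : ℕ → ℂ × ℂ) : W.Theta (ofPts P) = ofPts fun n => W.Theta (P n) := by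
  simp only [Theta]; rw [phi_ofPts, psi_ofPts]

lemma theta_iterate_ofPts (P : ℕ → ℂ × ℂ) (i : ℕ) :
    W.Theta^[i] (ofPts P) = ofPts fun n => W.Theta^[i] (P n) := by
  induction i with
  | zero => rfl
  | succ i ih => simp only [Function.iterate_succ_apply']; rw [ih, theta_ofPts]

lemma kernel_ofPts (P : ℕ → ℂ × ℂ) : W.kernel (ofPts P).1 (ofPts P).2 =
    ofSeq fun n => W.kernel (P n).1 (P n).2 := by
  simp only [kernel_eq_x, cat_eq, cbt_eq, cct_eq, ofPts]; rfl

lemma decouplingSum_ofPts (M : Rat2) (P : ℕ → ℂ × ℂ) :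
    W.decouplingSum M (ofPts P) = ofSeq fun n => W.decouplingSum M (P n) := by
  simp only [decouplingSum]
  have hN : (W.halfOrder : Ultra) = ofSeq fun _ => (W.halfOrder : ℂ) := by
    rw [← algebraMap_ultra]; simp
  have hi : ∀ i : ℕ, (i : Ultra) = ofSeq fun _ => (i : ℂ) := fun i => by
    rw [← algebraMap_ultra]; simp
  have h1 : (1 : Ultra) = ofSeq fun _ => 1 := rfl
  rw [psi_ofPts]
  simp only [theta_iterate_ofPts, ev_ofPts, ← map_add, hN, hi, ← map_mul, ← map_sum, h1,
    ← ofSeq_div, ← map_neg]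
  congr 1
  ext n
  simp

/-! ### Sequences of points tending to `(1, 1)` in a given direction -/

/-- The points `P n` tend to `(1, 1)` like `(1 - μ ξ, 1 - μ η)`. -/
def Dir (μ : ℕ → ℂ) (P : ℕ → ℂ × ℂ) (ξ η : ℂ) : Prop :=
  Tendsto (fun n => (1 - (P n).1) / μ n) ultra (𝓝 ξ) ∧
    Tendsto (fun n => (1 - (P n).2) / μ n) ultra (𝓝 η)

variable {μ : ℕ → ℂ} {P : ℕ → ℂ × ℂ} {ξ η : ℂ}

lemma tendsto_one_of_div (hμ : Tendsto μ ultra (𝓝[≠] 0)) {x : ℕ → ℂ}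
    (h : Tendsto (fun n => (1 - x n) / μ n) ultra (𝓝 ξ)) : Tendsto x ultra (𝓝 1) := by
  have hμ0 : Tendsto μ ultra (𝓝 0) := hμ.mono_right nhdsWithin_le_nhds
  have h1 := (hμ0.mul h).const_sub 1
  rw [zero_mul, sub_zero] at h1
  refine h1.congr' ?_
  filter_upwards [hμ self_mem_nhdsWithin] with n hn
  rw [mul_div_cancel₀ _ hn, sub_sub_cancel]

/-- The linear part of `Φ` at `(1, 1)`. -/
lemma Dir.phi (hnd : W.NonDegenerate) (hzd : W.ZeroDrift) (hμ : Tendsto μ ultra (𝓝[≠] 0))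
    (h : Dir μ P ξ η) :
    Dir μ (fun n => W.Phi (P n)) ((W.cplus + W.cminus) * η - ξ) η := by
  refine ⟨?_, h.2⟩
  have hx := tendsto_one_of_div hμ h.1
  have hy := tendsto_one_of_div hμ h.2
  have hs := sigma11_ne hnd
  have hcat : Tendsto (fun n => W.cat (P n).2) ultra (𝓝 ((W.sigma11 : ℂ) / 2)) := by
    have h1 : W.cat (1 : ℂ) = (W.sigma11 : ℂ) / 2 := by
      simpa using cat_one_add (W := W) (L := ℂ) hzd 0
    rw [← h1]
    simp only [cat_eq]
    exact (((hy.const_mul _).const_add _).add ((hy.pow 2).const_mul _))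
  have hs2 : (W.sigma11 : ℂ) / 2 ≠ 0 := div_ne_zero hs two_ne_zero
  have hlim := (((h.2.mul ((hy.sub_const 1).const_mul (W.wt ℂ (-1) (-1) - W.wt ℂ 1 (-1))
    |>.const_add (W.sigma12 : ℂ))).add (h.1.mul hcat)).neg).div (hcat.mul hx) (by simpa using hs)
  have e : -(η * ((W.sigma12 : ℂ) + (W.wt ℂ (-1) (-1) - W.wt ℂ 1 (-1)) * (1 - 1)) +
      ξ * ((W.sigma11 : ℂ) / 2)) / ((W.sigma11 : ℂ) / 2 * 1) =
      (W.cplus + W.cminus) * η - ξ := by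
    rw [cplus_add_cminus hnd]; field_simp; ring
  rw [e] at hlim
  refine hlim.congr' ?_
  filter_upwards [hμ self_mem_nhdsWithin, hcat.eventually_ne hs2, hx.eventually_ne one_ne_zero]
    with n h1 h2 h3
  have e1 := cat_one_add (W := W) (L := ℂ) hzd ((P n).2 - 1)
  have e2 := cct_one_add' (W := W) (L := ℂ) hzd ((P n).2 - 1)
  have e3 := wt_sigma12 (W := W) (L := ℂ)
  have e4 := hzd.wt_x (L := ℂ)
  rw [add_sub_cancel] at e1 e2
  simp only [Algebra.algebraMap_self, RingHom.id_apply] at e3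
  have h1' : μ n ≠ 0 := h1
  have e5 : W.cct (P n).2 = W.cat (P n).2 - ((P n).2 - 1) * (W.sigma12 +
      (W.wt ℂ (-1) (-1) - W.wt ℂ 1 (-1)) * ((P n).2 - 1)) := by
    rw [e1, e2, e3]; linear_combination ((P n).2 - 1) * e4
  simp only [Phi, Pi.div_apply]
  rw [e5]
  field_simp
  ring

/-- The linear part of `Ψ` at `(1, 1)`. -/
lemma Dir.psi (hnd : W.NonDegenerate) (hzd : W.ZeroDrift) (hμ : Tendsto μ ultra (𝓝[≠] 0))
    (h : Dir μ P ξ η) :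
    Dir μ (fun n => W.Psi (P n)) ξ ((W.cplus⁻¹ + W.cminus⁻¹) * ξ - η) := by
  refine ⟨h.1, ?_⟩
  have hx := tendsto_one_of_div hμ h.1
  have hy := tendsto_one_of_div hμ h.2
  have hs := sigma22_ne hnd
  have hs11 := sigma11_ne hnd
  have hca : Tendsto (fun n => W.ca (P n).1) ultra (𝓝 ((W.sigma22 : ℂ) / 2)) := by
    have h1 : W.ca (1 : ℂ) = (W.sigma22 : ℂ) / 2 := by
      simpa using ca_one_add (W := W) (L := ℂ) hzd 0
    rw [← h1]
    simp only [ca_eq]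
    exact (((hx.const_mul _).const_add _).add ((hx.pow 2).const_mul _))
  have hs2 : (W.sigma22 : ℂ) / 2 ≠ 0 := div_ne_zero hs two_ne_zero
  have hlim := (((h.1.mul ((hx.sub_const 1).const_mul (W.wt ℂ (-1) (-1) - W.wt ℂ (-1) 1)
    |>.const_add (W.sigma12 : ℂ))).add (h.2.mul hca)).neg).div (hca.mul hy) (by simpa using hs)
  have e : -(ξ * ((W.sigma12 : ℂ) + (W.wt ℂ (-1) (-1) - W.wt ℂ (-1) 1) * (1 - 1)) +
      η * ((W.sigma22 : ℂ) / 2)) / ((W.sigma22 : ℂ) / 2 * 1) =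
      (W.cplus⁻¹ + W.cminus⁻¹) * ξ - η := by
    have h1 := cplus_add_cminus hnd
    have h2 := cplus_mul_cminus hnd
    have h3 : W.cplus⁻¹ + W.cminus⁻¹ = (W.cplus + W.cminus) / (W.cplus * W.cminus) := by
      have := cplus_ne_zero hnd
      have := cminus_ne_zero hnd
      field_simp; ring
    rw [h3, h1, h2]; field_simp; ring
  rw [e] at hlim
  refine hlim.congr' ?_
  filter_upwards [hμ self_mem_nhdsWithin, hca.eventually_ne hs2, hy.eventually_ne one_ne_zero]
    with n h1 h2 h3
  have e1 := ca_one_add (W := W) (L := ℂ) hzd ((P n).1 - 1)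
  have e2 := cc_one_add (W := W) (L := ℂ) hzd ((P n).1 - 1)
  have e3 := wt_sigma12 (W := W) (L := ℂ)
  have e4 := hzd.wt_y (L := ℂ)
  rw [add_sub_cancel] at e1 e2
  simp only [Algebra.algebraMap_self, RingHom.id_apply] at e3
  have h1' : μ n ≠ 0 := h1
  have e5 : W.cc (P n).1 = W.ca (P n).1 - ((P n).1 - 1) * (W.sigma12 +
      (W.wt ℂ (-1) (-1) - W.wt ℂ (-1) 1) * ((P n).1 - 1)) := by
    rw [e1, e2, e3]; linear_combination ((P n).1 - 1) * e4
  simp only [Psi, Pi.div_apply]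
  rw [e5]
  field_simp
  ring

/-- Along the orbit of a sequence with direction `(c_+, 1)` all directions are multiples of it. -/
lemma Dir.theta_iterate_plus (hnd : W.NonDegenerate) (hzd : W.ZeroDrift)
    (hμ : Tendsto μ ultra (𝓝[≠] 0)) {z : ℂ} (hz : z ≠ 0) (h : Dir μ P (z * W.cplus) z) (i : ℕ) :
    ∃ w : ℂ, w ≠ 0 ∧ Dir μ (fun n => W.Theta^[i] (P n)) (w * W.cplus) w := by
  have h1 := cplus_ne_zero hnd
  have h2 := cminus_ne_zero hnd
  induction i with
  | zero => exact ⟨z, hz, h⟩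
  | succ i ih =>
    obtain ⟨w, hw, hd⟩ := ih
    refine ⟨w * W.cminus / W.cplus, div_ne_zero (mul_ne_zero hw h2) h1, ?_⟩
    have := (hd.phi hnd hzd hμ).psi hnd hzd hμ
    simp only [Function.iterate_succ_apply', Theta]
    convert this using 1
    · field_simp; ring
    · field_simp; ring

lemma Dir.theta_iterate_minus (hnd : W.NonDegenerate) (hzd : W.ZeroDrift)
    (hμ : Tendsto μ ultra (𝓝[≠] 0)) {z : ℂ} (hz : z ≠ 0) (h : Dir μ P (z * W.cminus) z) (i : ℕ) :
    ∃ w : ℂ, w ≠ 0 ∧ Dir μ (fun n => W.Theta^[i] (P n)) (w * W.cminus) w := by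
  have h1 := cplus_ne_zero hnd
  have h2 := cminus_ne_zero hnd
  induction i with
  | zero => exact ⟨z, hz, h⟩
  | succ i ih =>
    obtain ⟨w, hw, hd⟩ := ih
    refine ⟨w * W.cplus / W.cminus, div_ne_zero (mul_ne_zero hw h1) h2, ?_⟩
    have := (hd.phi hnd hzd hμ).psi hnd hzd hμ
    simp only [Function.iterate_succ_apply', Theta]
    convert this using 1
    · field_simp; ring
    · field_simp; ring

lemma Dir.tendsto_ev {M Λ : Rat2} {d : ℕ} (hM : HasLead M d Λ) (hμ : Tendsto μ ultra (𝓝[≠] 0))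
    (h : Dir μ P ξ η) (hξ : ξ ≠ 0) (hη : η ≠ 0) :
    Tendsto (fun n => μ n ^ d * ev M (P n)) ultra (𝓝 (eval2 Λ ξ η)) := by
  refine (hM.tendsto hξ hη hμ h.1 h.2).congr' ?_
  filter_upwards [hμ self_mem_nhdsWithin] with n hn
  rw [mul_div_cancel₀ _ hn, mul_div_cancel₀ _ hn, sub_sub_cancel, sub_sub_cancel]

end Walk

/-! ### Functions of one variable with a pole at `1` -/

/-- `F` is the quotient of `p` by `(1 - X)^d A`, where `A(1) ≠ 0` and `p(1) / A(1) = c`: it behaves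
like `c / (1 - x)^d` at `1`. -/
def PoleForm (F : RatFunc ℂ) (d : ℕ) (c : ℂ) : Prop :=
  ∃ p A : Polynomial ℂ, A.eval 1 ≠ 0 ∧ F = algebraMap _ (RatFunc ℂ) p /
    algebraMap _ (RatFunc ℂ) ((1 - Polynomial.X) ^ d * A) ∧ p.eval 1 / A.eval 1 = c

namespace PoleForm

variable {F : RatFunc ℂ} {d : ℕ} {c : ℂ}

lemma hasLead_fst (h : PoleForm F d c) :
    HasLead (eval1 F xvar) d (algebraMap ℂ Rat2 c / xvar ^ d) := by
  obtain ⟨p, A, hA, hF, rfl⟩ := h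
  exact HasLead.of_fst hA hF

lemma hasLead_snd (h : PoleForm F d c) :
    HasLead (eval1 F yvar) d (algebraMap ℂ Rat2 c / yvar ^ d) := by
  obtain ⟨p, A, hA, hF, rfl⟩ := h
  exact HasLead.of_snd hA hF

lemma neg (h : PoleForm F d c) : PoleForm (-F) d (-c) := by
  obtain ⟨p, A, hA, rfl, rfl⟩ := h
  exact ⟨-p, A, hA, by rw [map_neg]; exact (neg_div _ _).symm, by rw [Polynomial.eval_neg, neg_div]⟩

lemma tendsto (h : PoleForm F d c) {ι : Type*} {l : Filter ι} {μ x : ι → ℂ} {ξ : ℂ}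
    (hμ : Tendsto μ l (𝓝[≠] 0)) (hx : Tendsto (fun i => (1 - x i) / μ i) l (𝓝 ξ)) (hξ : ξ ≠ 0)
    (hx1 : Tendsto x l (𝓝 1)) :
    Tendsto (fun i => μ i ^ d * eval1 F (x i)) l (𝓝 (c / ξ ^ d)) := by
  obtain ⟨p, A, hA, hF, rfl⟩ := h
  have hp := (p.continuous.tendsto 1).comp hx1
  have hA1 := (A.continuous.tendsto 1).comp hx1
  refine ((hp.div hA1 hA).div (hx.pow d) (pow_ne_zero d hξ)).congr' ?_
  filter_upwards [hμ self_mem_nhdsWithin, hx.eventually_ne hξ, hA1.eventually_ne hA]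
    with i h1 h2 h3
  have h1' : μ i ≠ 0 := h1
  have h4 : 1 - x i ≠ 0 := fun h0 => h2 (by rw [h0, zero_div])
  simp only [Function.comp_apply, Pi.div_apply] at h3 ⊢
  rw [eval1_eq_div hF (by simpa using ⟨fun h => absurd h h4, h3⟩), div_pow]
  simp only [map_mul, map_pow, map_sub, map_one, Polynomial.aeval_X, Polynomial.coe_aeval_eq_eval]
  field_simp

end PoleForm

lemma eventually_ne_zero_of_tendsto_one {ι : Type*} {l : Filter ι} {x : ι → ℂ}
    (hx : Tendsto x l (𝓝[≠] 1)) {p : Polynomial ℂ} (hp : p ≠ 0) : ∀ᶠ i in l, p.eval (x i) ≠ 0 := by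
  have h : ∀ᶠ z in 𝓝[≠] (1 : ℂ), p.eval z ≠ 0 := by
    have h1 : ((p.roots.toFinset : Set ℂ) \ {1})ᶜ ∈ 𝓝 (1 : ℂ) :=
      ((p.roots.toFinset.finite_toSet.subset Set.sdiff_subset).isClosed.isOpen_compl).mem_nhds
        (by simp)
    filter_upwards [nhdsWithin_le_nhds h1, self_mem_nhdsWithin] with z hz hz1 h0
    exact hz ⟨by simpa [hp] using h0, hz1⟩
  exact hx.eventually h

/-- The order and the coefficient of the pole at `1` can be read off along one sequence. -/
lemma poleForm_of_tendsto {μ x : ℕ → ℂ} {ξ c : ℂ} (hμ : Tendsto μ ultra (𝓝[≠] 0))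
    (hx : Tendsto (fun n => (1 - x n) / μ n) ultra (𝓝 ξ)) (hξ : ξ ≠ 0) {F : RatFunc ℂ} {d : ℕ}
    (h : Tendsto (fun n => μ n ^ d * eval1 F (x n)) ultra (𝓝 c)) : PoleForm F d (c * ξ ^ d) := by
  have hX : (1 - Polynomial.X : Polynomial ℂ) ≠ 0 := by
    intro h0; simpa using congrArg (Polynomial.eval 0) h0
  have hX' : algebraMap (Polynomial ℂ) (RatFunc ℂ) (1 - Polynomial.X) ≠ 0 :=
    (map_ne_zero_iff _ (IsFractionRing.injective _ _)).2 hX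
  set E := algebraMap (Polynomial ℂ) (RatFunc ℂ) (1 - Polynomial.X) ^ d * F with hE
  have hden := E.denom_ne_zero
  have hF : F = algebraMap _ (RatFunc ℂ) E.num /
      algebraMap _ (RatFunc ℂ) ((1 - Polynomial.X) ^ d * E.denom) := by
    have h1 := E.num_div_denom
    rw [map_mul, map_pow, mul_comm, ← div_div, h1, hE, mul_div_cancel_left₀ _ (pow_ne_zero d hX')]
  have hx1 := Walk.tendsto_one_of_div hμ hx
  have hx1' : Tendsto x ultra (𝓝[≠] 1) := by
    refine tendsto_nhdsWithin_iff.2 ⟨hx1, ?_⟩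
    filter_upwards [hx.eventually_ne hξ] with n hn h0
    rw [Set.mem_singleton_iff] at h0
    exact hn (by rw [h0, sub_self, zero_div])
  have hp := (E.num.continuous.tendsto 1).comp hx1
  have hA := (E.denom.continuous.tendsto 1).comp hx1
  have key : E.num.eval 1 = E.denom.eval 1 * (c * ξ ^ d) := by
    refine tendsto_nhds_unique hp ((hA.mul (h.mul (hx.pow d))).congr' ?_)
    filter_upwards [hμ self_mem_nhdsWithin, eventually_ne_zero_of_tendsto_one hx1' hden,
      hx1'.eventually self_mem_nhdsWithin] with n h1 h2 h3
    have h1' : μ n ≠ 0 := h1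
    have h4 : 1 - x n ≠ 0 := fun h0 => h3 (sub_eq_zero.1 h0).symm
    rw [eval1_eq_div hF (by simpa using ⟨fun h => absurd h h4, h2⟩), div_pow]
    simp only [map_mul, map_pow, map_sub, map_one, Polynomial.aeval_X,
      Polynomial.coe_aeval_eq_eval, Function.comp_apply]
    field_simp
  have hA1 : E.denom.eval 1 ≠ 0 := by
    intro h0
    rw [h0, zero_mul] at key
    obtain ⟨a, b, hab⟩ := E.isCoprime_num_denom
    have := congrArg (Polynomial.eval 1) hab
    simp [h0, key] at this
  exact ⟨_, _, hA1, hF, by rw [key, mul_div_cancel_left₀ _ hA1]⟩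

namespace Walk

variable {W : Walk}

/-! ### A path on the curve `K = 0` through `(1, 1)` -/

/-- A sequence of points of the curve that tends to `(1, 1)` in the direction `(c_+, 1)`. -/
structure IsPath (W : Walk) (μ : ℕ → ℂ) (P : ℕ → ℂ × ℂ) : Prop where
  tendsto : Tendsto μ ultra (𝓝[≠] 0)
  dir : Dir μ P W.cplus 1
  onCurve : W.OnCurve (ofPts P)

/-- A sequence that tends to `1` at the same speed as `μ` is not constant. -/
lemma transcendental_ofSeq {μ x : ℕ → ℂ} {ξ : ℂ} (hμ : Tendsto μ ultra (𝓝[≠] 0))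
    (hx : Tendsto (fun n => (1 - x n) / μ n) ultra (𝓝 ξ)) (hξ : ξ ≠ 0) :
    Transcendental ℂ (ofSeq x) := by
  refine transcendental_of_forall_ne fun c hc => ?_
  rw [algebraMap_ultra, ofSeq_eq_iff] at hc
  have h1 : c = 1 := tendsto_nhds_unique
    (tendsto_const_nhds.congr' (hc.mono fun n h => h.symm)) (tendsto_one_of_div hμ hx)
  refine hξ (tendsto_nhds_unique hx (tendsto_const_nhds.congr' (hc.mono fun n h => ?_)))
  simp only [h, h1, sub_self, zero_div]

lemma exists_isPath (hnd : W.NonDegenerate) (hzd : W.ZeroDrift) : ∃ μ P, W.IsPath μ P := by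
  have hs := sigma11_ne hnd
  let μ : ℕ → ℂ := fun n => 1 / ((n : ℂ) + 1)
  have hμ0 : Tendsto μ ultra (𝓝 0) :=
    (tendsto_one_div_add_atTop_nhds_zero_nat (𝕜 := ℂ)).mono_left Nat.hyperfilter_le_atTop
  have hμ : Tendsto μ ultra (𝓝[≠] 0) := by
    refine tendsto_nhdsWithin_iff.2 ⟨hμ0, Eventually.of_forall fun n => ?_⟩
    exact one_div_ne_zero (Nat.cast_add_one_ne_zero n)
  -- On the line `y = 1 - μ` the kernel at `x = 1 - μ ξ` is `μ² (A ξ² + B ξ + σ₂₂ / 2)`.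
  let A : ℕ → ℂ := fun n => (W.sigma11 : ℂ) / 2 -
    (W.wt ℂ (-1) 0 + 2 * W.wt ℂ (-1) (-1)) * μ n + W.wt ℂ (-1) (-1) * μ n ^ 2
  let B : ℕ → ℂ := fun n => (W.sigma12 : ℂ) - (W.wt ℂ 0 (-1) + 2 * W.wt ℂ (-1) (-1)) * μ n
  have hA : Tendsto A ultra (𝓝 ((W.sigma11 : ℂ) / 2)) := by
    have := ((hμ0.const_mul (W.wt ℂ (-1) 0 + 2 * W.wt ℂ (-1) (-1))).const_sub
      ((W.sigma11 : ℂ) / 2)).add ((hμ0.pow 2).const_mul (W.wt ℂ (-1) (-1)))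
    simpa using this
  have hB : Tendsto B ultra (𝓝 (W.sigma12 : ℂ)) := by
    have := (hμ0.const_mul (W.wt ℂ 0 (-1) + 2 * W.wt ℂ (-1) (-1))).const_sub (W.sigma12 : ℂ)
    simpa using this
  let w : ℂ := W.sigma11 * W.cplus + W.sigma12
  have hw2 : w ^ 2 = (W.sigma12 : ℂ) ^ 2 - W.sigma11 * W.sigma22 := by
    have h1 := cplus_add_cminus hnd
    have h2 := cplus_mul_cminus hnd
    rw [eq_div_iff hs] at h1 h2
    simp only [w]
    linear_combination (W.sigma11 : ℂ) * W.cplus * h1 - (W.sigma11 : ℂ) * h2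
  have hw : w ≠ 0 := by
    intro h0
    have h1 := cplus_add_cminus hnd
    rw [eq_div_iff hs] at h1
    refine cplus_ne_cminus hnd (mul_left_cancel₀ hs ?_)
    have h0' : (W.sigma11 : ℂ) * W.cplus + W.sigma12 = 0 := h0
    linear_combination 2 * h0' - h1
  let D : ℕ → ℂ := fun n => B n ^ 2 - 2 * W.sigma22 * A n
  have hD : Tendsto (fun n => D n / w ^ 2) ultra (𝓝 1) := by
    have := (((hB.pow 2).sub (hA.const_mul (2 * (W.sigma22 : ℂ)))).div_const (w ^ 2))
    have e : ((W.sigma12 : ℂ) ^ 2 - 2 * W.sigma22 * (W.sigma11 / 2)) / w ^ 2 = 1 := by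
      rw [div_eq_one_iff_eq (pow_ne_zero 2 hw), hw2]; ring
    rwa [e] at this
  -- The branch of the square root of the discriminant that tends to `w`.
  let r : ℕ → ℂ := fun n => w * (D n / w ^ 2) ^ (((2 : ℕ) : ℂ)⁻¹)
  have hr : Tendsto r ultra (𝓝 w) := by
    have h1 : Tendsto (fun z : ℂ => z ^ (((2 : ℕ) : ℂ)⁻¹)) (𝓝 1) (𝓝 1) := by
      have := (continuousAt_cpow_const (b := ((2 : ℕ) : ℂ)⁻¹) Complex.one_mem_slitPlane).tendsto
      simpa using this
    have := (h1.comp hD).const_mul w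
    rwa [mul_one] at this
  have hr2 : ∀ n, r n ^ 2 = D n := fun n => by
    simp only [r]
    rw [mul_pow, Complex.cpow_nat_inv_pow _ two_ne_zero, mul_div_cancel₀ _ (pow_ne_zero 2 hw)]
  let ξ : ℕ → ℂ := fun n => (-B n + r n) / (2 * A n)
  have hξ : Tendsto ξ ultra (𝓝 W.cplus) := by
    have := (hB.neg.add hr).div (hA.const_mul 2) (by simpa using hs)
    have e : (-(W.sigma12 : ℂ) + w) / (2 * (W.sigma11 / 2)) = W.cplus := by
      simp only [w]; field_simp; ring
    rwa [e] at this
  let P : ℕ → ℂ × ℂ := fun n => (1 - μ n * ξ n, 1 - μ n)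
  have hdir : Dir μ P W.cplus 1 := by
    constructor
    · refine hξ.congr' ?_
      filter_upwards [hμ self_mem_nhdsWithin] with n hn
      simp only [P]
      rw [sub_sub_cancel, mul_div_cancel_left₀ _ hn]
    · refine tendsto_const_nhds.congr' ?_
      filter_upwards [hμ self_mem_nhdsWithin] with n hn
      simp only [P]
      rw [sub_sub_cancel, div_self hn]
  refine ⟨μ, P, hμ, hdir, OnCurve.of_snd hnd hzd (transcendental_ofSeq hμ hdir.2 one_ne_zero) ?_⟩
  have e0 : (0 : Ultra) = ofSeq fun _ => 0 := rfl
  have := kernel_ofPts (W := W) P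
  simp only [ofPts] at this
  rw [this, e0, ofSeq_eq_iff]
  filter_upwards [hA.eventually_ne (div_ne_zero hs two_ne_zero)] with n hn
  have h1 := kernel_one_add (W := W) (L := ℂ) hzd (-(μ n * ξ n)) (-μ n)
  simp only [P, sub_eq_add_neg]
  rw [h1]
  have h2 : 2 * A n * ξ n = -B n + r n := by simp only [ξ]; field_simp
  have h3 : A n * ξ n ^ 2 + B n * ξ n + (W.sigma22 : ℂ) / 2 = 0 := by
    have h4 : 4 * A n * (A n * ξ n ^ 2 + B n * ξ n + (W.sigma22 : ℂ) / 2) = 0 := by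
      have h5 := hr2 n
      simp only [D] at h5
      linear_combination (2 * A n * ξ n + B n + r n) * h2 + h5
    exact (mul_eq_zero.1 h4).resolve_left (mul_ne_zero (by norm_num) hn)
  simp only [A, B] at h3
  simp only [Algebra.algebraMap_self, RingHom.id_apply]
  linear_combination μ n ^ 2 * h3

section Path

variable {μ : ℕ → ℂ} {P : ℕ → ℂ × ℂ} {M Λ f : Rat2} {d : ℕ}

/-- The conjugate path, with direction `(c_-, 1)`. -/
lemma IsPath.dir_phi (hnd : W.NonDegenerate) (hzd : W.ZeroDrift) (h : W.IsPath μ P) :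
    Dir μ (fun n => W.Phi (P n)) W.cminus 1 := by
  have := h.dir.phi hnd hzd h.tendsto
  rwa [mul_one, add_sub_cancel_left] at this

/-- The leading coefficient of the decoupling function exists: along the path, it is a combination
of the leading coefficients of `M` in the directions of the orbit. -/
lemma IsPath.poleForm_decouplingFun (hnd : W.NonDegenerate) (hzd : W.ZeroDrift)
    (h : W.IsPath μ P) (hM : HasLead M d Λ) :
    ∃ c, PoleForm (toRat (W.decouplingFun M)) d c := by
  have h1 := cplus_ne_zero hnd
  have h2 := cminus_ne_zero hnd
  have hΨ : Dir μ (fun n => W.Psi (P n)) (W.cplus / W.cminus * W.cminus) (W.cplus / W.cminus) := by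
    have := h.dir.psi hnd hzd h.tendsto
    convert this using 1
    · field_simp
    · field_simp; ring
  have hp : ∀ i : ℕ, ∃ c, Tendsto (fun n => μ n ^ d * ev M (W.Theta^[i] (P n))) ultra (𝓝 c) := by
    intro i
    obtain ⟨w, hw, hd⟩ := Dir.theta_iterate_plus hnd hzd h.tendsto one_ne_zero
      (by rw [one_mul]; exact h.dir) i
    exact ⟨_, hd.tendsto_ev hM h.tendsto (mul_ne_zero hw h1) hw⟩
  have hm : ∀ i : ℕ, ∃ c,
      Tendsto (fun n => μ n ^ d * ev M (W.Theta^[i] (W.Psi (P n)))) ultra (𝓝 c) := by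
    intro i
    obtain ⟨w, hw, hd⟩ := Dir.theta_iterate_minus hnd hzd h.tendsto (div_ne_zero h1 h2) hΨ i
    exact ⟨_, hd.tendsto_ev hM h.tendsto (mul_ne_zero hw h2) hw⟩
  choose cp hcp using hp
  choose cm hcm using hm
  have hsum : Tendsto (fun n => ∑ i ∈ Finset.Ico 1 W.halfOrder, (i : ℂ) *
      (μ n ^ d * ev M (W.Theta^[i] (P n)) + μ n ^ d * ev M (W.Theta^[i] (W.Psi (P n))))) ultra
      (𝓝 (∑ i ∈ Finset.Ico 1 W.halfOrder, (i : ℂ) * (cp i + cm i))) :=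
    tendsto_finsetSum _ fun i _ => ((hcp i).add (hcm i)).const_mul (i : ℂ)
  have hlim := hsum.const_mul (-(1 / (W.halfOrder : ℂ)))
  refine ⟨_, poleForm_of_tendsto h.tendsto h.dir.1 h1 (hlim.congr' ?_)⟩
  have e := eval1_decouplingFun hnd hzd M h.onCurve
  rw [decouplingSum_ofPts, ofPts, eval1_ofSeq, ofSeq_eq_iff] at e
  filter_upwards [e] with n hn
  rw [hn, decouplingSum]
  simp only [Finset.mul_sum]
  exact Finset.sum_congr rfl fun i _ => by ring

/-- The lowest order terms of a decoupling `M = F(x) + G(y)` on the curve are a decoupling on the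
tangent directions `(c_±, 1)`. -/
lemma IsPath.lead_decoupling (hnd : W.NonDegenerate) (hzd : W.ZeroDrift) (h : W.IsPath μ P)
    {F G : RatFunc ℂ} (hM : HasLead M d Λ) (hF : HasLead (eval1 F xvar) d f)
    (hdec : W.Decouples M F G) :
    eval2 (Λ - f) W.cplus 1 = eval2 (Λ - f) W.cminus 1 ∧
      PoleForm G d (eval2 (Λ - f) W.cplus 1) := by
  have hU := hM.sub hF
  have hG : ∀ {Q : ℕ → ℂ × ℂ} {z : ℂ}, z ≠ 0 → W.OnCurve (ofPts Q) → Dir μ Q z 1 →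
      Tendsto (fun n => μ n ^ d * eval1 G (Q n).2) ultra (𝓝 (eval2 (Λ - f) z 1)) := by
    intro Q z hz hQ hd
    refine (hd.tendsto_ev hU h.tendsto hz one_ne_zero).congr' ?_
    have e1 : ev (M - eval1 F xvar) (ofPts Q) = eval1 G (ofPts Q).2 := by
      rw [hdec _ hQ]
      exact ((hM.split.specAt hQ.fst hQ.snd).sub (SpecAt.x.eval1 F hQ.fst)).eval2
    rw [ev_ofPts, ofPts, eval1_ofSeq, ofSeq_eq_iff] at e1
    filter_upwards [e1] with n hn
    rw [hn]
  have h1 := hG (cplus_ne_zero hnd) h.onCurve h.dir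
  have h2 := hG (cminus_ne_zero hnd) (by rw [← phi_ofPts]; exact h.onCurve.phi hnd hzd)
    (h.dir_phi hnd hzd)
  refine ⟨tendsto_nhds_unique h1 h2, ?_⟩
  simpa using poleForm_of_tendsto h.tendsto h.dir.2 one_ne_zero h1

end Path

end Walk

/-! ### Dickson polynomials -/

/-- The defining property of the Dickson polynomials of the first kind. -/
lemma aeval_dickson {L : Type*} [Field L] [Algebra ℂ L] {c : ℂ} {a b : L}
    (h : a * b = algebraMap ℂ L c) (n : ℕ) :
    Polynomial.aeval (a + b) (Polynomial.dickson 1 c n) = a ^ n + b ^ n := by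
  induction n using Nat.twoStepInduction with
  | zero =>
    rw [Polynomial.dickson_zero, map_sub, map_ofNat, map_natCast, pow_zero, pow_zero]
    norm_num
  | one => simp
  | more n h1 h2 =>
    rw [Polynomial.dickson_add_two, map_sub, map_mul, map_mul, h1, h2, Polynomial.aeval_X,
      Polynomial.aeval_C, ← h]
    ring

lemma natDegree_dickson_le (c : ℂ) (n : ℕ) : (Polynomial.dickson 1 c n).natDegree ≤ n := by
  induction n using Nat.twoStepInduction with
  | zero => rw [Polynomial.dickson_zero]; norm_num
  | one => simp
  | more n h1 h2 =>
    rw [Polynomial.dickson_add_two]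
    refine (Polynomial.natDegree_sub_le _ _).trans (max_le ?_ ?_)
    · refine Polynomial.natDegree_mul_le.trans ?_
      have := Polynomial.natDegree_X_le (R := ℂ)
      omega
    · refine (Polynomial.natDegree_C_mul_le _ _).trans ?_
      omega

lemma coeff_dickson (c : ℂ) (n : ℕ) : (Polynomial.dickson 1 c (n + 1)).coeff (n + 1) = 1 := by
  induction n with
  | zero => simp
  | succ n ih =>
    rw [Polynomial.dickson_add_two, Polynomial.coeff_sub, Polynomial.coeff_X_mul, ih,
      Polynomial.coeff_C_mul, Polynomial.coeff_eq_zero_of_natDegree_lt, mul_zero, sub_zero]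
    exact (natDegree_dickson_le c n).trans_lt (by omega)

namespace Walk

variable {W : Walk}

/-! ### The conformal gluing function -/

/-- The substitution `x ↦ 1 / (x - 1)` turns a polynomial of degree `m` into a rational function
with a pole of order `m` at `1`. -/
lemma exists_eval1_eq_aeval_inv {E : Polynomial ℂ} {m : ℕ} (hE : E.natDegree ≤ m) :
    ∃ q : Polynomial ℂ, q.natDegree ≤ m ∧ q.eval 1 = E.coeff m ∧
      ∀ {L : Type} [Field L] [Algebra ℂ L] (u : L), u ≠ 1 →
        eval1 (algebraMap (Polynomial ℂ) (RatFunc ℂ) q / (RatFunc.X - 1) ^ m) u =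
          Polynomial.aeval (u - 1)⁻¹ E := by
  refine ⟨∑ i ∈ Finset.range (m + 1),
    Polynomial.C (E.coeff i) * (Polynomial.X - 1) ^ (m - i), ?_, ?_, ?_⟩
  · refine Polynomial.natDegree_sum_le_of_forall_le _ _ fun i _ => ?_
    refine (Polynomial.natDegree_C_mul_le _ _).trans (Polynomial.natDegree_pow_le.trans ?_)
    have : (Polynomial.X - 1 : Polynomial ℂ).natDegree = 1 := by
      simpa using Polynomial.natDegree_X_sub_C (1 : ℂ)
    rw [this]; omega
  · rw [Polynomial.eval_finsetSum, Finset.sum_eq_single_of_mem m (by simp)]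
    · simp
    · intro i hi hm
      have : m - i ≠ 0 := by have := Finset.mem_range.1 hi; omega
      simp [this]
  · intro L _ _ u hu
    have hu' : u - 1 ≠ 0 := sub_ne_zero.2 hu
    rw [eval1_eq_div (p := ∑ i ∈ Finset.range (m + 1),
        Polynomial.C (E.coeff i) * (Polynomial.X - 1) ^ (m - i)) (q := (Polynomial.X - 1) ^ m)
        (by simp) (by simpa using fun h => absurd h hu'),
      Polynomial.aeval_eq_sum_range' (p := E) (n := m + 1) (by omega), map_sum, Finset.sum_div]
    refine Finset.sum_congr rfl fun i hi => ?_
    have hi' : i ≤ m := by have := Finset.mem_range.1 hi; omega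
    simp only [map_mul, map_pow, map_sub, map_one, Polynomial.aeval_X, Polynomial.aeval_C,
      Algebra.smul_def, inv_pow]
    rw [pow_sub₀ _ hu' hi']
    field_simp

/-- In the coordinates `1 / (x - 1)` and `1 / (y - 1)`, shifted by constants, the curve `K = 0` is
the conic `(U - V / c_+) (U - V / c_-) = const`. -/
lemma exists_conic (hnd : W.NonDegenerate) (hzd : W.ZeroDrift) : ∃ x₀ y₀ c : ℂ,
    ∀ {L : Type} [Field L] [Algebra ℂ L] {q : L × L}, W.OnCurve q →
      ((q.1 - 1)⁻¹ + algebraMap ℂ L x₀ -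
          algebraMap ℂ L W.cplus⁻¹ * ((q.2 - 1)⁻¹ + algebraMap ℂ L y₀)) *
        ((q.1 - 1)⁻¹ + algebraMap ℂ L x₀ -
          algebraMap ℂ L W.cminus⁻¹ * ((q.2 - 1)⁻¹ + algebraMap ℂ L y₀)) = algebraMap ℂ L c := by
  obtain ⟨k₁, hk1⟩ : ∃ k : ℂ, k = W.wt ℂ (-1) 0 + 2 * W.wt ℂ (-1) (-1) := ⟨_, rfl⟩
  obtain ⟨k₂, hk2⟩ : ∃ k : ℂ, k = W.wt ℂ 0 (-1) + 2 * W.wt ℂ (-1) (-1) := ⟨_, rfl⟩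
  obtain ⟨k₃, hk3⟩ : ∃ k : ℂ, k = W.wt ℂ (-1) (-1) := ⟨_, rfl⟩
  have hs1 := sigma11_ne hnd
  have hs2 := sigma22_ne hnd
  have hc1 := cplus_ne_zero hnd
  have hc2 := cminus_ne_zero hnd
  have hdet : (W.sigma11 : ℂ) * W.sigma22 - (W.sigma12 : ℂ) ^ 2 ≠ 0 := by
    exact_mod_cast (det_pos hnd).ne'
  -- The shift moves the centre of the conic to the origin.
  obtain ⟨x₀, hx0⟩ : ∃ x : ℂ, x = (W.sigma11 * k₂ - W.sigma12 * k₁) /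
    (W.sigma11 * W.sigma22 - (W.sigma12 : ℂ) ^ 2) := ⟨_, rfl⟩
  obtain ⟨y₀, hy0⟩ : ∃ y : ℂ, y = (W.sigma22 * k₁ - W.sigma12 * k₂) /
    (W.sigma11 * W.sigma22 - (W.sigma12 : ℂ) ^ 2) := ⟨_, rfl⟩
  have e1 : W.sigma22 * x₀ + W.sigma12 * y₀ = k₂ := by
    rw [hx0, hy0, mul_div_assoc', mul_div_assoc', ← add_div, div_eq_iff hdet]; ring
  have e2 : W.sigma12 * x₀ + W.sigma11 * y₀ = k₁ := by
    rw [hx0, hy0, mul_div_assoc', mul_div_assoc', ← add_div, div_eq_iff hdet]; ring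
  have e3 : W.cplus⁻¹ + W.cminus⁻¹ = -2 * (W.sigma12 : ℂ) / W.sigma22 := by
    have h1 := cplus_add_cminus hnd
    have h2 := cplus_mul_cminus hnd
    have h3 : W.cplus⁻¹ + W.cminus⁻¹ = (W.cplus + W.cminus) / (W.cplus * W.cminus) := by
      field_simp; ring
    rw [h3, h1, h2]; field_simp
  have e4 : W.cplus⁻¹ * W.cminus⁻¹ = (W.sigma11 : ℂ) / W.sigma22 := by
    rw [← mul_inv, cplus_mul_cminus hnd, inv_div]
  refine ⟨x₀, y₀, x₀ ^ 2 + 2 * W.sigma12 / W.sigma22 * x₀ * y₀ + W.sigma11 / W.sigma22 * y₀ ^ 2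
    - 2 * k₃ / W.sigma22, ?_⟩
  intro L _ _ q hq
  have hu : q.1 - 1 ≠ 0 := sub_ne_zero.2 (by simpa using hq.fst.ne_algebraMap 1)
  have hv : q.2 - 1 ≠ 0 := sub_ne_zero.2 (by simpa using hq.snd.ne_algebraMap 1)
  have hK := kernel_one_add (W := W) hzd (q.1 - 1) (q.2 - 1)
  rw [add_sub_cancel, add_sub_cancel, hq.kernel] at hK
  have i1 := congrArg (algebraMap ℂ L) e1
  have i2 := congrArg (algebraMap ℂ L) e2
  have i3 := congrArg (algebraMap ℂ L) e3
  have i4 := congrArg (algebraMap ℂ L) e4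
  have hs2' : algebraMap ℂ L (W.sigma22 : ℂ) ≠ 0 := by simpa using hs2
  have h2 := two_ne_zero_of_algebra (L := L)
  have w1 : algebraMap ℂ L k₁ = W.wt L (-1) 0 + 2 * W.wt L (-1) (-1) := by
    rw [hk1, map_add, map_mul, map_ofNat]; simp [wt]
  have w2 : algebraMap ℂ L k₂ = W.wt L 0 (-1) + 2 * W.wt L (-1) (-1) := by
    rw [hk2, map_add, map_mul, map_ofNat]; simp [wt]
  have w3 : algebraMap ℂ L k₃ = W.wt L (-1) (-1) := by simp [hk3, wt]
  rw [← w1, ← w2, ← w3] at hK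
  simp only [map_add, map_mul, map_sub, map_pow, map_div₀, map_neg, map_ofNat] at i1 i2 i3 i4 ⊢
  generalize algebraMap ℂ L W.cplus⁻¹ = ρ at *
  generalize algebraMap ℂ L W.cminus⁻¹ = ρ' at *
  generalize algebraMap ℂ L (W.sigma22 : ℂ) = s2 at *
  generalize algebraMap ℂ L (W.sigma11 : ℂ) = s1 at *
  generalize algebraMap ℂ L (W.sigma12 : ℂ) = s at *
  generalize algebraMap ℂ L x₀ = x at *
  generalize algebraMap ℂ L y₀ = y at *
  generalize algebraMap ℂ L k₁ = l1 at *
  generalize algebraMap ℂ L k₂ = l2 at *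
  generalize algebraMap ℂ L k₃ = l3 at *
  rw [eq_div_iff hs2'] at i3 i4
  have hU : (q.1 - 1)⁻¹ * (q.1 - 1) = 1 := inv_mul_cancel₀ hu
  have hV : (q.2 - 1)⁻¹ * (q.2 - 1) = 1 := inv_mul_cancel₀ hv
  generalize (q.1 - 1)⁻¹ = U at *
  generalize (q.2 - 1)⁻¹ = V at *
  generalize q.1 - 1 = u at *
  generalize q.2 - 1 = v at *
  -- The equation of the curve, divided by `u² v²`.
  have hK' : s1 * V ^ 2 + 2 * l1 * V + 2 * l3 + (2 * s * V + 2 * l2) * U + s2 * U ^ 2 = 0 := by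
    have hK2 : 0 = (s1 + 2 * l1 * v + 2 * l3 * v ^ 2) * u ^ 2 +
        (2 * s * v + 2 * l2 * v ^ 2) * u + s2 * v ^ 2 := by
      field_simp at hK; linear_combination hK
    have hU2 : U = u⁻¹ := eq_inv_of_mul_eq_one_left hU
    have hV2 : V = v⁻¹ := eq_inv_of_mul_eq_one_left hV
    rw [hU2, hV2]
    field_simp
    linear_combination -hK2
  refine mul_left_cancel₀ hs2' ?_
  have hgoal : s2 * (x ^ 2 + 2 * s / s2 * x * y + s1 / s2 * y ^ 2 - 2 * l3 / s2) =
      s2 * x ^ 2 + 2 * s * x * y + s1 * y ^ 2 - 2 * l3 := by field_simp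
  rw [hgoal]
  linear_combination hK' + (V + y) ^ 2 * i4 - (U + x) * (V + y) * i3 + 2 * U * i1 + 2 * V * i2

/-- The gluing function is a Dickson polynomial in a shift of `1 / (x - 1)`: on the conic
`S T = const`, which is an affine image of the curve, the exchange of `X_+` and `X_-` multiplies
the two summands of the argument by `m`-th roots of unity and swaps them. -/
lemma exists_isGluing (hnd : W.NonDegenerate) (hzd : W.ZeroDrift) {m : ℕ}
    (hm : Real.pi / W.theta = m) : ∃ ω, W.IsGluing m ω := by
  obtain ⟨x₀, y₀, c, hconic⟩ := exists_conic hnd hzd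
  have hc1 := cplus_ne_zero hnd
  have hc2 := cminus_ne_zero hnd
  have hm0 := m_ne_zero hnd hm
  have hδ : W.cplus⁻¹ - W.cminus⁻¹ ≠ 0 :=
    sub_ne_zero.2 fun h => cplus_ne_cminus hnd (inv_injective h)
  set δ := W.cplus⁻¹ - W.cminus⁻¹ with hδ'
  set D := Polynomial.dickson 1 (-(W.cplus⁻¹ * W.cminus⁻¹ * c / δ ^ 2)) m with hD
  -- The shift by `x₀` and the normalization at `0`, where `1 / (x - 1) = -1`.
  set E := D.comp (Polynomial.X + Polynomial.C x₀) - Polynomial.C (D.eval (-1 + x₀)) with hE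
  have hcomp : (D.comp (Polynomial.X + Polynomial.C x₀)).natDegree ≤ m := by
    rw [Polynomial.natDegree_comp, Polynomial.natDegree_X_add_C, mul_one]
    exact natDegree_dickson_le _ _
  have hEdeg : E.natDegree ≤ m :=
    (Polynomial.natDegree_sub_le _ _).trans (max_le hcomp (by simp))
  have hEm : E.coeff m = 1 := by
    obtain ⟨k, rfl⟩ := Nat.exists_eq_succ_of_ne_zero hm0
    have h1 : D.natDegree = k + 1 :=
      le_antisymm (natDegree_dickson_le _ _) (Polynomial.le_natDegree_of_ne_zero
        (by rw [hD, coeff_dickson]; exact one_ne_zero))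
    have h2 := Polynomial.coeff_comp_degree_mul_degree (p := D)
      (q := Polynomial.X + Polynomial.C x₀)
      (by rw [Polynomial.natDegree_X_add_C]; exact one_ne_zero)
    rw [Polynomial.natDegree_X_add_C, Polynomial.leadingCoeff_X_add_C, one_pow, mul_one, mul_one,
      Polynomial.leadingCoeff, h1] at h2
    rw [hE, Polynomial.coeff_sub, Polynomial.coeff_C, if_neg hm0, sub_zero, h2, hD, coeff_dickson]
  obtain ⟨q, hq, hq1, hev⟩ := exists_eval1_eq_aeval_inv hEdeg
  have hval : ∀ {L : Type} [Field L] [Algebra ℂ L] (u : L), Polynomial.aeval u E =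
      Polynomial.aeval (u + algebraMap ℂ L x₀) D - algebraMap ℂ L (D.eval (-1 + x₀)) := by
    intro L _ _ u
    rw [hE, map_sub, Polynomial.aeval_comp, Polynomial.aeval_C]
    simp
  refine ⟨_, ⟨q, hq, by rw [hq1, hEm]; exact one_ne_zero, rfl⟩, ?_, ?_⟩
  · rw [hev _ zero_ne_one, hval]
    norm_num
  · have hp := onCurve_Xp hnd hzd
    have hn := onCurve_Xm hnd hzd
    have hp1 : W.Xp ≠ 1 := by simpa using hp.fst.ne_algebraMap 1
    have hn1 : W.Xm ≠ 1 := by simpa using hn.fst.ne_algebraMap 1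
    rw [hev _ hp1, hev _ hn1, hval, hval]
    congr 1
    have k1 := hconic hp
    have k2 := hconic hn
    have hUne : (W.Xp - 1)⁻¹ ≠ (W.Xm - 1)⁻¹ := fun h =>
      Xp_ne_Xm hnd hzd (sub_left_injective (inv_injective h))
    have hroot : algebraMap ℂ AlgFun W.cplus⁻¹ ^ m = algebraMap ℂ AlgFun W.cminus⁻¹ ^ m := by
      rw [← map_pow, ← map_pow, inv_pow, inv_pow, (cplus_pow_eq_iff hnd hm m).2 dvd_rfl]
    have hδL : algebraMap ℂ AlgFun W.cplus⁻¹ - algebraMap ℂ AlgFun W.cminus⁻¹ ≠ 0 := by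
      rw [← map_sub]
      exact (map_ne_zero_iff _ (algebraMap ℂ AlgFun).injective).2 hδ
    have hκ : algebraMap ℂ AlgFun (-(W.cplus⁻¹ * W.cminus⁻¹ * c / δ ^ 2)) =
        -(algebraMap ℂ AlgFun W.cplus⁻¹ * algebraMap ℂ AlgFun W.cminus⁻¹ * algebraMap ℂ AlgFun c /
          (algebraMap ℂ AlgFun W.cplus⁻¹ - algebraMap ℂ AlgFun W.cminus⁻¹) ^ 2) := by
      simp only [map_neg, map_div₀, map_mul, map_pow, hδ', map_sub]
    simp only at k1 k2
    generalize hρ : algebraMap ℂ AlgFun W.cplus⁻¹ = ρ at *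
    generalize hρ' : algebraMap ℂ AlgFun W.cminus⁻¹ = ρ' at *
    generalize (tvar - 1)⁻¹ + algebraMap ℂ AlgFun y₀ = V at *
    have hsum : ((W.Xp - 1)⁻¹ + algebraMap ℂ AlgFun x₀) + ((W.Xm - 1)⁻¹ + algebraMap ℂ AlgFun x₀) =
        (ρ + ρ') * V := by
      have := sub_ne_zero.2 hUne
      refine mul_left_cancel₀ this ?_
      linear_combination k1 - k2
    generalize (W.Xp - 1)⁻¹ + algebraMap ℂ AlgFun x₀ = U at *
    generalize (W.Xm - 1)⁻¹ + algebraMap ℂ AlgFun x₀ = U' at *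
    have hdick : ∀ {u : AlgFun}, (u - ρ * V) * (u - ρ' * V) = algebraMap ℂ AlgFun c →
        Polynomial.aeval u D = (ρ * (u - ρ' * V) / (ρ - ρ')) ^ m +
          (-(ρ' * (u - ρ * V)) / (ρ - ρ')) ^ m := by
      intro u hu
      rw [← aeval_dickson (c := -(W.cplus⁻¹ * W.cminus⁻¹ * c / δ ^ 2)), ← hD]
      · congr 2
        rw [← add_div, eq_div_iff hδL]
        ring
      · rw [hκ, ← hu]; field_simp
    rw [hdick k1, hdick k2]
    have hU' : U' = (ρ + ρ') * V - U := by rw [← hsum]; ring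
    rw [hU', div_pow, div_pow, div_pow, div_pow, ← add_div, ← add_div]
    congr 1
    have t1 : ρ * ((ρ + ρ') * V - U - ρ' * V) = -ρ * (U - ρ * V) := by ring
    have t2 : -(ρ' * ((ρ + ρ') * V - U - ρ * V)) = ρ' * (U - ρ' * V) := by ring
    have t3 : (-ρ) ^ m = (-ρ') ^ m := by rw [neg_pow, neg_pow ρ', hroot]
    rw [t1, t2, ← neg_mul, mul_pow, mul_pow, mul_pow, mul_pow, t3, hroot]
    ring

lemma poleForm_of_X_sub_one (q : Polynomial ℂ) (d : ℕ) :
    PoleForm (algebraMap _ (RatFunc ℂ) q / (RatFunc.X - 1) ^ d) d ((-1) ^ d * q.eval 1) := by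
  refine ⟨Polynomial.C ((-1) ^ d) * q, 1, by simp, ?_, by simp⟩
  have h : (1 - RatFunc.X : RatFunc ℂ) = -1 * (RatFunc.X - 1) := by ring
  have h2 : ((-1 : RatFunc ℂ) ^ d) ≠ 0 := pow_ne_zero _ (by norm_num)
  rw [mul_one, map_mul, RatFunc.algebraMap_C, map_pow _ (1 - Polynomial.X), map_sub, map_one,
    RatFunc.algebraMap_X, h, mul_pow, map_pow, map_neg, map_one, mul_div_mul_left _ _ h2]

lemma specAt_const_div_xvar_pow {L : Type*} [Field L] [Algebra ℂ L] {u v : L} (hu : u ≠ 0) (c : ℂ)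
    (d : ℕ) : SpecAt u v (algebraMap ℂ Rat2 c / xvar ^ d) (algebraMap ℂ L c / u ^ d) :=
  (SpecAt.const c).div (SpecAt.x.pow d) (pow_ne_zero d hu)

/-- A rational function that takes equal values at `X_+` and `X_-` and has a pole of order `d` at
`1` satisfies `c_+^d = c_-^d`. -/
lemma pow_eq_of_poleForm (hnd : W.NonDegenerate) (hzd : W.ZeroDrift) {f : RatFunc ℂ} {d : ℕ} {c : ℂ}
    (hf : PoleForm f d c) (hc : c ≠ 0) (h : eval1 f W.Xp = eval1 f W.Xm) :
    W.cplus ^ d = W.cminus ^ d := by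
  obtain ⟨μ, P, hP⟩ := exists_isPath hnd hzd
  have hdec : W.Decouples 0 f (toRat (eval2 0 W.Xp tvar - eval1 f W.Xp)) :=
    (decouples_of_branches hnd hzd rfl (by simp only [eval2_zero]; rw [h])).2
  have h1 := (hP.lead_decoupling hnd hzd (HasLead.zero d) hf.hasLead_fst hdec).1
  have h2 : ∀ {z : ℂ}, z ≠ 0 →
      eval2 (0 - algebraMap ℂ Rat2 c / xvar ^ d) z 1 = -(c / z ^ d) := by
    intro z hz
    have := ((SpecAt.zero (u := z) (v := (1 : ℂ))).sub (specAt_const_div_xvar_pow hz c d)).eval2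
    simpa using this
  have h3 := cplus_ne_zero hnd
  have h4 := cminus_ne_zero hnd
  rw [h2 h3, h2 h4, neg_inj, div_eq_div_iff (pow_ne_zero d h3) (pow_ne_zero d h4)] at h1
  exact (mul_left_cancel₀ hc h1).symm

lemma eval1_sub_C_mul {L : Type*} [Field L] [Algebra ℂ L] {u : L}
    (hu : Transcendental ℂ u) (c : ℂ) (f g : RatFunc ℂ) :
    eval1 (f - RatFunc.C c * g) u = eval1 f u - algebraMap ℂ L c * eval1 g u := by
  rw [← substHom_apply hu, ← substHom_apply hu, ← substHom_apply hu, map_sub, map_mul]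
  congr 2
  exact (substHom hu).commutes c

/-- A combination of two gluing functions in which the poles of order `m` cancel has a pole of smaller
order `j`; this forces `c_+^j = c_-^j`, hence `j = 0`. -/
lemma IsGluing.unique (hnd : W.NonDegenerate) (hzd : W.ZeroDrift) {m : ℕ}
    (hm : Real.pi / W.theta = m) {ω ω' : RatFunc ℂ} (h : W.IsGluing m ω) (h' : W.IsGluing m ω') :
    ∃ c : ℂ, c ≠ 0 ∧ ω' = RatFunc.C c * ω := by
  obtain ⟨⟨q, hq, hq1, hω⟩, h0, hX⟩ := h
  obtain ⟨⟨q', hq', hq1', hω'⟩, h0', hX'⟩ := h'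
  refine ⟨q'.eval 1 / q.eval 1, div_ne_zero hq1' hq1, sub_eq_zero.1 ?_⟩
  set c := q'.eval 1 / q.eval 1 with hc
  set r := q' - Polynomial.C c * q with hr
  have hX1 : (RatFunc.X - 1 : RatFunc ℂ) ≠ 0 := by
    intro h
    have : Transcendental ℂ (RatFunc.X : RatFunc ℂ) := RatFunc.transcendental_X
    exact this.ne_algebraMap 1 (by rw [map_one]; exact sub_eq_zero.1 h)
  have hf : ω' - RatFunc.C c * ω = algebraMap _ (RatFunc ℂ) r / (RatFunc.X - 1) ^ m := by
    rw [hω, hω', hr, map_sub, map_mul, RatFunc.algebraMap_C]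
    ring
  by_contra hne
  have hr0 : r ≠ 0 := by rintro h; rw [hf, h, map_zero, zero_div] at hne; exact hne rfl
  have hr1 : r.eval 1 = 0 := by
    rw [hr, Polynomial.eval_sub, Polynomial.eval_mul, Polynomial.eval_C, hc, div_mul_cancel₀ _ hq1,
      sub_self]
  have hrdeg : r.natDegree ≤ m :=
    (Polynomial.natDegree_sub_le _ _).trans
      (max_le hq' ((Polynomial.natDegree_C_mul_le _ _).trans hq))
  obtain ⟨s, hs, hs1⟩ := Polynomial.exists_eq_pow_rootMultiplicity_mul_and_not_dvd r hr0 1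
  set i := r.rootMultiplicity 1 with hi
  have hi0 : 0 < i := (Polynomial.rootMultiplicity_pos hr0).2 hr1
  have hs0 : s ≠ 0 := by rintro rfl; simp at hs1
  have hs1' : s.eval 1 ≠ 0 := fun h => hs1 (Polynomial.dvd_iff_isRoot.2 h)
  have hsdeg : i + s.natDegree ≤ m := by
    refine le_trans (le_of_eq ?_) hrdeg
    conv_rhs => rw [hs]
    rw [Polynomial.natDegree_mul (pow_ne_zero _ (Polynomial.X_sub_C_ne_zero 1)) hs0,
      Polynomial.natDegree_pow, Polynomial.natDegree_X_sub_C, mul_one]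
  have hf2 : ω' - RatFunc.C c * ω = algebraMap _ (RatFunc ℂ) s / (RatFunc.X - 1) ^ (m - i) := by
    rw [hf, div_eq_div_iff (pow_ne_zero _ hX1) (pow_ne_zero _ hX1)]
    conv_lhs => rw [hs]
    rw [map_mul, map_pow, map_sub, RatFunc.algebraMap_X, Polynomial.C_1, map_one, mul_right_comm,
      ← pow_add, Nat.add_sub_cancel' (by omega), mul_comm]
  have hroot : W.cplus ^ (m - i) = W.cminus ^ (m - i) := by
    refine pow_eq_of_poleForm hnd hzd (f := ω' - RatFunc.C c * ω)
      (by rw [hf2]; exact poleForm_of_X_sub_one s _)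
      (mul_ne_zero (pow_ne_zero _ (by norm_num)) hs1') ?_
    rw [eval1_sub_C_mul (onCurve_Xp hnd hzd).fst,
      eval1_sub_C_mul (onCurve_Xm hnd hzd).fst, hX, hX']
  -- As `0 < i`, the pole order `m - i` is zero, and the difference of the functions is constant.
  have him : m - i = 0 :=
    Nat.eq_zero_of_dvd_of_lt ((cplus_pow_eq_iff hnd hm _).1 hroot) (by omega)
  have hsC : s = Polynomial.C (s.coeff 0) :=
    Polynomial.eq_C_of_natDegree_eq_zero (by omega)
  have hr0' : r.eval 0 = 0 := by
    have e1 : q.eval 0 = 0 := by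
      rw [eval1_eq_div (p := q) (q := (Polynomial.X - 1) ^ m) (by simp [hω]) (by simp)] at h0
      simpa using h0
    have e2 : q'.eval 0 = 0 := by
      rw [eval1_eq_div (p := q') (q := (Polynomial.X - 1) ^ m) (by simp [hω']) (by simp)] at h0'
      simpa using h0'
    simp [hr, e1, e2]
  rw [hs, hsC] at hr0'
  have hs2 : s.coeff 0 = 0 := by simpa using hr0'
  exact hs0 (by rw [hsC, hs2, map_zero])

end Walk

/-! ### Homogeneous Laurent polynomials -/

/-- `f` is homogeneous of degree `-d`, and its denominator is a monomial: `f` is the product of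
`y^{-d}` and a Laurent polynomial in `x / y`. -/
def Laurent (f : Rat2) (d : ℕ) : Prop :=
  ∃ (Q : Polynomial ℂ) (a : ℕ),
    f * ((xvar / yvar) ^ a * yvar ^ d) = Polynomial.aeval (xvar / yvar) Q

namespace Laurent

variable {L : Type*} [Field L] [Algebra ℂ L] {u v : L} {f : Rat2} {d : ℕ}

lemma zero (d : ℕ) : Laurent 0 d := ⟨0, 0, by simp⟩

lemma specAt_ratio (hv : v ≠ 0) : SpecAt u v (xvar / yvar) (u / v) := SpecAt.x.div SpecAt.y hv

lemma exists_specAt (h : Laurent f d) : ∃ (Q : Polynomial ℂ) (a : ℕ),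
    f * ((xvar / yvar) ^ a * yvar ^ d) = Polynomial.aeval (xvar / yvar) Q ∧
    ∀ {L : Type} [Field L] [Algebra ℂ L] {u v : L}, u ≠ 0 → v ≠ 0 →
      SpecAt u v f (Polynomial.aeval (u / v) Q / ((u / v) ^ a * v ^ d)) := by
  obtain ⟨Q, a, hQ⟩ := h
  refine ⟨Q, a, hQ, fun {L} _ _ {u v} hu hv => ?_⟩
  have h1 : (xvar / yvar) ^ a * yvar ^ d ≠ 0 :=
    mul_ne_zero (pow_ne_zero _ (div_ne_zero xvar_ne_zero yvar_ne_zero))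
      (pow_ne_zero _ yvar_ne_zero)
  rw [eq_div_of_mul_eq h1 hQ]
  exact ((specAt_ratio hv).aeval Q).div (((specAt_ratio hv).pow a).mul (SpecAt.y.pow d))
    (mul_ne_zero (pow_ne_zero _ (div_ne_zero hu hv)) (pow_ne_zero _ hv))

lemma specAt {L : Type} [Field L] [Algebra ℂ L] {u v : L} (h : Laurent f d) (hu : u ≠ 0)
    (hv : v ≠ 0) : SpecAt u v f (eval2 f u v) := by
  obtain ⟨Q, a, -, hs⟩ := h.exists_specAt
  rw [(hs hu hv).eval2]
  exact hs hu hv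

/-- Homogeneity. -/
lemma eval2_ray {L : Type} [Field L] [Algebra ℂ L] {v : L} (h : Laurent f d) {z : ℂ} (hz : z ≠ 0)
    (hv : v ≠ 0) :
    eval2 f (algebraMap ℂ L z * v) v = algebraMap ℂ L (eval2 f z 1) / v ^ d := by
  obtain ⟨Q, a, -, hs⟩ := h.exists_specAt
  have hz' : algebraMap ℂ L z ≠ 0 := by simpa using hz
  rw [(hs (mul_ne_zero hz' hv) hv).eval2, (hs hz one_ne_zero).eval2, mul_div_cancel_right₀ _ hv,
    Polynomial.aeval_algebraMap_apply]
  simp only [map_div₀, map_pow, div_one, one_pow, mul_one, div_div]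

lemma eval2_const_mul {L : Type} [Field L] [Algebra ℂ L] {u v : L} (h : Laurent f d) (hu : u ≠ 0)
    (hv : v ≠ 0) (c : ℂ) : eval2 (algebraMap ℂ Rat2 c * f) u v = algebraMap ℂ L c * eval2 f u v :=
  ((SpecAt.const c).mul (h.specAt hu hv)).eval2

end Laurent

namespace Walk

variable {W : Walk}

/-! ### The continuous recursion -/

lemma gamPoly_roots (hnd : W.NonDegenerate) {L : Type*} [Field L] [Algebra ℂ L] (u v : L) :
    MvPolynomial.aeval ![u, v] W.gamPoly = algebraMap ℂ L ((W.sigma11 : ℂ) / 2) *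
      ((u - algebraMap ℂ L W.cplus * v) * (u - algebraMap ℂ L W.cminus * v)) := by
  have h1 := cplus_add_cminus hnd
  have h2 := cplus_mul_cminus hnd
  have hs := sigma11_ne hnd
  have e1 : (W.sigma12 : ℂ) = -(W.sigma11 / 2) * (W.cplus + W.cminus) := by
    rw [h1]; field_simp
  have e2 : (W.sigma22 : ℂ) / 2 = W.sigma11 / 2 * (W.cplus * W.cminus) := by
    rw [h2]; field_simp
  rw [gamPoly, e1, e2]
  simp
  ring

lemma specAt_gam (hnd : W.NonDegenerate) {L : Type*} [Field L] [Algebra ℂ L] (u v : L) :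
    SpecAt u v W.gam (algebraMap ℂ L ((W.sigma11 : ℂ) / 2) *
      ((u - algebraMap ℂ L W.cplus * v) * (u - algebraMap ℂ L W.cminus * v))) := by
  rw [← algebraMap_gamPoly, ← gamPoly_roots hnd]
  exact SpecAt.poly _

lemma gam_eq (hnd : W.NonDegenerate) : W.gam = algebraMap ℂ Rat2 ((W.sigma11 : ℂ) / 2) *
    ((xvar - algebraMap ℂ Rat2 W.cplus * yvar) * (xvar - algebraMap ℂ Rat2 W.cminus * yvar)) := by
  rw [← algebraMap_gamPoly, algebraMap_eq_aeval, gamPoly_roots hnd]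

/-- One step of the continuous recursion, for a homogeneous function `f` of degree `-d` and the
decoupling function `α / x^d`. -/
def contStep (W : Walk) (f : Rat2) (d : ℕ) (α : ℂ) : Rat2 :=
  (f - algebraMap ℂ Rat2 α / xvar ^ d -
    algebraMap ℂ Rat2 (eval2 f W.cplus 1 - α / W.cplus ^ d) / yvar ^ d) / W.gam

/-- `α / x^d` decouples `f` in the directions `(c_±, 1)`. -/
def RayDecouples (W : Walk) (f : Rat2) (d : ℕ) (α : ℂ) : Prop :=
  eval2 f W.cplus 1 - α / W.cplus ^ d = eval2 f W.cminus 1 - α / W.cminus ^ d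

lemma contStep_const_mul (hnd : W.NonDegenerate) {f : Rat2} {d : ℕ} (h : Laurent f d) (c α : ℂ) :
    W.contStep (algebraMap ℂ Rat2 c * f) d (c * α) = algebraMap ℂ Rat2 c * W.contStep f d α := by
  rw [contStep, contStep, h.eval2_const_mul (cplus_ne_zero hnd) one_ne_zero]
  simp only [Algebra.algebraMap_self, RingHom.id_apply, map_sub, map_mul, map_div₀, map_pow]
  ring

/-- The decoupling condition says that the numerator vanishes on both lines `x = c_± y`, so that it
is divisible by `γ`. -/
lemma _root_.Laurent.contStep (hnd : W.NonDegenerate) {f : Rat2} {d : ℕ} {α : ℂ} (h : Laurent f d)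
    (hα : W.RayDecouples f d α) : Laurent (W.contStep f d α) (d + 2) := by
  obtain ⟨Q, a, hQ, hs⟩ := h.exists_specAt
  have hs1 := sigma11_ne hnd
  set g : ℂ := eval2 f W.cplus 1 - α / W.cplus ^ d with hg
  let R : Polynomial ℂ := Q * Polynomial.X ^ d - Polynomial.C α * Polynomial.X ^ a -
    Polynomial.C g * Polynomial.X ^ (a + d)
  have hroot : ∀ {z : ℂ}, z ≠ 0 → eval2 f z 1 - α / z ^ d = g → R.eval z = 0 := by
    intro z hz hz1
    have := (hs hz one_ne_zero).eval2
    simp only [div_one, one_pow, mul_one, Polynomial.coe_aeval_eq_eval] at this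
    rw [this] at hz1
    simp only [R, Polynomial.eval_sub, Polynomial.eval_mul, Polynomial.eval_pow, Polynomial.eval_X,
      Polynomial.eval_C]
    rw [← hz1, pow_add]
    field_simp
    ring
  have hdvd : (Polynomial.X - Polynomial.C W.cplus) * (Polynomial.X - Polynomial.C W.cminus) ∣ R :=
    (Polynomial.isCoprime_X_sub_C_of_isUnit_sub
      (sub_ne_zero.2 (cplus_ne_cminus hnd)).isUnit).mul_dvd
      (Polynomial.dvd_iff_isRoot.2 (hroot (cplus_ne_zero hnd) hg.symm))
      (Polynomial.dvd_iff_isRoot.2 (hroot (cminus_ne_zero hnd) hα.symm))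
  obtain ⟨S, hS⟩ := hdvd
  refine ⟨Polynomial.C (2 / (W.sigma11 : ℂ)) * S, a + d, ?_⟩
  have hx := xvar_ne_zero
  have hy := yvar_ne_zero
  have hγ := gam_ne_zero hnd
  have hR := congrArg (Polynomial.aeval (xvar / yvar)) hS
  simp only [R, map_sub, map_mul, map_pow, Polynomial.aeval_X, Polynomial.aeval_C] at hR ⊢
  rw [← hQ] at hR
  have hγ' := gam_eq hnd
  have hsc : algebraMap ℂ Rat2 (2 / (W.sigma11 : ℂ)) *
      algebraMap ℂ Rat2 ((W.sigma11 : ℂ) / 2) = 1 := by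
    rw [← map_mul]
    have : 2 / (W.sigma11 : ℂ) * (W.sigma11 / 2) = 1 := by field_simp
    rw [this, map_one]
  have hγ2 : W.gam = algebraMap ℂ Rat2 ((W.sigma11 : ℂ) / 2) *
      ((xvar / yvar - algebraMap ℂ Rat2 W.cplus) * (xvar / yvar - algebraMap ℂ Rat2 W.cminus)) *
        yvar ^ 2 := by
    rw [hγ']; field_simp
  rw [Walk.contStep, ← hg, div_mul_eq_mul_div, div_eq_iff hγ, hγ2]
  have hz : xvar = xvar / yvar * yvar := by field_simp
  generalize hzz : xvar / yvar = z at *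
  rw [hz]
  have hz0 : z ≠ 0 := by rw [← hzz]; exact div_ne_zero hx hy
  have e1 : (f - algebraMap ℂ Rat2 α / (z * yvar) ^ d - algebraMap ℂ Rat2 g / yvar ^ d) *
      (z ^ (a + d) * yvar ^ (d + 2)) =
      (f * (z ^ a * yvar ^ d) * z ^ d - algebraMap ℂ Rat2 α * z ^ a -
        algebraMap ℂ Rat2 g * z ^ (a + d)) * yvar ^ 2 := by
    rw [mul_pow, pow_add, pow_add]
    field_simp
  rw [e1, hR]
  linear_combination -(z - algebraMap ℂ Rat2 W.cplus) * (z - algebraMap ℂ Rat2 W.cminus) *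
    Polynomial.aeval z S * yvar ^ 2 * hsc

/-! ### The linear reflections of the continuous problem -/

section Reflections

variable {L : Type*} [Field L] [Algebra ℂ L]

/-- The linear part of `Φ` at `(1, 1)`. -/
def linPhi (W : Walk) (q : L × L) : L × L :=
  (algebraMap ℂ L (W.cplus + W.cminus) * q.2 - q.1, q.2)

/-- The linear part of `Ψ` at `(1, 1)`. -/
def linPsi (W : Walk) (q : L × L) : L × L :=
  (q.1, algebraMap ℂ L (W.cplus⁻¹ + W.cminus⁻¹) * q.1 - q.2)

/-- The composition of the two reflections, a rotation by the angle `2 θ` in suitable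
coordinates. -/
def linTheta (W : Walk) : L × L → L × L := W.linPsi ∘ W.linPhi

lemma linPhi_linPhi (q : L × L) : W.linPhi (W.linPhi q) = q := by simp [linPhi]

lemma linPsi_linPsi (q : L × L) : W.linPsi (W.linPsi q) = q := by simp [linPsi]

/-- The eigenvectors of the rotation. -/
lemma linTheta_eigen (hnd : W.NonDegenerate) (q : L × L) :
    (W.linTheta q).1 - algebraMap ℂ L W.cminus * (W.linTheta q).2 =
      algebraMap ℂ L (W.cminus / W.cplus) * (q.1 - algebraMap ℂ L W.cminus * q.2) ∧
    (W.linTheta q).1 - algebraMap ℂ L W.cplus * (W.linTheta q).2 =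
      algebraMap ℂ L (W.cplus / W.cminus) * (q.1 - algebraMap ℂ L W.cplus * q.2) := by
  have h1 : algebraMap ℂ L W.cplus ≠ 0 := by simpa using cplus_ne_zero hnd
  have h2 : algebraMap ℂ L W.cminus ≠ 0 := by simpa using cminus_ne_zero hnd
  simp only [linTheta, linPsi, linPhi, Function.comp_apply, map_add, map_inv₀, map_div₀]
  constructor <;> · field_simp; ring

lemma linTheta_period (hnd : W.NonDegenerate) {m : ℕ} (hm : Real.pi / W.theta = m) (q : L × L) :
    W.linTheta^[m] q = q := by
  have hprim := isPrimitiveRoot hnd hm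
  have hit : ∀ i, (W.linTheta^[i] q).1 - algebraMap ℂ L W.cminus * (W.linTheta^[i] q).2 =
        algebraMap ℂ L (W.cminus / W.cplus) ^ i * (q.1 - algebraMap ℂ L W.cminus * q.2) ∧
      (W.linTheta^[i] q).1 - algebraMap ℂ L W.cplus * (W.linTheta^[i] q).2 =
        algebraMap ℂ L (W.cplus / W.cminus) ^ i * (q.1 - algebraMap ℂ L W.cplus * q.2) := by
    intro i
    induction i with
    | zero => simp
    | succ i ih =>
      have := linTheta_eigen hnd (W.linTheta^[i] q)
      rw [Function.iterate_succ_apply', this.1, this.2, ih.1, ih.2]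
      constructor <;> ring
  obtain ⟨e1, e2⟩ := hit m
  have h1 : algebraMap ℂ L (W.cplus / W.cminus) ^ m = 1 := by
    rw [← map_pow, hprim.pow_eq_one, map_one]
  have h2 : algebraMap ℂ L (W.cminus / W.cplus) ^ m = 1 := by
    rw [← map_pow, ← inv_div, inv_pow, hprim.pow_eq_one, inv_one, map_one]
  rw [h1, one_mul] at e2
  rw [h2, one_mul] at e1
  have hne : algebraMap ℂ L W.cplus - algebraMap ℂ L W.cminus ≠ 0 :=
    sub_ne_zero.2 fun h => cplus_ne_cminus hnd ((algebraMap ℂ L).injective h)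
  have hsnd : (W.linTheta^[m] q).2 = q.2 :=
    mul_left_cancel₀ hne (by linear_combination e1 - e2)
  refine Prod.ext ?_ hsnd
  rw [hsnd] at e1
  linear_combination e1

/-- The points of the plane that specialize to a multiple of `(c_+, 1)` or `(c_-, 1)` when
`(x, y) = (c_+, 1)`. -/
def OnRays (W : Walk) (q : Rat2 × Rat2) : Prop :=
  ∃ w : ℂ, w ≠ 0 ∧
    (SpecPt (W.cplus, 1) q (w * W.cplus, w) ∨ SpecPt (W.cplus, 1) q (w * W.cminus, w))

variable {q : Rat2 × Rat2} {P q' : ℂ × ℂ}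

lemma SpecPt.linPhi (h : SpecPt P q q') : SpecPt P (W.linPhi q) (W.linPhi q') :=
  ⟨((SpecAt.const _).mul h.2).sub h.1, h.2⟩

lemma SpecPt.linPsi (h : SpecPt P q q') : SpecPt P (W.linPsi q) (W.linPsi q') :=
  ⟨h.1, ((SpecAt.const _).mul h.1).sub h.2⟩

lemma linPhi_plus (w : ℂ) : W.linPhi (w * W.cplus, w) = (w * W.cminus, w) := by
  simp only [linPhi, Algebra.algebraMap_self, RingHom.id_apply]
  exact Prod.ext (by ring) rfl

lemma linPhi_minus (w : ℂ) : W.linPhi (w * W.cminus, w) = (w * W.cplus, w) := by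
  simp only [linPhi, Algebra.algebraMap_self, RingHom.id_apply]
  exact Prod.ext (by ring) rfl

lemma linPsi_plus (hnd : W.NonDegenerate) (w : ℂ) : W.linPsi (w * W.cplus, w) =
    (w * W.cplus / W.cminus * W.cminus, w * W.cplus / W.cminus) := by
  have h1 := cplus_ne_zero hnd
  have h2 := cminus_ne_zero hnd
  simp only [linPsi, Algebra.algebraMap_self, RingHom.id_apply]
  exact Prod.ext (by field_simp) (by field_simp; ring)

lemma linPsi_minus (hnd : W.NonDegenerate) (w : ℂ) : W.linPsi (w * W.cminus, w) =
    (w * W.cminus / W.cplus * W.cplus, w * W.cminus / W.cplus) := by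
  have h1 := cplus_ne_zero hnd
  have h2 := cminus_ne_zero hnd
  simp only [linPsi, Algebra.algebraMap_self, RingHom.id_apply]
  exact Prod.ext (by field_simp) (by field_simp; ring)

lemma linTheta_plus (hnd : W.NonDegenerate) (w : ℂ) : W.linTheta (w * W.cplus, w) =
    (w * (W.cminus / W.cplus) * W.cplus, w * (W.cminus / W.cplus)) := by
  rw [linTheta, Function.comp_apply, linPhi_plus, linPsi_minus hnd, mul_div_assoc]

lemma linTheta_minus (hnd : W.NonDegenerate) (w : ℂ) : W.linTheta (w * W.cminus, w) =
    (w * (W.cplus / W.cminus) * W.cminus, w * (W.cplus / W.cminus)) := by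
  rw [linTheta, Function.comp_apply, linPhi_minus, linPsi_plus hnd, mul_div_assoc]

lemma linTheta_iterate_plus (hnd : W.NonDegenerate) (w : ℂ) (i : ℕ) :
    W.linTheta^[i] (w * W.cplus, w) =
      (w * (W.cminus / W.cplus) ^ i * W.cplus, w * (W.cminus / W.cplus) ^ i) := by
  induction i with
  | zero => simp
  | succ i ih =>
    rw [Function.iterate_succ_apply', ih, linTheta_plus hnd, pow_succ, mul_assoc w]

lemma linTheta_iterate_minus (hnd : W.NonDegenerate) (w : ℂ) (i : ℕ) :
    W.linTheta^[i] (w * W.cminus, w) =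
      (w * (W.cplus / W.cminus) ^ i * W.cminus, w * (W.cplus / W.cminus) ^ i) := by
  induction i with
  | zero => simp
  | succ i ih =>
    rw [Function.iterate_succ_apply', ih, linTheta_minus hnd, pow_succ, mul_assoc w]

lemma specPt_linTheta_iterate (h : SpecPt P q q') (i : ℕ) :
    SpecPt P (W.linTheta^[i] q) (W.linTheta^[i] q') := by
  induction i with
  | zero => exact h
  | succ i ih =>
    rw [Function.iterate_succ_apply', Function.iterate_succ_apply']
    exact SpecPt.linPsi (SpecPt.linPhi ih)

lemma onRays_generic : W.OnRays genericPt :=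
  ⟨1, one_ne_zero, Or.inl (by rw [one_mul]; exact specPt_genericPt)⟩

lemma OnRays.psi (hnd : W.NonDegenerate) (h : W.OnRays q) : W.OnRays (W.linPsi q) := by
  have h1 := cplus_ne_zero hnd
  have h2 := cminus_ne_zero hnd
  obtain ⟨w, hw, h | h⟩ := h
  · exact ⟨_, div_ne_zero (mul_ne_zero hw h1) h2, Or.inr (by
      rw [← linPsi_plus hnd]; exact SpecPt.linPsi h)⟩
  · exact ⟨_, div_ne_zero (mul_ne_zero hw h2) h1, Or.inl (by
      rw [← linPsi_minus hnd]; exact SpecPt.linPsi h)⟩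

lemma OnRays.theta_iterate (hnd : W.NonDegenerate) (h : W.OnRays q) (i : ℕ) :
    W.OnRays (W.linTheta^[i] q) := by
  have h1 := cplus_ne_zero hnd
  have h2 := cminus_ne_zero hnd
  obtain ⟨w, hw, h | h⟩ := h
  · exact ⟨_, mul_ne_zero hw (pow_ne_zero i (div_ne_zero h2 h1)), Or.inl (by
      rw [← linTheta_iterate_plus hnd]; exact specPt_linTheta_iterate h i)⟩
  · exact ⟨_, mul_ne_zero hw (pow_ne_zero i (div_ne_zero h1 h2)), Or.inr (by
      rw [← linTheta_iterate_minus hnd]; exact specPt_linTheta_iterate h i)⟩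

lemma OnRays.ne_zero (hnd : W.NonDegenerate) (h : W.OnRays q) : q.1 ≠ 0 ∧ q.2 ≠ 0 := by
  obtain ⟨w, hw, h | h⟩ := h
  · exact ⟨h.1.ne_zero (mul_ne_zero hw (cplus_ne_zero hnd)), h.2.ne_zero hw⟩
  · exact ⟨h.1.ne_zero (mul_ne_zero hw (cminus_ne_zero hnd)), h.2.ne_zero hw⟩

/-- The value of `γ` at a point. -/
def gamAt (W : Walk) (q : L × L) : L := algebraMap ℂ L ((W.sigma11 : ℂ) / 2) *
  ((q.1 - algebraMap ℂ L W.cplus * q.2) * (q.1 - algebraMap ℂ L W.cminus * q.2))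

lemma gamAt_linTheta_iterate (hnd : W.NonDegenerate) (q : L × L) (i : ℕ) :
    W.gamAt (W.linTheta^[i] q) = W.gamAt q := by
  have h1 := cplus_ne_zero hnd
  have h2 := cminus_ne_zero hnd
  induction i with
  | zero => rfl
  | succ i ih =>
    rw [Function.iterate_succ_apply', ← ih, gamAt, gamAt, (linTheta_eigen hnd _).1,
      (linTheta_eigen hnd _).2]
    have h3 : algebraMap ℂ L (W.cplus / W.cminus) * algebraMap ℂ L (W.cminus / W.cplus) = 1 := by
      rw [← map_mul, div_mul_div_cancel₀ h2, div_self h1, map_one]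
    linear_combination algebraMap ℂ L ((W.sigma11 : ℂ) / 2) *
      (((W.linTheta^[i] q).1 - algebraMap ℂ L W.cplus * (W.linTheta^[i] q).2) *
        ((W.linTheta^[i] q).1 - algebraMap ℂ L W.cminus * (W.linTheta^[i] q).2)) * h3

lemma gamAt_linPsi (hnd : W.NonDegenerate) (q : L × L) :
    W.gamAt (W.linPsi q) = W.gamAt q := by
  have h1 : algebraMap ℂ L W.cplus ≠ 0 := by simpa using cplus_ne_zero hnd
  have h2 : algebraMap ℂ L W.cminus ≠ 0 := by simpa using cminus_ne_zero hnd
  simp only [gamAt, linPsi, map_add, map_inv₀]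
  field_simp
  ring

/-- The alternating sum of `f` over the orbit of the generic point under the two linear reflections
is zero. -/
def RayOrbitZero (W : Walk) (m : ℕ) (f : Rat2) : Prop :=
  ∑ i ∈ Finset.range m, (ev f (W.linTheta^[i] genericPt) -
    ev f (W.linTheta^[i] (W.linPsi genericPt))) = 0

lemma RayOrbitZero.contStep (hnd : W.NonDegenerate) {m : ℕ} (hm : Real.pi / W.theta = m)
    {f : Rat2} {d : ℕ} {α : ℂ} (h : W.RayOrbitZero m f) (hf : Laurent f d)
    (hα : W.RayDecouples f d α) : W.RayOrbitZero m (W.contStep f d α) := by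
  have hγ := gam_ne_zero hnd
  have hstep := Laurent.contStep hnd hf hα
  set g : ℂ := eval2 f W.cplus 1 - α / W.cplus ^ d with hg
  have hmul : W.contStep f d α * W.gam = f - algebraMap ℂ Rat2 α / xvar ^ d -
      algebraMap ℂ Rat2 g / yvar ^ d := by rw [Walk.contStep, div_mul_cancel₀ _ hγ]
  have hval : ∀ {q : Rat2 × Rat2}, W.OnRays q → W.gamAt q = W.gam →
      ev (W.contStep f d α) q = (ev f q - algebraMap ℂ Rat2 α / q.1 ^ d -
        algebraMap ℂ Rat2 g / q.2 ^ d) / W.gam := by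
    intro q hq hqγ
    obtain ⟨h1, h2⟩ := hq.ne_zero hnd
    have s1 := (hstep.specAt h1 h2).mul (specAt_gam hnd q.1 q.2)
    rw [hmul] at s1
    have s2 := ((hf.specAt h1 h2).sub (specAt_const_div_xvar_pow h1 α d)).sub
      ((SpecAt.const g).div (SpecAt.y.pow d) (pow_ne_zero d h2))
    have e := s1.unique s2
    rw [eq_div_iff hγ, ← e]
    congr 1
    rw [← hqγ, gamAt]
  have hgen : W.gamAt (genericPt : Rat2 × Rat2) = W.gam := (gam_eq hnd).symm
  have hT : ∀ p : Rat2 × Rat2, (W.linPsi ∘ W.linPhi)^[m] p = p := linTheta_period hnd hm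
  have o1 := orbit_sum_of_psi_invariant W.linPhi W.linPsi (hT genericPt)
    (fun i => linPhi_linPhi _) (fun i => linPsi_linPsi _)
    (fun q : Rat2 × Rat2 => algebraMap ℂ Rat2 α / q.1 ^ d) (fun p => rfl)
  have o2 := orbit_sum_of_phi_invariant W.linPhi W.linPsi (hT genericPt)
    (fun i => linPhi_linPhi _) (fun i => linPsi_linPsi _)
    (fun q : Rat2 × Rat2 => algebraMap ℂ Rat2 g / q.2 ^ d) (fun p => rfl)
  rw [RayOrbitZero] at h ⊢
  have hterm : ∀ i ∈ Finset.range m, ev (W.contStep f d α) (W.linTheta^[i] genericPt) -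
      ev (W.contStep f d α) (W.linTheta^[i] (W.linPsi genericPt)) =
      ((ev f (W.linTheta^[i] genericPt) - ev f (W.linTheta^[i] (W.linPsi genericPt))) -
        (algebraMap ℂ Rat2 α / (W.linTheta^[i] genericPt).1 ^ d -
          algebraMap ℂ Rat2 α / (W.linTheta^[i] (W.linPsi genericPt)).1 ^ d) -
        (algebraMap ℂ Rat2 g / (W.linTheta^[i] genericPt).2 ^ d -
          algebraMap ℂ Rat2 g / (W.linTheta^[i] (W.linPsi genericPt)).2 ^ d)) / W.gam := by
    intro i _
    rw [hval (onRays_generic.theta_iterate hnd i) (by rw [gamAt_linTheta_iterate hnd, hgen]),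
      hval ((onRays_generic.psi hnd).theta_iterate hnd i)
        (by rw [gamAt_linTheta_iterate hnd, gamAt_linPsi hnd, hgen])]
    ring
  rw [Finset.sum_congr rfl hterm, ← Finset.sum_div, Finset.sum_sub_distrib, Finset.sum_sub_distrib,
    h]
  simp only [linTheta] at o1 o2 ⊢
  rw [o1, o2]
  simp

/-- If `m` divides `d`, the orbit of `(c_+, 1)` lies on two rays on which `f` is constant up to
homogeneity, and the vanishing orbit sum compares the two values. -/
lemma RayOrbitZero.eval2_eq (hnd : W.NonDegenerate) {m : ℕ} (hm : Real.pi / W.theta = m)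
    {f : Rat2} {d : ℕ} (h : W.RayOrbitZero m f) (hf : Laurent f d) (hmd : m ∣ d) :
    eval2 f W.cplus 1 = eval2 f W.cminus 1 := by
  have h1 := cplus_ne_zero hnd
  have h2 := cminus_ne_zero hnd
  have hprim := isPrimitiveRoot hnd hm
  have r1 : (W.cplus / W.cminus) ^ d = 1 := (hprim.pow_eq_one_iff_dvd d).2 hmd
  have r2 : (W.cminus / W.cplus) ^ d = 1 := by rw [← inv_div, inv_pow, r1, inv_one]
  have hcomp : ∀ {q : Rat2 × Rat2} {z w : ℂ}, z ≠ 0 → w ≠ 0 → w ^ d = 1 →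
      SpecPt (W.cplus, 1) q (w * z, w) → SpecAt W.cplus 1 (ev f q) (eval2 f z 1) := by
    intro q z w hz hw hwd hq
    have hq1 : q.1 ≠ 0 := hq.1.ne_zero (mul_ne_zero hw hz)
    have hq2 : q.2 ≠ 0 := hq.2.ne_zero hw
    obtain ⟨Q, a, -, hs⟩ := hf.exists_specAt
    have hray := hf.eval2_ray (L := ℂ) hz hw
    simp only [Algebra.algebraMap_self, RingHom.id_apply, hwd, div_one] at hray
    rw [← hray, mul_comm z w, (hs (mul_ne_zero hw hz) hw).eval2, ev, (hs hq1 hq2).eval2]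
    exact ((hq.1.div hq.2 hw).aeval Q).div (((hq.1.div hq.2 hw).pow a).mul (hq.2.pow d))
      (mul_ne_zero (pow_ne_zero _ (div_ne_zero (mul_ne_zero hw hz) hw)) (pow_ne_zero _ hw))
  have hgen : SpecPt (W.cplus, (1 : ℂ)) genericPt (1 * W.cplus, 1) := by
    rw [one_mul]; exact specPt_genericPt
  have hpsi := SpecPt.linPsi (W := W) hgen
  rw [linPsi_plus hnd, one_mul] at hpsi
  have hsum : SpecAt W.cplus 1 (∑ i ∈ Finset.range m, (ev f (W.linTheta^[i] genericPt) -
      ev f (W.linTheta^[i] (W.linPsi genericPt))))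
      (∑ i ∈ Finset.range m, (eval2 f W.cplus 1 - eval2 f W.cminus 1)) := by
    refine SpecAt.sum _ fun i _ => (hcomp (w := 1 * (W.cminus / W.cplus) ^ i) h1 ?_ ?_ ?_).sub
      (hcomp (w := W.cplus / W.cminus * (W.cplus / W.cminus) ^ i) h2 ?_ ?_ ?_)
    · exact mul_ne_zero one_ne_zero (pow_ne_zero i (div_ne_zero h2 h1))
    · rw [one_mul, pow_right_comm, r2, one_pow]
    · rw [← linTheta_iterate_plus hnd]; exact specPt_linTheta_iterate hgen i
    · exact mul_ne_zero (div_ne_zero h1 h2) (pow_ne_zero i (div_ne_zero h1 h2))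
    · rw [mul_pow, pow_right_comm, r1, one_pow, one_mul]
    · rw [← linTheta_iterate_minus hnd]; exact specPt_linTheta_iterate hpsi i
  rw [RayOrbitZero] at h
  rw [h] at hsum
  have := hsum.unique SpecAt.zero
  rw [Finset.sum_const, Finset.card_range, nsmul_eq_mul] at this
  exact sub_eq_zero.1 ((mul_eq_zero.1 this).resolve_left (by exact_mod_cast m_ne_zero hnd hm))

end Reflections

/-! ### The decoupling functions of the continuous recursion -/

lemma cpy_ne_zero (hnd : W.NonDegenerate) : W.cpy ≠ 0 :=
  mul_ne_zero (by simpa using cplus_ne_zero hnd) yvar_ne_zero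

lemma cmy_ne_zero (hnd : W.NonDegenerate) : W.cmy ≠ 0 :=
  mul_ne_zero (by simpa using cminus_ne_zero hnd) yvar_ne_zero

/-- By homogeneity the decoupling condition is a condition in the directions `(c_±, 1)`. -/
lemma contDecouples_iff (hnd : W.NonDegenerate) {m k n : ℕ} {a : ℕ → ℂ} {α : ℂ}
    (h : Laurent (W.contL m k a n) (k * m + 2 * n)) :
    W.ContDecouples m k a n α ↔ W.RayDecouples (W.contL m k a n) (k * m + 2 * n) α := by
  have hy := pow_ne_zero (k * m + 2 * n) yvar_ne_zero
  rw [ContDecouples, RayDecouples, cpy, cmy, h.eval2_ray (cplus_ne_zero hnd) yvar_ne_zero,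
    h.eval2_ray (cminus_ne_zero hnd) yvar_ne_zero, ansatz, ansatz, mul_pow, mul_pow, ← div_div,
    ← div_div, ← sub_div, ← sub_div, div_left_inj' hy, ← map_pow, ← map_pow, ← map_div₀, ← map_div₀,
    ← map_sub, ← map_sub, (algebraMap ℂ Rat2).injective.eq_iff]
  constructor <;> intro h' <;> linear_combination -h'

/-- The first function of the recursion is also obtained by a step, from `0` and with the decoupling
function `-x^{-k m}`. -/
lemma contL_one (m k : ℕ) (a : ℕ → ℂ) : W.contL m k a 1 = W.contStep 0 (k * m) (-1) := by
  rw [contL, contStep, eval2_zero, cpy]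
  simp only [map_sub, map_zero, map_neg, map_one, map_div₀, map_pow, mul_pow]
  congr 1
  simp only [one_div, inv_pow, ← pow_mul, mul_comm m k, mul_inv]
  ring

lemma contL_add_two (hnd : W.NonDegenerate) {m k n : ℕ} {a : ℕ → ℂ}
    (h : Laurent (W.contL m k a (n + 1)) (k * m + 2 * (n + 1))) :
    W.contL m k a (n + 2) =
      W.contStep (W.contL m k a (n + 1)) (k * m + 2 * (n + 1)) (a (n + 1)) := by
  rw [contL, contStep, cpy, h.eval2_ray (cplus_ne_zero hnd) yvar_ne_zero]
  simp only [ansatz, map_sub, map_div₀, map_pow, mul_pow]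
  congr 1
  ring

lemma rayDecouples_zero (hnd : W.NonDegenerate) {m : ℕ} (hm : Real.pi / W.theta = m) (k : ℕ)
    (α : ℂ) : W.RayDecouples 0 (k * m) α := by
  rw [RayDecouples, eval2_zero, eval2_zero, (cplus_pow_eq_iff hnd hm _).2 (dvd_mul_left m k)]

/-- As long as the functions `a_j / x^{k m + 2 j}` decouple, `L(h_n^k)` is homogeneous with monomial
denominator, and its orbit sum vanishes. -/
lemma laurent_contL (hnd : W.NonDegenerate) {m : ℕ} (hm : Real.pi / W.theta = m) {k : ℕ}
    {a : ℕ → ℂ} (n : ℕ)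
    (h : ∀ j : ℕ, 1 ≤ j → j < n + 1 → W.ContDecouples m k a j (a j)) :
    Laurent (W.contL m k a (n + 1)) (k * m + 2 * (n + 1)) ∧
      W.RayOrbitZero m (W.contL m k a (n + 1)) := by
  induction n with
  | zero =>
    have h0 : W.RayOrbitZero m 0 := by simp [RayOrbitZero, ev, eval2_zero]
    have h1 := rayDecouples_zero hnd hm k (-1)
    rw [contL_one]
    exact ⟨(Laurent.zero _).contStep hnd h1, h0.contStep hnd hm (Laurent.zero _) h1⟩
  | succ n ih =>
    obtain ⟨i1, i2⟩ := ih fun j h1 h2 => h j h1 (by omega)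
    have h1 := (contDecouples_iff hnd i1).1 (h (n + 1) (by omega) (by omega))
    rw [contL_add_two hnd i1]
    exact ⟨i1.contStep hnd h1, i2.contStep hnd hm i1 h1⟩

/-- If `c_+^d ≠ c_-^d`, the decoupling condition is a linear equation for `α` with a unique
solution; otherwise it is satisfied by every `α`. -/
lemma exists_contDecouples (hnd : W.NonDegenerate) {m : ℕ} (hm : Real.pi / W.theta = m) {k n : ℕ}
    (hn : 1 ≤ n) {a : ℕ → ℂ}
    (h : ∀ j : ℕ, 1 ≤ j → j < n → W.ContDecouples m k a j (a j)) :
    RegularAt (W.contL m k a n) W.cpy yvar ∧ RegularAt (W.contL m k a n) W.cmy yvar ∧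
      ∃ α : ℂ, W.ContDecouples m k a n α ∧
        (¬ m ∣ 2 * n → ∀ α' : ℂ, W.ContDecouples m k a n α' → α' = α) := by
  obtain ⟨n, rfl⟩ := Nat.exists_eq_add_of_le' hn
  obtain ⟨hL, hO⟩ := laurent_contL hnd hm n h
  refine ⟨(hL.specAt (cpy_ne_zero hnd) yvar_ne_zero).regularAt,
    (hL.specAt (cmy_ne_zero hnd) yvar_ne_zero).regularAt, ?_⟩
  simp only [contDecouples_iff hnd hL, RayDecouples]
  have hdvd : m ∣ k * m + 2 * (n + 1) ↔ m ∣ 2 * (n + 1) := Nat.dvd_add_right (dvd_mul_left m k)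
  by_cases hd : m ∣ 2 * (n + 1)
  · refine ⟨0, ?_, fun h' => absurd hd h'⟩
    rw [hO.eval2_eq hnd hm hL (hdvd.2 hd), zero_div, zero_div]
  · have hne : 1 / W.cplus ^ (k * m + 2 * (n + 1)) - 1 / W.cminus ^ (k * m + 2 * (n + 1)) ≠ 0 := by
      rw [sub_ne_zero, one_div, one_div]
      exact fun h' => hd (hdvd.1 ((cplus_pow_eq_iff hnd hm _).1 (inv_injective h')))
    refine ⟨(eval2 (W.contL m k a (n + 1)) W.cplus 1 - eval2 (W.contL m k a (n + 1)) W.cminus 1) /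
      (1 / W.cplus ^ (k * m + 2 * (n + 1)) - 1 / W.cminus ^ (k * m + 2 * (n + 1))), ?_,
      fun _ α' hα' => ?_⟩
    · have := div_mul_cancel₀ (eval2 (W.contL m k a (n + 1)) W.cplus 1 -
        eval2 (W.contL m k a (n + 1)) W.cminus 1) hne
      linear_combination -this
    · rw [eq_div_iff hne]
      linear_combination -hα'

end Walk

/-! ### The discrete recursion and its limit -/

namespace PoleForm

variable {F G : RatFunc ℂ} {d d' : ℕ} {c c' : ℂ}

lemma mul (h : PoleForm F d c) (h' : PoleForm G d' c') : PoleForm (F * G) (d + d') (c * c') := by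
  obtain ⟨p, A, hA, rfl, rfl⟩ := h
  obtain ⟨p', A', hA', rfl, rfl⟩ := h'
  refine ⟨p * p', A * A', by simpa using ⟨hA, hA'⟩, ?_, by
    rw [Polynomial.eval_mul, Polynomial.eval_mul, div_mul_div_comm]⟩
  rw [div_mul_div_comm, ← map_mul, ← map_mul]
  congr 2
  ring

lemma pow (h : PoleForm F d c) (j : ℕ) : PoleForm (F ^ j) (j * d) (c ^ j) := by
  induction j with
  | zero => exact ⟨1, 1, by simp, by simp, by simp⟩
  | succ j ih => rw [pow_succ, pow_succ, add_mul, one_mul]; exact ih.mul h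

lemma sub_const (h : PoleForm F d c) (hd : d ≠ 0) (e : ℂ) :
    PoleForm (F - algebraMap ℂ (RatFunc ℂ) e) d c := by
  obtain ⟨p, A, hA, rfl, rfl⟩ := h
  have hX : (1 - Polynomial.X : Polynomial ℂ) ≠ 0 := by
    intro h0; simpa using congrArg (Polynomial.eval 0) h0
  have hA0 : A ≠ 0 := by rintro rfl; simp at hA
  have h0 : algebraMap (Polynomial ℂ) (RatFunc ℂ) ((1 - Polynomial.X) ^ d * A) ≠ 0 :=
    (map_ne_zero_iff _ (IsFractionRing.injective _ _)).2 (mul_ne_zero (pow_ne_zero _ hX) hA0)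
  refine ⟨p - Polynomial.C e * ((1 - Polynomial.X) ^ d * A), A, hA, ?_, by simp [hd]⟩
  rw [map_sub, sub_div, map_mul _ (Polynomial.C e), mul_div_cancel_right₀ _ h0]
  rfl

end PoleForm

lemma Laurent.const_mul {f : Rat2} {d : ℕ} (h : Laurent f d) (c : ℂ) :
    Laurent (algebraMap ℂ Rat2 c * f) d := by
  obtain ⟨Q, a, hQ⟩ := h
  exact ⟨Polynomial.C c * Q, a, by rw [mul_assoc, hQ, map_mul, Polynomial.aeval_C]⟩

namespace Walk

variable {W : Walk}

lemma RayDecouples.of_const_mul (hnd : W.NonDegenerate) {f : Rat2} {d : ℕ} {c α : ℂ} (hc : c ≠ 0)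
    (hf : Laurent f d) (h : W.RayDecouples (algebraMap ℂ Rat2 c * f) d (c * α)) :
    W.RayDecouples f d α := by
  rw [RayDecouples, hf.eval2_const_mul (cplus_ne_zero hnd) one_ne_zero,
    hf.eval2_const_mul (cminus_ne_zero hnd) one_ne_zero] at h
  simp only [Algebra.algebraMap_self, RingHom.id_apply] at h
  refine mul_left_cancel₀ hc ?_
  linear_combination h

/-- One step of the discrete recursion becomes, at lowest order, one step of the continuous
recursion. -/
lemma hasLead_nextM (hnd : W.NonDegenerate) (hzd : W.ZeroDrift) {M Λ : Rat2} {d : ℕ}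
    {F G : RatFunc ℂ} {c : ℂ} (hM : HasLead M d Λ) (hΛ : Laurent Λ d) (hF : PoleForm F d c)
    (hdec : W.Decouples M F G) :
    W.RayDecouples Λ d c ∧ HasLead (W.nextM M F G) (d + 2) (W.contStep Λ d c) := by
  obtain ⟨μ, P, hP⟩ := exists_isPath hnd hzd
  obtain ⟨h1, h2⟩ := hP.lead_decoupling hnd hzd hM hF.hasLead_fst hdec
  have hval : ∀ {z : ℂ}, z ≠ 0 →
      eval2 (Λ - algebraMap ℂ Rat2 c / xvar ^ d) z (1 : ℂ) = eval2 Λ z 1 - c / z ^ d :=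
    fun hz => ((hΛ.specAt hz one_ne_zero).sub (specAt_const_div_xvar_pow hz c d)).eval2
  refine ⟨by rw [RayDecouples, ← hval (cplus_ne_zero hnd), h1, hval (cminus_ne_zero hnd)], ?_⟩
  have := HasLead.nextM hnd hzd hM hF.hasLead_fst h2.hasLead_snd hdec
  rwa [hval (cplus_ne_zero hnd)] at this

section Recursion

variable {m k : ℕ} {ω : RatFunc ℂ}

lemma eval1_basisPoly {L : Type*} [Field L] [Algebra ℂ L] {u : L} (hu : Transcendental ℂ u)
    (d : ℂ) (k : ℕ) (ω : RatFunc ℂ) :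
    eval1 (-basisPoly d k ω) u = -basisPoly d k (eval1 ω u) := by
  rw [← substHom_apply hu, ← substHom_apply hu, map_neg, basisPoly, basisPoly, map_mul, map_pow,
    map_pow, map_sub, AlgHom.commutes]

/-- The function `P_k(ω)` takes the same value at `X_+` and `X_-`. -/
lemma IsGluing.decouples (hnd : W.NonDegenerate) (hzd : W.ZeroDrift) (hω : W.IsGluing m ω) (d : ℂ)
    (k : ℕ) : IsRationalFun (basisPoly d k (eval1 ω W.Xp)) ∧
      W.Decouples 0 (-basisPoly d k ω) (toRat (basisPoly d k (eval1 ω W.Xp))) := by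
  refine decouples_of_branches hnd hzd ?_ ?_
  · rw [eval2_zero, eval1_basisPoly (onCurve_Xp hnd hzd).fst, zero_sub, neg_neg]
  · rw [eval2_zero, eval1_basisPoly (onCurve_Xm hnd hzd).fst, zero_sub, neg_neg, hω.2.2]

lemma IsGluing.isRationalFun (hnd : W.NonDegenerate) (hzd : W.ZeroDrift) (hω : W.IsGluing m ω) :
    IsRationalFun (eval1 ω W.Xp) := by
  have := (hω.decouples hnd hzd 0 1).1
  simpa [basisPoly] using this

/-- The polynomial `P_k` has degree `k`, so that `P_k(ω)` has a pole of order `k m` at `1`. Its leading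
coefficient does not depend on the constant `d`. -/
lemma IsGluing.poleForm (hnd : W.NonDegenerate) (hm : Real.pi / W.theta = m)
    (hω : W.IsGluing m ω) : ∃ c : ℂ, c ≠ 0 ∧ ∀ (d : ℂ) (k : ℕ),
      PoleForm (basisPoly d k ω) (k * m) (c ^ k) := by
  obtain ⟨⟨q, -, hq, h⟩, -, -⟩ := hω
  have hω : PoleForm ω m ((-1) ^ m * q.eval 1) := by rw [h]; exact poleForm_of_X_sub_one q m
  refine ⟨(-1) ^ m * q.eval 1, mul_ne_zero (pow_ne_zero _ (by norm_num)) hq, fun d k => ?_⟩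
  have := (hω.pow ((k + 1) / 2)).mul ((hω.sub_const (m_ne_zero hnd hm) d).pow (k / 2))
  rwa [← add_mul, ← pow_add, show (k + 1) / 2 + k / 2 = k by omega] at this

/-- The first function of the recursion is also obtained by a step, from `0` and with the decoupling
function `-P_k(ω)`. -/
lemma discM_one (ω : RatFunc ℂ) (k : ℕ) : W.discM ω k 1 =
    W.nextM 0 (-basisPoly (W.d0 ω) k ω) (toRat (basisPoly (W.d0 ω) k (eval1 ω W.Xp))) := by
  rw [discM, discH, harmonic, nextM, eval1_basisPoly transcendental_xvar, zero_sub, neg_neg]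

lemma discM_add_two (ω : RatFunc ℂ) (k n : ℕ) : W.discM ω k (n + 2) =
    W.nextM (W.discM ω k (n + 1)) (W.discF ω k (n + 1))
      (toRat (W.remainder (W.discM ω k (n + 1)) (W.discF ω k (n + 1)))) := by
  rw [discM, discH]
  rfl

/-- All functions of the recursion have a lowest order term and vanishing orbit sum, so that the
next step is meaningful. -/
lemma exists_hasLead_discM (hnd : W.NonDegenerate) (hzd : W.ZeroDrift)
    (hm : Real.pi / W.theta = m) (hfin : W.FiniteGroup) (hω : W.IsGluing m ω) (k n : ℕ) :
    (∃ Λ, HasLead (W.discM ω k (n + 1)) (k * m + 2 * (n + 1)) Λ) ∧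
      W.OrbitZero (W.discM ω k (n + 1)) := by
  obtain ⟨μ, P, hP⟩ := exists_isPath hnd hzd
  induction n with
  | zero =>
    obtain ⟨c, -, hc⟩ := hω.poleForm hnd hm
    have hF := (hc (W.d0 ω) k).neg.hasLead_fst
    obtain ⟨-, hdec⟩ := hω.decouples hnd hzd (W.d0 ω) k
    have hG := (hP.lead_decoupling hnd hzd (HasLead.zero _) hF hdec).2.hasLead_snd
    rw [discM_one]
    exact ⟨⟨_, HasLead.nextM hnd hzd (HasLead.zero _) hF hG hdec⟩,
      OrbitZero.nextM hnd hzd hfin orbitZero_zero split_zero _ _⟩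
  | succ n ih =>
    obtain ⟨⟨Λ, hΛ⟩, h0⟩ := ih
    obtain ⟨c, hc⟩ := hP.poleForm_decouplingFun hnd hzd hΛ
    obtain ⟨-, -, hdec⟩ := decouples_decouplingFun hnd hzd hfin h0 hΛ.split
    have hG := (hP.lead_decoupling hnd hzd hΛ hc.hasLead_fst hdec).2.hasLead_snd
    rw [discM_add_two]
    exact ⟨⟨_, HasLead.nextM hnd hzd hΛ hc.hasLead_fst hG hdec⟩,
      OrbitZero.nextM hnd hzd hfin h0 hΛ.split _ _⟩

/-- The functions `x y H_n` have denominators `A(x) B(y)`, so that they are regular at all generic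
points of the curve. -/
lemma discStepOK (hnd : W.NonDegenerate) (hzd : W.ZeroDrift)
    (hm : Real.pi / W.theta = m) (hfin : W.FiniteGroup) (hω : W.IsGluing m ω) (k : ℕ) {n : ℕ}
    (hn : 1 ≤ n) : W.DiscStepOK ω k n := by
  obtain ⟨n, rfl⟩ := Nat.exists_eq_add_of_le' hn
  obtain ⟨⟨Λ, hΛ⟩, h0⟩ := exists_hasLead_discM hnd hzd hm hfin hω k n
  have hreg : ∀ {q : AlgFun × AlgFun}, W.OnCurve q → RegularAt (W.discM ω k (n + 1)) q.1 q.2 :=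
    fun hq => (hΛ.split.specAt hq.fst hq.snd).regularAt
  obtain ⟨h1, h2, -⟩ := decouples_decouplingFun hnd hzd hfin h0 hΛ.split
  refine ⟨fun i => ⟨?_, ?_⟩, ?_, ?_, isRationalFun_decouplingFun hnd hzd _, h2, h1⟩
  · exact hreg (q := W.Theta^[i] (tvar, W.Yp)) ((onCurve_Yp hnd hzd).theta_iterate hnd hzd i)
  · exact hreg (q := W.Theta^[i] (tvar, W.Ym)) ((onCurve_Ym hnd hzd).theta_iterate hnd hzd i)
  · exact hreg (q := (W.Xp, tvar)) (onCurve_Xp hnd hzd)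
  · exact hreg (q := (W.Xm, tvar)) (onCurve_Xm hnd hzd)

/-- The lowest order term of `x y H_n` is `L(h_n)`, up to a constant that does not depend on
`n`. -/
lemma exists_hasLead_contL (hnd : W.NonDegenerate) (hzd : W.ZeroDrift)
    (hm : Real.pi / W.theta = m) (hfin : W.FiniteGroup) (hω : W.IsGluing m ω) (k : ℕ) :
    ∃ (c : ℂ) (a : ℕ → ℂ), c ≠ 0 ∧ ∀ n : ℕ,
    PoleForm (W.discF ω k (n + 1)) (k * m + 2 * (n + 1)) (c * a (n + 1)) ∧
    HasLead (W.discM ω k (n + 1)) (k * m + 2 * (n + 1))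
      (algebraMap ℂ Rat2 c * W.contL m k a (n + 1)) ∧
    Laurent (W.contL m k a (n + 1)) (k * m + 2 * (n + 1)) ∧
    W.ContDecouples m k a (n + 1) (a (n + 1)) := by
  obtain ⟨μ, P, hP⟩ := exists_isPath hnd hzd
  obtain ⟨e, he, hpole⟩ := hω.poleForm hnd hm
  have hc : e ^ k ≠ 0 := pow_ne_zero k he
  have hF : ∀ n : ℕ, ∃ b, PoleForm (W.discF ω k (n + 1)) (k * m + 2 * (n + 1)) b := fun n =>
    have ⟨_, hΛ⟩ := (exists_hasLead_discM hnd hzd hm hfin hω k n).1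
    hP.poleForm_decouplingFun hnd hzd hΛ
  choose b hb using hF
  -- The factor `e ^ k` comes from `P_k(ω)` and persists, as the recursion is linear.
  let a : ℕ → ℂ := fun n => b (n - 1) / e ^ k
  have ha : ∀ n, e ^ k * a (n + 1) = b n := fun n => mul_div_cancel₀ _ hc
  refine ⟨e ^ k, a, hc, fun n => ?_⟩
  have hF' : ∀ n : ℕ, PoleForm (W.discF ω k (n + 1)) (k * m + 2 * (n + 1)) (e ^ k * a (n + 1)) :=
    fun n => by rw [ha]; exact hb n
  -- The decoupling condition at one step follows from the lowest order terms at this step.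
  have hstep : ∀ n, HasLead (W.discM ω k (n + 1)) (k * m + 2 * (n + 1))
        (algebraMap ℂ Rat2 (e ^ k) * W.contL m k a (n + 1)) →
      Laurent (W.contL m k a (n + 1)) (k * m + 2 * (n + 1)) →
      W.ContDecouples m k a (n + 1) (a (n + 1)) ∧
      Laurent (W.contL m k a (n + 2)) (k * m + 2 * (n + 2)) ∧
      HasLead (W.discM ω k (n + 2)) (k * m + 2 * (n + 2))
        (algebraMap ℂ Rat2 (e ^ k) * W.contL m k a (n + 2)) := by
    intro n h1 h2
    obtain ⟨-, h0⟩ := exists_hasLead_discM hnd hzd hm hfin hω k n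
    obtain ⟨h3, h4⟩ := hasLead_nextM hnd hzd h1 (h2.const_mul _) (hF' n)
      (decouples_decouplingFun hnd hzd hfin h0 h1.split).2.2
    have h5 := h3.of_const_mul hnd hc h2
    rw [contStep_const_mul hnd h2, ← contL_add_two hnd h2] at h4
    refine ⟨(contDecouples_iff hnd h2).2 h5, ?_, ?_⟩
    · rw [contL_add_two hnd h2]; exact h2.contStep hnd h5
    · rw [discM_add_two]; exact h4
  have hall : ∀ n, Laurent (W.contL m k a (n + 1)) (k * m + 2 * (n + 1)) ∧
      HasLead (W.discM ω k (n + 1)) (k * m + 2 * (n + 1))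
        (algebraMap ℂ Rat2 (e ^ k) * W.contL m k a (n + 1)) := by
    intro n
    induction n with
    | zero =>
      have h1 := rayDecouples_zero hnd hm k (-1)
      have h2 := (hasLead_nextM hnd hzd (HasLead.zero _) (Laurent.zero _)
        (hpole (W.d0 ω) k).neg (hω.decouples hnd hzd (W.d0 ω) k).2).2
      have h3 := contStep_const_mul hnd (Laurent.zero (k * m)) (e ^ k) (-1)
      rw [mul_zero, mul_neg_one] at h3
      rw [contL_one, discM_one]
      exact ⟨(Laurent.zero _).contStep hnd h1, by rw [← h3]; exact h2⟩
    | succ n ih => exact (hstep n ih.2 ih.1).2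
  exact ⟨hF' n, (hall n).2, (hall n).1, (hstep n (hall n).2 (hall n).1).1⟩

end Recursion

lemma tendsto_ofReal_punctured :
    Tendsto (fun μ : ℝ => (μ : ℂ)) (𝓝[≠] 0) (𝓝[≠] 0) := by
  refine tendsto_nhdsWithin_iff.2 ⟨?_, ?_⟩
  · exact (Complex.continuous_ofReal.tendsto' 0 0 Complex.ofReal_zero).mono_left nhdsWithin_le_nhds
  · filter_upwards [self_mem_nhdsWithin] with μ hμ
    simpa using hμ

lemma tendsto_one_sub_exp_div (x : ℂ) :
    Tendsto (fun μ : ℝ => (1 - Complex.exp (-((μ : ℂ) * x))) / μ) (𝓝[≠] 0) (𝓝 x) := by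
  have h : HasDerivAt (fun s : ℂ => -Complex.exp (-(s * x))) x 0 := by
    have := (((hasDerivAt_id (0 : ℂ)).mul_const x).neg.cexp).neg
    exact this.congr_deriv (by simp)
  refine ((hasDerivAt_iff_tendsto_slope.1 h).comp tendsto_ofReal_punctured).congr fun μ => ?_
  simp [slope_def_field]
  ring

lemma tendsto_exp_neg_mul (x : ℂ) :
    Tendsto (fun μ : ℝ => Complex.exp (-((μ : ℂ) * x))) (𝓝[≠] 0) (𝓝 1) := by
  have h : Continuous fun μ : ℝ => Complex.exp (-((μ : ℂ) * x)) := by fun_prop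
  exact (h.tendsto' 0 1 (by simp)).mono_left nhdsWithin_le_nhds

end Walk

end

theorem mainTheorem4 (W : Walk) (hnd : W.NonDegenerate) (hzd : W.ZeroDrift)
    (m : ℕ) (hm : Real.pi / W.theta = m) :
    -- the continuous decoupling ansatz always works
    (∀ k n : ℕ, 1 ≤ k → 1 ≤ n → ∀ a : ℕ → ℂ,
      (∀ j : ℕ, 1 ≤ j → j < n → W.ContDecouples m k a j (a j)) →
        RegularAt (W.contL m k a n) W.cpy yvar ∧ RegularAt (W.contL m k a n) W.cmy yvar ∧
        ∃ α : ℂ, W.ContDecouples m k a n α ∧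
          (¬ m ∣ 2 * n → ∀ α' : ℂ, W.ContDecouples m k a n α' → α' = α)) ∧
    -- the gluing function exists and is unique up to a constant factor
    (∃ ω : RatFunc ℂ, W.IsGluing m ω) ∧
    (∀ ω ω' : RatFunc ℂ, W.IsGluing m ω → W.IsGluing m ω' →
      ∃ c : ℂ, c ≠ 0 ∧ ω' = RatFunc.C c * ω) ∧
    -- convergence of the discrete functions to the continuous ones
    (W.FiniteGroup → ∀ ω : RatFunc ℂ, W.IsGluing m ω → IsRationalFun (eval1 ω W.Xp) ∧
      ∀ k : ℕ, 1 ≤ k →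
        (∀ n : ℕ, 1 ≤ n → W.DiscStepOK ω k n) ∧
        ∃ (a : ℕ → ℂ) (α : ℕ → ℂ), ∀ n : ℕ, 1 ≤ n →
          α n ≠ 0 ∧
          W.ContDecouples m k a n (a n) ∧
          (∀ x : ℂ, x ≠ 0 →
            Tendsto (fun μ : ℝ => (μ : ℂ) ^ (k * m + 2 * n) *
                eval1 (W.discF ω k n) (Complex.exp (-((μ : ℂ) * x))))
              (𝓝[≠] 0) (𝓝 (α n * Walk.ansatz m k n (a n) x))) ∧
          (∀ x y : ℂ, x ≠ 0 → y ≠ 0 →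
            Tendsto (fun μ : ℝ => (μ : ℂ) ^ (k * m + 2 * n) *
                eval2 (W.discH ω k n) (Complex.exp (-((μ : ℂ) * x)))
                  (Complex.exp (-((μ : ℂ) * y))))
              (𝓝[≠] 0) (𝓝 (α n * eval2 (W.contL m k a n) x y)))) := by
  refine ⟨fun k n _ hn a h => Walk.exists_contDecouples hnd hm hn h, Walk.exists_isGluing hnd hzd hm,
    fun ω ω' h h' => h.unique hnd hzd hm h', fun hfin ω hω => ⟨hω.isRationalFun hnd hzd, ?_⟩⟩
  refine fun k _ => ⟨fun n hn => Walk.discStepOK hnd hzd hm hfin hω k hn, ?_⟩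
  obtain ⟨c, a, hc, h⟩ := Walk.exists_hasLead_contL hnd hzd hm hfin hω k
  refine ⟨a, fun _ => c, fun n hn => ?_⟩
  obtain ⟨n, rfl⟩ := Nat.exists_eq_add_of_le' hn
  obtain ⟨hF, hM, hL, hdec⟩ := h n
  refine ⟨hc, hdec, fun x hx => ?_, fun x y hx hy => ?_⟩
  · have := hF.tendsto Walk.tendsto_ofReal_punctured (Walk.tendsto_one_sub_exp_div x) hx
      (Walk.tendsto_exp_neg_mul x)
    rwa [mul_div_assoc] at this
  · have hlim := HasLead.tendsto (HasLead.div_xy hM) hx hy Walk.tendsto_ofReal_punctured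
      (Walk.tendsto_one_sub_exp_div x) (Walk.tendsto_one_sub_exp_div y)
    rw [hL.eval2_const_mul hx hy] at hlim
    refine hlim.congr' ?_
    filter_upwards [self_mem_nhdsWithin] with μ hμ
    have hμ' : (μ : ℂ) ≠ 0 := by simpa using hμ
    rw [mul_div_cancel₀ _ hμ', mul_div_cancel₀ _ hμ', sub_sub_cancel, sub_sub_cancel]
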